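/- Let $d\ge 2$, let $A:\mathbb R^d\to\mathbb R^d$ be a real magnetic potential, $A\in L_{2,\mathrm{loc}}$, and let $H=(i\nabla+A(x))^2$ be the self-adjoint operator in $L_2(\mathbb R^d)$ defined by the quadratic form $\int|(i\nabla+A)u|^2dx$ on all $u\in L_2$ with $(i\nabla+A)u\in L_2$ (distributional sense); let $H_0=-\Delta$ be this operator for $A=0$. Wave operators are the strong limits $W_\pm(H,H_0)=\operatorname{s-lim}_{t\to\pm\infty}e^{iHt}e^{-iH_0t}$, when they exist, and the scattering operator is $\mathbf S(H,H_0)=W_+(H,H_0)^*W_-(H,H_0)$. Put $(\mathcal Ff)(\xi)=\hat f(\xi)=(2\pi)^{-d/2}\int e^{-i\langle x,\xi\rangle}f(x)\,dx$ (unitary in $L_2(\mathbb R^d)$) and $(Ff)(\lambda;\omega)=2^{-1/2}\lambda^{(d-2)/4}\hat f(\lambda^{1/2}\omega)$ for $\lambda>0$, $\omega\in\mathbb S^{d-1}$. A family $S(\lambda)$, $\lambda>0$, of bounded operators in $L_2(\mathbb S^{d-1})$ is called a scattering matrix of the pair $H_0,H$ if, for every $f\in L_2(\mathbb R^d)$,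 $(F\mathbf S(H,H_0)f)(\lambda)=S(\lambda)(Ff)(\lambda)$ for a.e. $\lambda>0$; the scattering amplitude $s(\omega,\omega';\lambda)$ is its (generalized) kernel. Let $\varphi:\mathbb R^d\to\mathbb R$ be a differentiable function such that $\varphi(x)=\varphi_0(x)+\varphi_1(x)$, where $\varphi_0(x)=\varphi_0(x/|x|)$ for $x\ne0$ and $\varphi_1(x)\to0$ as $|x|\to\infty$. Set $\tilde A=A+\operatorname{grad}\varphi$ and $\tilde H=e^{i\varphi}He^{-i\varphi}$. Then the following holds. (1) If $\tilde A\in L_{2,\mathrm{loc}}$ (so that $(i\nabla+\tilde A)^2$ is defined by its quadratic form), then $\tilde H=(i\nabla+\tilde A(x))^2$. (2) For each of the two signs, if the wave operator $W_\pm(H,H_0)$ exists, then $W_\pm(\tilde H,H_0)$ also exists and $$W_\pm(\tilde H,H_0)=e^{i\varphi(x)}\,W_\pm(H,H_0)\,\mathcal F^*e^{-i\varphi_0(\pm\xi)}\mathcal F.$$ (3) If both wave operators $W_\pm(H,H_0)$ exist, then $$\mathcal F\,\mathbf S(\tilde H,H_0)\,\mathcal F^*=e^{i\varphi_0(\xi)}\,\mathcal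 F\,\mathbf S(H,H_0)\,\mathcal F^*\,e^{-i\varphi_0(-\xi)} .$$ (4) Suppose that both wave operators $W_\pm(H,H_0)$ exist. If $S(\lambda)$ is a scattering matrix of the pair $H_0,H$, then $e^{i\varphi_0(\omega)}S(\lambda)e^{-i\varphi_0(-\omega)}$, $\lambda>0$, is a scattering matrix of the pair $H_0,\tilde H$. Moreover, for any scattering matrices $S(\lambda)$ and $\tilde S(\lambda)$ of the pairs $H_0,H$ and $H_0,\tilde H$, the relation $$\tilde S(\lambda)=e^{i\varphi_0(\omega)}S(\lambda)e^{-i\varphi_0(-\omega)}$$ and, in terms of the scattering amplitudes, $$\tilde s(\omega,\omega';\lambda)=e^{i\varphi_0(\omega)-i\varphi_0(-\omega')}s(\omega,\omega';\lambda)$$ hold for a.e. $\lambda>0$, and for all $\lambda>0$ if $S(\lambda)$ and $\tilde S(\lambda)$ are weakly continuous in $\lambda>0$. The relation between the amplitudes is understood for the generalized kernels, and also, almost everywhere, for the functions $s$, $\tilde s$ by which these kernels are given away from the diagonal $\omega=\omega'$, when the kernels are functions there; if $S(\lambda)$ has such a function $s$, then $\tilde S(\lambda)$ has one as well. -/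

import Mathlib

open MeasureTheory Filter Topology Set
open scoped ENNReal

noncomputable section

/-- Euclidean space `ℝ^d`. -/
abbrev RSpace (d : ℕ) : Type := EuclideanSpace ℝ (Fin d)

/-- The Hilbert space `L₂(ℝ^d)` of complex functions. -/
abbrev L2Space (d : ℕ) : Type := Lp ℂ 2 (volume : Measure (RSpace d))

/-- The unit sphere `𝕊^{d-1}`. -/
abbrev USphere (d : ℕ) : Type := Metric.sphere (0 : RSpace d) 1

/-- The surface measure on the unit sphere. -/
abbrev surfaceMeasure (d : ℕ) : Measure (USphere d) := (volume : Measure (RSpace d)).toSphere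

/-- The Hilbert space `L₂(𝕊^{d-1})` of complex functions. -/
abbrev L2Sphere (d : ℕ) : Type := Lp ℂ 2 (surfaceMeasure d)

/-! ### Multiplication operators and the Fourier transform -/

/-- The operator of multiplication by `e^{ig}` in `L₂(μ)`, for a real measurable function `g`. -/
def phaseMul {α : Type*} [MeasurableSpace α] {μ : Measure α} (g : α → ℝ) :
    Lp ℂ 2 μ →L[ℂ] Lp ℂ 2 μ :=
  open Classical in
  if h : MemLp (fun x => Complex.exp (Complex.I * (g x : ℂ))) ∞ μ then
    (ContinuousLinearMap.mul ℂ ℂ).holderL μ ∞ 2 2 (h.toLp _)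
  else 0

lemma eLpNorm_comp_smul {d : ℕ} {c : ℝ} (hc : c ≠ 0) (f : RSpace d → ℂ)
    (hf : AEStronglyMeasurable f volume) :
    eLpNorm (fun x => f (c • x)) 2 volume
      = (ENNReal.ofReal |(c ^ d)⁻¹|) ^ (1 / (2 : ℝ≥0∞)).toReal * eLpNorm f 2 volume := by
  have hmap : Measure.map (fun x : RSpace d => c • x) volume
      = ENNReal.ofReal |(c ^ d)⁻¹| • volume := by
    have h := Measure.map_addHaar_smul (volume : Measure (RSpace d)) hc
    rwa [finrank_euclideanSpace_fin] at h
  have hf' : AEStronglyMeasurable f (Measure.map (fun x : RSpace d => c • x) volume) := by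
    rw [hmap]; exact hf.smul_measure _
  have h1 := eLpNorm_map_measure (p := 2) hf' (measurable_const_smul c).aemeasurable
  rw [hmap, eLpNorm_smul_measure_of_ne_top (by norm_num)] at h1
  exact h1.symm

lemma quasiMeasurePreserving_const_smul {d : ℕ} {c : ℝ} (hc : c ≠ 0) :
    Measure.QuasiMeasurePreserving (fun x : RSpace d => c • x) volume volume := by
  refine ⟨measurable_const_smul c, ?_⟩
  rw [Measure.map_addHaar_smul (volume : Measure (RSpace d)) hc]
  exact Measure.smul_absolutelyContinuous

lemma memLp_comp_smul {d : ℕ} {c : ℝ} (hc : c ≠ 0) {f : RSpace d → ℂ} (hf : MemLp f 2 volume) :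
    MemLp (fun x => f (c • x)) 2 volume := by
  refine ⟨hf.1.comp_quasiMeasurePreserving (quasiMeasurePreserving_const_smul hc), ?_⟩
  rw [eLpNorm_comp_smul hc f hf.1]
  exact ENNReal.mul_lt_top (ENNReal.rpow_lt_top_of_nonneg (by simp) (by simp)) hf.2

/-- The operator `f ↦ f(c ·)` in `L₂(ℝ^d)`, for `c ≠ 0`. -/
def compSMul (d : ℕ) (c : ℝ) (hc : c ≠ 0) : L2Space d →L[ℂ] L2Space d :=
  LinearMap.mkContinuous
    { toFun := fun f => (memLp_comp_smul hc (Lp.memLp f)).toLp _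
      map_add' := fun f g => by
        rw [← MemLp.toLp_add]
        refine MemLp.toLp_congr _ _ ?_
        exact (quasiMeasurePreserving_const_smul hc).ae_eq_comp (Lp.coeFn_add f g)
      map_smul' := fun a f => by
        rw [RingHom.id_apply, ← MemLp.toLp_const_smul]
        refine MemLp.toLp_congr _ _ ?_
        exact (quasiMeasurePreserving_const_smul hc).ae_eq_comp (Lp.coeFn_smul a f) }
    ((ENNReal.ofReal |(c ^ d)⁻¹|) ^ (1 / (2 : ℝ≥0∞)).toReal).toReal
    (fun f => by
      simp only [LinearMap.coe_mk, AddHom.coe_mk]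
      rw [Lp.norm_toLp, eLpNorm_comp_smul hc _ (Lp.aestronglyMeasurable f), ENNReal.toReal_mul,
        Lp.norm_def])

/-- The unitary Fourier transform `(𝓕 f)(ξ) = (2π)^{-d/2} ∫ e^{-i⟨x,ξ⟩} f(x) dx` in `L₂(ℝ^d)`.
Mathlib's transform is `∫ e^{-2πi⟨x,ξ⟩} f(x) dx`, so it has to be evaluated at `ξ / (2π)`. -/
def fourierL2 (d : ℕ) : L2Space d →L[ℂ] L2Space d :=
  (((2 * Real.pi) ^ (-(d : ℝ) / 2) : ℝ) : ℂ) •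
    (compSMul d (2 * Real.pi)⁻¹ (by positivity)).comp
      ((Lp.fourierTransformₗᵢ (RSpace d) ℂ).toContinuousLinearEquiv :
        L2Space d →L[ℂ] L2Space d)

/-- The Fourier multiplier `𝓕* e^{ig(ξ)} 𝓕`. -/
def fourierPhase {d : ℕ} (g : RSpace d → ℝ) : L2Space d →L[ℂ] L2Space d :=
  (ContinuousLinearMap.adjoint (fourierL2 d)).comp ((phaseMul g).comp (fourierL2 d))

/-! ### The magnetic Schrödinger operator -/

/-- The vector field `A` belongs to `L₂` locally. -/
def LocallyL2 {d : ℕ} (A : RSpace d → RSpace d) : Prop :=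
  ∀ K : Set (RSpace d), IsCompact K → MemLp A 2 (volume.restrict K)

/-- The classical `j`-th partial derivative. -/
def partialD {d : ℕ} (j : Fin d) (ψ : RSpace d → ℂ) (x : RSpace d) : ℂ :=
  fderiv ℝ ψ x (EuclideanSpace.single j 1)

/-- `(i∇ + A) u = g` in the sense of distributions, where `u` and the components of `g` are
in `L₂(ℝ^d)`; in order that `A u` be a distribution, it is required to be locally integrable. -/
def IsMagneticGradient {d : ℕ} (A : RSpace d → RSpace d) (u : L2Space d)
    (g : Fin d → L2Space d) : Prop :=
  ∀ j : Fin d,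
    LocallyIntegrable (fun x => ((A x j : ℝ) : ℂ) * u x) volume ∧
    ∀ ψ : RSpace d → ℂ, ContDiff ℝ (⊤ : ℕ∞) ψ → HasCompactSupport ψ →
      -Complex.I * (∫ x, u x * partialD j ψ x) + (∫ x, ((A x j : ℝ) : ℂ) * u x * ψ x)
        = ∫ x, g j x * ψ x

lemma integrable_L2_mul {d : ℕ} (u : L2Space d) {ψ : RSpace d → ℂ} (hψ : Continuous ψ)
    (hc : HasCompactSupport ψ) : Integrable (fun x => u x * ψ x) volume :=
  (Lp.memLp u).integrable_mul (hψ.memLp_of_hasCompactSupport (p := 2) hc)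

lemma integrable_loc_mul {d : ℕ} {f ψ : RSpace d → ℂ} (hf : LocallyIntegrable f volume)
    (hψ : Continuous ψ) (hc : HasCompactSupport ψ) : Integrable (fun x => f x * ψ x) volume := by
  simpa [smul_eq_mul, mul_comm] using hf.integrable_smul_left_of_hasCompactSupport hψ hc

lemma continuous_partialD {d : ℕ} (j : Fin d) {ψ : RSpace d → ℂ} (hψ : ContDiff ℝ (⊤ : ℕ∞) ψ) :
    Continuous (partialD j ψ) :=
  (hψ.continuous_fderiv (by simp)).clm_apply continuous_const

lemma hasCompactSupport_partialD {d : ℕ} (j : Fin d) {ψ : RSpace d → ℂ}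
    (hc : HasCompactSupport ψ) : HasCompactSupport (partialD j ψ) :=
  hc.fderiv_apply (𝕜 := ℝ) _

lemma IsMagneticGradient.zero {d : ℕ} (A : RSpace d → RSpace d) :
    IsMagneticGradient A 0 (fun _ => 0) := by
  intro j
  have h0 : ∀ F : RSpace d → ℂ, (fun x => F x * (0 : L2Space d) x) =ᵐ[volume] fun _ => 0 := by
    intro F
    exact ae_of_all _ fun x => by simp
  refine ⟨(locallyIntegrable_zero (X := RSpace d) (ε'' := ℂ) (μ := volume)).congr (h0 _).symm, ?_⟩
  intro ψ _ _
  have h1 : ∀ F : RSpace d → ℂ, (∫ x, (0 : L2Space d) x * F x) = 0 := by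
    intro F
    rw [← integral_zero (RSpace d) ℂ (μ := volume)]
    refine integral_congr_ae ?_
    filter_upwards [h0 F] with x hx
    rw [mul_comm, hx]
  have h2 : (∫ x, ((A x j : ℝ) : ℂ) * (0 : L2Space d) x * ψ x) = 0 := by
    rw [← integral_zero (RSpace d) ℂ (μ := volume)]
    refine integral_congr_ae ?_
    filter_upwards [h0 (fun x => ((A x j : ℝ) : ℂ))] with x hx
    rw [hx, zero_mul]
  rw [h1, h1, h2]; simp

lemma IsMagneticGradient.add {d : ℕ} {A : RSpace d → RSpace d} {u v : L2Space d}
    {g h : Fin d → L2Space d} (hu : IsMagneticGradient A u g) (hv : IsMagneticGradient A v h) :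
    IsMagneticGradient A (u + v) (fun j => g j + h j) := by
  intro j
  have e1 : (fun x => ((A x j : ℝ) : ℂ) * (u + v) x) =ᵐ[volume]
      (fun x => ((A x j : ℝ) : ℂ) * u x) + (fun x => ((A x j : ℝ) : ℂ) * v x) := by
    filter_upwards [Lp.coeFn_add u v] with x hx
    rw [hx]; simp only [Pi.add_apply, mul_add]
  refine ⟨((hu j).1.add (hv j).1).congr e1.symm, ?_⟩
  intro ψ hψ hc
  have key : ∀ (a b : L2Space d) (F : RSpace d → ℂ), Continuous F → HasCompactSupport F →
      (∫ x, (a + b) x * F x) = (∫ x, a x * F x) + ∫ x, b x * F x := by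
    intro a b F hF hFc
    rw [← integral_add (integrable_L2_mul a hF hFc) (integrable_L2_mul b hF hFc)]
    refine integral_congr_ae ?_
    filter_upwards [Lp.coeFn_add a b] with x hx
    rw [hx]; simp only [Pi.add_apply, add_mul]
  have key2 : (∫ x, ((A x j : ℝ) : ℂ) * (u + v) x * ψ x)
      = (∫ x, ((A x j : ℝ) : ℂ) * u x * ψ x) + ∫ x, ((A x j : ℝ) : ℂ) * v x * ψ x := by
    rw [← integral_add (integrable_loc_mul (hu j).1 hψ.continuous hc)
      (integrable_loc_mul (hv j).1 hψ.continuous hc)]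
    refine integral_congr_ae ?_
    filter_upwards [e1] with x hx
    rw [hx]; simp only [Pi.add_apply, add_mul]
  rw [key _ _ _ (continuous_partialD j hψ) (hasCompactSupport_partialD j hc),
    key _ _ _ hψ.continuous hc, key2, ← (hu j).2 ψ hψ hc, ← (hv j).2 ψ hψ hc]
  ring

lemma IsMagneticGradient.smul {d : ℕ} {A : RSpace d → RSpace d} {u : L2Space d}
    {g : Fin d → L2Space d} (c : ℂ) (hu : IsMagneticGradient A u g) :
    IsMagneticGradient A (c • u) (fun j => c • g j) := by
  intro j
  have e1 : (fun x => ((A x j : ℝ) : ℂ) * (c • u) x) =ᵐ[volume]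
      c • (fun x => ((A x j : ℝ) : ℂ) * u x) := by
    filter_upwards [Lp.coeFn_smul c u] with x hx
    simp only [hx, Pi.smul_apply, smul_eq_mul]; ring
  refine ⟨((hu j).1.smul c).congr e1.symm, ?_⟩
  intro ψ hψ hc
  have key : ∀ (a : L2Space d) (F : RSpace d → ℂ),
      (∫ x, (c • a) x * F x) = c * (∫ x, a x * F x) := by
    intro a F
    rw [← integral_const_mul]
    refine integral_congr_ae ?_
    filter_upwards [Lp.coeFn_smul c a] with x hx
    simp only [hx, Pi.smul_apply, smul_eq_mul]; ring
  have key2 : (∫ x, ((A x j : ℝ) : ℂ) * (c • u) x * ψ x)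
      = c * (∫ x, ((A x j : ℝ) : ℂ) * u x * ψ x) := by
    rw [← integral_const_mul]
    refine integral_congr_ae ?_
    filter_upwards [e1] with x hx
    rw [hx]; simp only [Pi.smul_apply, smul_eq_mul]; ring
  rw [key, key, key2, ← (hu j).2 ψ hψ hc]
  ring

/-- The graph of the operator associated with the quadratic form `∫ |(i∇ + A) u|² dx`, whose
domain consists of all `u ∈ L₂` with `(i∇ + A) u ∈ L₂`: the pairs `(u, f)` such that `u` is in the
domain of the form and `⟨(i∇ + A) v, (i∇ + A) u⟩ = ⟨v, f⟩` for all `v` in this domain. -/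
def magneticGraph {d : ℕ} (A : RSpace d → RSpace d) : Submodule ℂ (L2Space d × L2Space d) where
  carrier := {p | ∃ g, IsMagneticGradient A p.1 g ∧
    ∀ v h, IsMagneticGradient A v h → ∑ j, inner ℂ (h j) (g j) = inner ℂ v p.2}
  zero_mem' := ⟨fun _ => 0, IsMagneticGradient.zero A, fun v h _ => by simp⟩
  add_mem' := by
    rintro p q ⟨g, hg, hp⟩ ⟨g', hg', hq⟩
    refine ⟨_, hg.add hg', fun v h hv => ?_⟩
    simp only [inner_add_right, Finset.sum_add_distrib, Prod.snd_add]
    rw [hp v h hv, hq v h hv]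
  smul_mem' := by
    rintro c p ⟨g, hg, hp⟩
    refine ⟨_, hg.smul c, fun v h hv => ?_⟩
    simp only [inner_smul_right, ← Finset.mul_sum, Prod.smul_snd]
    rw [hp v h hv]

/-- The magnetic Schrödinger operator `H = (i∇ + A)²` in `L₂(ℝ^d)`, defined through its
quadratic form. -/
def magneticSchrodinger {d : ℕ} (A : RSpace d → RSpace d) : L2Space d →ₗ.[ℂ] L2Space d :=
  (magneticGraph A).toLinearPMap

/-- The free operator `H₀ = -Δ = (i∇)²`. -/
def freeHamiltonian (d : ℕ) : L2Space d →ₗ.[ℂ] L2Space d :=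
  magneticSchrodinger (fun _ => 0)

/-- The operator `e^{iφ} H e^{-iφ}`, with domain `e^{iφ} D(H)`. -/
def gaugeConj {d : ℕ} (φ : RSpace d → ℝ) (H : L2Space d →ₗ.[ℂ] L2Space d) :
    L2Space d →ₗ.[ℂ] L2Space d where
  domain := H.domain.comap (phaseMul (fun x => -φ x)).toLinearMap
  toFun := (phaseMul φ).toLinearMap ∘ₗ H.toFun ∘ₗ
    ((phaseMul (fun x => -φ x)).toLinearMap.restrict fun _ hx => hx)

/-! ### Unitary groups, wave operators and scattering operators -/

/-- `U t = e^{-itH}`: a strongly continuous one-parameter unitary group whose generator is `H`,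
that is, `f ∈ D(H)` and `H f = g` if and only if `U t f` is differentiable at `t = 0` with
derivative `-i g`. -/
structure IsUnitaryGroup {d : ℕ} (H : L2Space d →ₗ.[ℂ] L2Space d)
    (U : ℝ → L2Space d →L[ℂ] L2Space d) : Prop where
  zero : U 0 = ContinuousLinearMap.id ℂ (L2Space d)
  add : ∀ s t, U (s + t) = (U s).comp (U t)
  norm_map : ∀ t f, ‖U t f‖ = ‖f‖
  continuous : ∀ f, Continuous fun t => U t f
  generator : ∀ f g, (f, g) ∈ H.graph ↔
    Tendsto (fun t : ℝ => ((t⁻¹ : ℝ) : ℂ) • (U t f - f)) (𝓝[≠] 0) (𝓝 (-Complex.I • g))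

/-- The unitary group `e^{-itH}` of a self-adjoint operator `H`. -/
def unitaryGroup {d : ℕ} (H : L2Space d →ₗ.[ℂ] L2Space d) : ℝ → L2Space d →L[ℂ] L2Space d :=
  open Classical in
  if h : ∃ U, IsUnitaryGroup H U then h.choose else fun _ => 0

/-- `W` is the strong limit of `e^{iHt} e^{-iH₀t}` along `l`, which is `atTop` for `W₊` and
`atBot` for `W₋`. -/
def IsWaveOperator {d : ℕ} (H H₀ : L2Space d →ₗ.[ℂ] L2Space d) (l : Filter ℝ)
    (W : L2Space d →L[ℂ] L2Space d) : Prop :=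
  ∀ f, Tendsto (fun t : ℝ => unitaryGroup H (-t) (unitaryGroup H₀ t f)) l (𝓝 (W f))

/-- The wave operator for the pair `H₀, H` exists. -/
def WaveOperatorExists {d : ℕ} (H H₀ : L2Space d →ₗ.[ℂ] L2Space d) (l : Filter ℝ) : Prop :=
  ∃ W, IsWaveOperator H H₀ l W

/-- The wave operator `W_±(H, H₀)`, with `l = atTop` for `+` and `l = atBot` for `-`. -/
def waveOperator {d : ℕ} (H H₀ : L2Space d →ₗ.[ℂ] L2Space d) (l : Filter ℝ) :
    L2Space d →L[ℂ] L2Space d :=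
  open Classical in
  if h : WaveOperatorExists H H₀ l then h.choose else 0

/-- The scattering operator `𝐒(H, H₀) = W₊* W₋`. -/
def scatteringOperator {d : ℕ} (H H₀ : L2Space d →ₗ.[ℂ] L2Space d) :
    L2Space d →L[ℂ] L2Space d :=
  (ContinuousLinearMap.adjoint (waveOperator H H₀ atTop)).comp (waveOperator H H₀ atBot)

/-! ### The scattering matrix -/

/-- `(F f)(λ; ω) = 2^{-1/2} λ^{(d-2)/4} (𝓕 f)(λ^{1/2} ω)` as an element of `L₂(𝕊^{d-1})`; for
every `f` this is defined for almost every `λ > 0`. -/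
def energySlice {d : ℕ} (lam : ℝ) (f : L2Space d) : L2Sphere d :=
  open Classical in
  if h : MemLp (fun ω : USphere d => (((2 : ℝ) ^ (-(1 / 2) : ℝ) * lam ^ (((d : ℝ) - 2) / 4) : ℝ) : ℂ)
      * fourierL2 d f (Real.sqrt lam • (ω : RSpace d))) 2 (surfaceMeasure d)
  then h.toLp _ else 0

/-- The family `S(λ)`, `λ > 0`, of bounded operators in `L₂(𝕊^{d-1})` is the scattering matrix of
the operator `T` in `L₂(ℝ^d)`: `(F T f)(λ) = S(λ) (F f)(λ)` for almost every `λ > 0`. -/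
def IsScatteringMatrix {d : ℕ} (T : L2Space d →L[ℂ] L2Space d)
    (S : ℝ → L2Sphere d →L[ℂ] L2Sphere d) : Prop :=
  ∀ f, ∀ᵐ lam ∂(volume.restrict (Ioi (0 : ℝ))),
    energySlice lam (T f) = S lam (energySlice lam f)

/-- Weak continuity of an operator family in `λ > 0`. -/
def WeaklyContinuousOnPos {d : ℕ} (S : ℝ → L2Sphere d →L[ℂ] L2Sphere d) : Prop :=
  ∀ u v, ContinuousOn (fun lam => inner ℂ u (S lam v)) (Ioi (0 : ℝ))

/-- The operator `e^{iφ₀(ω)} T e^{-iφ₀(-ω)}` in `L₂(𝕊^{d-1})`. -/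
def sphereGauge {d : ℕ} (φ₀ : RSpace d → ℝ) (T : L2Sphere d →L[ℂ] L2Sphere d) :
    L2Sphere d →L[ℂ] L2Sphere d :=
  (phaseMul fun ω : USphere d => φ₀ ω).comp
    (T.comp (phaseMul fun ω : USphere d => -φ₀ (-(ω : RSpace d))))

/-- The kernel of `T`, as a generalized function on `𝕊^{d-1} × 𝕊^{d-1}`, evaluated at
`u(ω) v(ω')`. -/
def kernelPairing {d : ℕ} (T : L2Sphere d →L[ℂ] L2Sphere d) (u v : L2Sphere d) : ℂ :=
  ∫ ω, u ω * T v ω ∂(surfaceMeasure d)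

/-- Away from the diagonal `ω = ω'` the kernel of `T` is the function `s(ω, ω')`:
`∫ u (T v) dω = ∬ u(ω) s(ω, ω') v(ω') dω dω'` for bounded `u`, `v` with disjoint supports. (On the
diagonal the kernel may contain a Dirac function or a singular integral.) -/
def IsOffDiagonalKernel {d : ℕ} (T : L2Sphere d →L[ℂ] L2Sphere d)
    (s : USphere d → USphere d → ℂ) : Prop :=
  ∀ (u v : USphere d → ℂ), MemLp u ∞ (surfaceMeasure d) → ∀ hv : MemLp v ∞ (surfaceMeasure d),
    Disjoint (tsupport u) (tsupport v) →
    Integrable (fun p : USphere d × USphere d => u p.1 * s p.1 p.2 * v p.2)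
      ((surfaceMeasure d).prod (surfaceMeasure d)) ∧
    ∫ ω, u ω * T ((hv.mono_exponent le_top).toLp v) ω ∂(surfaceMeasure d)
      = ∫ p : USphere d × USphere d, u p.1 * s p.1 p.2 * v p.2
          ∂((surfaceMeasure d).prod (surfaceMeasure d))

/-- The function `e^{iφ₀(ω) - iφ₀(-ω')}`. -/
def amplitudeFactor {d : ℕ} (φ₀ : RSpace d → ℝ) (ω ω' : USphere d) : ℂ :=
  Complex.exp (Complex.I * (φ₀ ω : ℂ) - Complex.I * (φ₀ (-(ω' : RSpace d)) : ℂ))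

/-- The kernels of `T` and `T'` satisfy `s'(ω, ω') = e^{iφ₀(ω) - iφ₀(-ω')} s(ω, ω')`, as
generalized functions and, where they are given by functions away from the diagonal, for these
functions almost everywhere. -/
def KernelsGaugeRelated {d : ℕ} (φ₀ : RSpace d → ℝ) (T T' : L2Sphere d →L[ℂ] L2Sphere d) : Prop :=
  (∀ u v, kernelPairing T' u v = kernelPairing T (phaseMul (fun ω : USphere d => φ₀ ω) u)
    (phaseMul (fun ω : USphere d => -φ₀ (-(ω : RSpace d))) v)) ∧
  (∀ s, IsOffDiagonalKernel T s →
    IsOffDiagonalKernel T' (fun ω ω' => amplitudeFactor φ₀ ω ω' * s ω ω')) ∧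
  (∀ s s', IsOffDiagonalKernel T s → IsOffDiagonalKernel T' s' →
    ∀ᵐ p ∂((surfaceMeasure d).prod (surfaceMeasure d)),
      s' p.1 p.2 = amplitudeFactor φ₀ p.1 p.2 * s p.1 p.2)

end

/-! The core is the factorization e^{-itH₀} = c M D 𝓕 M, where M is multiplication by e^{i|x|²/4t}
and D is the dilation v ↦ v(x/2t) (`exists_fourierPhase_eq`). A multiplication by ψ(x) commutes with
M and passes through D as multiplication by ψ(2tξ), and M tends strongly to the identity as t → ±∞.
Since φ(2tξ) → φ₀(±ξ) for ξ ≠ 0, the vectors e^{-iφ} e^{-itH₀} f and e^{-itH₀} 𝓕* e^{-iφ₀(±ξ)} 𝓕 f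
are asymptotically equal (`tendsto_phaseMul_free_sub`): a free particle of momentum ξ is found near
2tξ. Together with the conjugation e^{itH̃} = e^{iφ} e^{itH} e^{-iφ} (`unitaryGroup_gaugeConj`) this
gives the wave operators (`waveOperatorExists_gaugeConj`). In W₊* W₋ the outer factors e^{iφ}
cancel, which gives the scattering operator.

The abstract group of H₀ becomes a Fourier multiplier because e^{-it|ξ|²} solves the defining
conditions (`isUnitaryGroup_freeHamiltonian`) and a group is determined by its generator
(`IsUnitaryGroup.unique`). The generator is computed from the form in `mem_magneticGraph_zero_iff`.

The identity H̃ = (i∇ + Ã)² comes from inserting e^{iφ}ψ as a test function in the weak definition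
of i∇ + A (`IsMagneticGradient.gauge`). As φ is only differentiable, that function is not smooth; it
is admissible by mollification, its gradient being in L₂ because grad φ = Ã - A is locally in L₂
(`integral_mul_partialD_of_forall_contDiff`).

For the scattering matrix, φ₀ is homogeneous of degree 0, so its phases act in the same way on the
sphere at every energy (`energySlice_eq_phaseMul`). A scattering matrix is unique for a.e. λ
(`IsScatteringMatrix.ae_eq`), and weak continuity removes the exceptional set. For d ≥ 2 the
diagonal is a null set, so an off-diagonal kernel is determined a.e. (`IsOffDiagonalKernel.ae_eq`).
-/

noncomputable section

/-! ### Multiplication by unimodular functions. -/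

section Phase

variable {α : Type*} [MeasurableSpace α] {μ : Measure α}

lemma norm_cexp_I_mul_ofReal (t : ℝ) : ‖Complex.exp (Complex.I * (t : ℂ))‖ = 1 := by
  rw [mul_comm, Complex.norm_exp_ofReal_mul_I]

lemma measurable_phase {g : α → ℝ} (hg : Measurable g) :
    Measurable fun x => Complex.exp (Complex.I * (g x : ℂ)) := by
  fun_prop

lemma memLp_phase {g : α → ℝ} (hg : Measurable g) :
    MemLp (fun x => Complex.exp (Complex.I * (g x : ℂ))) ∞ μ :=
  memLp_top_of_bound (measurable_phase hg).aestronglyMeasurable 1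
    (ae_of_all _ fun _ => (norm_cexp_I_mul_ofReal _).le)

lemma phaseMul_coeFn {g : α → ℝ} (hg : Measurable g) (f : Lp ℂ 2 μ) :
    phaseMul g f =ᵐ[μ] fun x => Complex.exp (Complex.I * (g x : ℂ)) * f x := by
  rw [phaseMul, dif_pos (memLp_phase hg)]
  filter_upwards [(ContinuousLinearMap.mul ℂ ℂ).coeFn_holder (r := 2)
    ((memLp_phase hg).toLp _ : Lp ℂ ∞ μ) f, (memLp_phase (μ := μ) hg).coeFn_toLp] with x hx h2
  rw [ContinuousLinearMap.holderL_apply_apply, hx, h2]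
  rfl

lemma phaseMul_phaseMul {g h : α → ℝ} (hg : Measurable g) (hh : Measurable h) (f : Lp ℂ 2 μ) :
    phaseMul g (phaseMul h f) = phaseMul (fun x => g x + h x) f := by
  refine Lp.ext ?_
  filter_upwards [phaseMul_coeFn hg (phaseMul h f), phaseMul_coeFn hh f,
    phaseMul_coeFn (hg.fun_add hh) f] with x h1 h2 h3
  rw [h1, h2, h3, ← mul_assoc, ← Complex.exp_add]
  push_cast
  ring_nf

lemma phaseMul_zero (f : Lp ℂ 2 μ) : phaseMul (fun _ => (0 : ℝ)) f = f := by
  refine Lp.ext ?_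
  filter_upwards [phaseMul_coeFn (measurable_const (a := (0 : ℝ))) f] with x h1
  simp [h1]

lemma phaseMul_neg_phaseMul {g : α → ℝ} (hg : Measurable g) (f : Lp ℂ 2 μ) :
    phaseMul (fun x => -g x) (phaseMul g f) = f := by
  rw [phaseMul_phaseMul hg.fun_neg hg]
  simp [phaseMul_zero]

lemma phaseMul_phaseMul_neg {g : α → ℝ} (hg : Measurable g) (f : Lp ℂ 2 μ) :
    phaseMul g (phaseMul (fun x => -g x) f) = f := by
  rw [phaseMul_phaseMul hg hg.fun_neg]
  simp [phaseMul_zero]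

lemma norm_phaseMul {g : α → ℝ} (hg : Measurable g) (f : Lp ℂ 2 μ) : ‖phaseMul g f‖ = ‖f‖ := by
  refine le_antisymm ?_ ?_ <;> refine Lp.norm_le_norm_of_ae_le ?_ <;>
  · filter_upwards [phaseMul_coeFn hg f] with x h1
    rw [h1, norm_mul, norm_cexp_I_mul_ofReal, one_mul]

lemma inner_phaseMul {g : α → ℝ} (hg : Measurable g) (u v : Lp ℂ 2 μ) :
    inner ℂ (phaseMul g u) (phaseMul g v) = inner ℂ u v := by
  rw [L2.inner_def, L2.inner_def]
  refine integral_congr_ae ?_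
  filter_upwards [phaseMul_coeFn hg u, phaseMul_coeFn hg v] with x h1 h2
  have h3 : (starRingEnd ℂ) (Complex.exp (Complex.I * (g x : ℂ)))
      * Complex.exp (Complex.I * (g x : ℂ)) = 1 := by
    rw [mul_comm, Complex.mul_conj, Complex.normSq_eq_norm_sq, norm_cexp_I_mul_ofReal]
    simp
  simp only [RCLike.inner_apply, h1, h2, map_mul]
  linear_combination (v x * (starRingEnd ℂ) (u x)) * h3

lemma adjoint_phaseMul {g : α → ℝ} (hg : Measurable g) :
    ContinuousLinearMap.adjoint (phaseMul (μ := μ) g) = phaseMul fun x => -g x := by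
  symm
  rw [ContinuousLinearMap.eq_adjoint_iff]
  intro u v
  rw [← inner_phaseMul hg, phaseMul_phaseMul_neg hg]

end Phase

/-! ### Unitarity of the rescaled Fourier transform. -/

section Fourier

variable {d : ℕ}

lemma compSMul_coeFn {c : ℝ} (hc : c ≠ 0) (f : L2Space d) :
    compSMul d c hc f =ᵐ[volume] fun x => f (c • x) :=
  MemLp.coeFn_toLp (memLp_comp_smul hc (Lp.memLp f))

lemma norm_compSMul {c : ℝ} (hc : c ≠ 0) (f : L2Space d) :
    ‖compSMul d c hc f‖ = |c| ^ (-(d : ℝ) / 2) * ‖f‖ := by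
  have h : ‖compSMul d c hc f‖
      = ((ENNReal.ofReal |(c ^ d)⁻¹|) ^ (1 / (2 : ℝ≥0∞)).toReal).toReal * ‖f‖ := by
    change ‖(memLp_comp_smul hc (Lp.memLp f)).toLp _‖ = _
    rw [Lp.norm_toLp, eLpNorm_comp_smul hc _ (Lp.aestronglyMeasurable f), ENNReal.toReal_mul,
      Lp.norm_def]
  rw [h, ← ENNReal.toReal_rpow, ENNReal.toReal_ofReal (abs_nonneg _), abs_inv, abs_pow,
    ← Real.rpow_natCast, ← Real.rpow_neg (abs_nonneg _), ← Real.rpow_mul (abs_nonneg _)]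
  congr 2
  simp
  ring

lemma compSMul_compSMul_inv {c : ℝ} (hc : c ≠ 0) (f : L2Space d) :
    compSMul d c hc (compSMul d c⁻¹ (inv_ne_zero hc) f) = f := by
  refine Lp.ext ?_
  filter_upwards [compSMul_coeFn hc (compSMul d c⁻¹ (inv_ne_zero hc) f),
    (quasiMeasurePreserving_const_smul hc).ae_eq_comp (compSMul_coeFn (inv_ne_zero hc) f)]
    with x h1 h2
  simp only [Function.comp_apply] at h2
  rw [h1, h2, smul_smul, inv_mul_cancel₀ hc, one_smul]

lemma fourierL2_apply (f : L2Space d) :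
    fourierL2 d f = (((2 * Real.pi) ^ (-(d : ℝ) / 2) : ℝ) : ℂ) •
      compSMul d (2 * Real.pi)⁻¹ (by positivity) (Lp.fourierTransformₗᵢ (RSpace d) ℂ f) := rfl

/-- Dilation by 1/(2π) multiplies the norm by (2π)^{d/2}, which the prefactor compensates. -/
lemma norm_fourierL2 (f : L2Space d) : ‖fourierL2 d f‖ = ‖f‖ := by
  have hpi : (0 : ℝ) < 2 * Real.pi := by positivity
  rw [fourierL2_apply, norm_smul, norm_compSMul, LinearIsometryEquiv.norm_map, Complex.norm_real,
    Real.norm_of_nonneg (by positivity), abs_inv, abs_of_pos hpi, ← mul_assoc,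
    Real.inv_rpow hpi.le, mul_inv_cancel₀ (by positivity), one_mul]

lemma fourierL2_surjective : Function.Surjective (fourierL2 d) := by
  intro g
  have hpi : (2 * Real.pi) ≠ 0 := by positivity
  have hc : (((2 * Real.pi) ^ (-(d : ℝ) / 2) : ℝ) : ℂ) ≠ 0 := by
    exact_mod_cast (by positivity : (0 : ℝ) < (2 * Real.pi) ^ (-(d : ℝ) / 2)).ne'
  refine ⟨(Lp.fourierTransformₗᵢ (RSpace d) ℂ).symm ((((2 * Real.pi) ^ (-(d : ℝ) / 2) : ℝ) : ℂ)⁻¹ •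
    compSMul d (2 * Real.pi)⁻¹⁻¹ (inv_ne_zero (inv_ne_zero hpi)) g), ?_⟩
  rw [fourierL2_apply, LinearIsometryEquiv.apply_symm_apply, map_smul, compSMul_compSMul_inv,
    smul_smul, mul_inv_cancel₀ hc, one_smul]

lemma inner_fourierL2 (f g : L2Space d) :
    inner ℂ (fourierL2 d f) (fourierL2 d g) = inner ℂ f g :=
  (⟨(fourierL2 d : L2Space d →ₗ[ℂ] L2Space d), norm_fourierL2⟩ :
    L2Space d →ₗᵢ[ℂ] L2Space d).inner_map_map f g

lemma adjoint_fourierL2_fourierL2 (f : L2Space d) :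
    ContinuousLinearMap.adjoint (fourierL2 d) (fourierL2 d f) = f := by
  refine ext_inner_left ℂ fun v => ?_
  rw [ContinuousLinearMap.adjoint_inner_right, inner_fourierL2]

lemma fourierL2_adjoint_fourierL2 (f : L2Space d) :
    fourierL2 d (ContinuousLinearMap.adjoint (fourierL2 d) f) = f := by
  obtain ⟨g, rfl⟩ := fourierL2_surjective f
  rw [adjoint_fourierL2_fourierL2]

lemma fourierL2_injective : Function.Injective (fourierL2 d) := fun f g h => by
  rw [← adjoint_fourierL2_fourierL2 f, h, adjoint_fourierL2_fourierL2]

lemma fourierL2_fourierPhase (g : RSpace d → ℝ) (f : L2Space d) :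
    fourierL2 d (fourierPhase g f) = phaseMul g (fourierL2 d f) := by
  simp only [fourierPhase, ContinuousLinearMap.comp_apply, fourierL2_adjoint_fourierL2]

lemma norm_fourierPhase {g : RSpace d → ℝ} (hg : Measurable g) (f : L2Space d) :
    ‖fourierPhase g f‖ = ‖f‖ := by
  rw [← norm_fourierL2, fourierL2_fourierPhase, norm_phaseMul hg, norm_fourierL2]

end Fourier

/-! ### Uniqueness of unitary groups and their behaviour under gauge conjugation. -/

section UnitaryGroup

variable {d : ℕ} {H : L2Space d →ₗ.[ℂ] L2Space d} {U V : ℝ → L2Space d →L[ℂ] L2Space d}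

lemma IsUnitaryGroup.add_apply (hU : IsUnitaryGroup H U) (s t : ℝ) (f : L2Space d) :
    U (s + t) f = U s (U t f) := by
  rw [hU.add]; rfl

lemma IsUnitaryGroup.zero_apply (hU : IsUnitaryGroup H U) (f : L2Space d) : U 0 f = f := by
  rw [hU.zero]; rfl

/-- The domain of the generator is invariant under the group. -/
lemma IsUnitaryGroup.map_mem_graph (hU : IsUnitaryGroup H U) {f g : L2Space d}
    (h : (f, g) ∈ H.graph) (t : ℝ) : (U t f, U t g) ∈ H.graph := by
  rw [hU.generator] at h ⊢
  have h1 := ((U t).continuous.tendsto _).comp h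
  rw [map_smul] at h1
  refine h1.congr fun r => ?_
  simp only [Function.comp_apply, map_smul, map_sub]
  rw [← hU.add_apply, ← hU.add_apply, add_comm]

/-- The domain of the generator of a unitary group is dense. -/
lemma IsUnitaryGroup.dense_domain (hU : IsUnitaryGroup H U) :
    Dense {f : L2Space d | ∃ g, (f, g) ∈ H.graph} := by
  intro f
  -- Averaging over time: Φ(ε)/ε lies in the domain of the generator and tends to f as ε → 0.
  set Φ : ℝ → L2Space d := fun x => ∫ s in (0 : ℝ)..x, U s f
  have hΦ : ∀ x, HasDerivAt Φ (U x f) x := fun x =>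
    intervalIntegral.integral_hasDerivAt_right ((hU.continuous f).intervalIntegrable _ _)
      ((hU.continuous f).stronglyMeasurableAtFilter _ _) (hU.continuous f).continuousAt
  have hΦ0 : Φ 0 = 0 := intervalIntegral.integral_same
  have hshift : ∀ t ε, U t (Φ ε) = Φ (ε + t) - Φ t := by
    intro t ε
    have h1 : U t (Φ ε) = ∫ s in (0 : ℝ)..ε, U (s + t) f := by
      rw [← ContinuousLinearMap.intervalIntegral_comp_comm _
        ((hU.continuous f).intervalIntegrable _ _)]
      simp only [← hU.add_apply, add_comm]
    rw [h1, intervalIntegral.integral_comp_add_right (fun s => U s f), zero_add,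
      intervalIntegral.integral_interval_sub_left ((hU.continuous f).intervalIntegrable _ _)
        ((hU.continuous f).intervalIntegrable _ _)]
  have hmem : ∀ ε, (Φ ε, Complex.I • (U ε f - f)) ∈ H.graph := by
    intro ε
    rw [hU.generator]
    have h1 : HasDerivAt (fun t => Φ (ε + t) - Φ t) (U ε f - f) 0 := by
      have h2 : HasDerivAt (fun t => Φ (ε + t)) (U ε f) 0 := by
        have := (hΦ (ε + 0)).comp_const_add ε 0
        rwa [add_zero] at this
      have h3 := hΦ 0
      rw [hU.zero_apply] at h3
      exact h2.sub h3
    rw [hasDerivAt_iff_tendsto_slope_zero] at h1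
    rw [smul_smul, neg_mul, Complex.I_mul_I, neg_neg, one_smul]
    refine h1.congr fun t => ?_
    rw [hshift, Complex.coe_smul, zero_add, add_zero, hΦ0, sub_zero]
    rfl
  have hlim : Tendsto (fun ε : ℝ => ε⁻¹ • Φ ε) (𝓝[≠] 0) (𝓝 f) := by
    have h1 := hΦ 0
    rw [hU.zero_apply, hasDerivAt_iff_tendsto_slope_zero] at h1
    refine h1.congr fun t => ?_
    rw [zero_add, hΦ0, sub_zero]
  refine mem_closure_of_tendsto hlim (Eventually.of_forall fun ε => ?_)
  refine ⟨((ε⁻¹ : ℝ) : ℂ) • Complex.I • (U ε f - f), ?_⟩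
  have := H.graph.smul_mem ((ε⁻¹ : ℝ) : ℂ) (hmem ε)
  rwa [Prod.smul_mk, Complex.coe_smul] at this

/-- A unitary group is determined by its generator. -/
lemma IsUnitaryGroup.unique (hU : IsUnitaryGroup H U) (hV : IsUnitaryGroup H V) : U = V := by
  -- On the common domain V(-t) U(t) f has zero derivative, because the difference quotients of U
  -- and V at U(t) f share the limit -i g(t), with g(t) = U(t) g.
  have key : ∀ f g, (f, g) ∈ H.graph → ∀ t, V (-t) (U t f) = f := by
    intro f g hfg
    have hder : ∀ t, HasDerivAt (fun t => V (-t) (U t f)) 0 t := by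
      intro t
      rw [hasDerivAt_iff_tendsto_slope_zero]
      have h1 := (hU.generator _ _).1 (hU.map_mem_graph hfg t)
      have h2 := (hV.generator _ _).1 (hU.map_mem_graph hfg t)
      have h3 := (h1.sub h2).norm
      rw [sub_self, norm_zero] at h3
      rw [tendsto_zero_iff_norm_tendsto_zero]
      refine h3.congr fun r => ?_
      -- Pulling out the isometry V(-(t + r)) avoids a product rule: only the difference of the
      -- increments of U and V at the vector U(t) f remains.
      have e : V (-(t + r)) (U (t + r) f) - V (-t) (U t f)
          = V (-(t + r)) (U r (U t f) - V r (U t f)) := by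
        rw [map_sub, ← hU.add_apply, ← hV.add_apply, add_comm r t]
        congr 3
        ring
      rw [e, norm_smul, hV.norm_map, ← smul_sub, sub_sub_sub_cancel_right, norm_smul,
        Complex.norm_real]
    intro t
    have := is_const_of_deriv_eq_zero (fun s => (hder s).differentiableAt)
      (fun s => (hder s).deriv) t 0
    rw [this, neg_zero, hU.zero_apply, hV.zero_apply]
  funext t
  refine DFunLike.coe_injective (Continuous.ext_on hU.dense_domain (U t).continuous (V t).continuous ?_)
  rintro f ⟨g, hfg⟩
  have h := congrArg (V t) (key f g hfg t)
  rwa [← hV.add_apply, add_neg_cancel, hV.zero_apply] at h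

lemma IsUnitaryGroup.unitaryGroup_eq (hU : IsUnitaryGroup H U) : unitaryGroup H = U := by
  have h : ∃ U, IsUnitaryGroup H U := ⟨U, hU⟩
  rw [unitaryGroup, dif_pos h]
  exact h.choose_spec.unique hU

/-- An inequality, not an equality, since it has to cover the default value 0 taken when H generates
no group. -/
lemma norm_unitaryGroup_le (H : L2Space d →ₗ.[ℂ] L2Space d) (t : ℝ) (f : L2Space d) :
    ‖unitaryGroup H t f‖ ≤ ‖f‖ := by
  rw [unitaryGroup]
  split_ifs with h
  · exact (h.choose_spec.norm_map t f).le
  · simp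

variable {φ : RSpace d → ℝ}

lemma mem_graph_gaugeConj_iff (hφ : Measurable φ) {f g : L2Space d} :
    (f, g) ∈ (gaugeConj φ H).graph ↔
      (phaseMul (fun x => -φ x) f, phaseMul (fun x => -φ x) g) ∈ H.graph := by
  simp only [LinearPMap.mem_graph_iff]
  constructor
  · rintro ⟨y, rfl, hy⟩
    refine ⟨⟨_, y.2⟩, rfl, ?_⟩
    rw [← hy]
    exact (phaseMul_neg_phaseMul hφ _).symm
  · rintro ⟨y, h1, h2⟩
    refine ⟨⟨f, by
      change phaseMul (fun x => -φ x) f ∈ H.domain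
      rw [← h1]; exact y.2⟩, rfl, ?_⟩
    have : phaseMul φ (H y) = g := by rw [h2, phaseMul_phaseMul_neg hφ]
    rw [← this]
    exact congrArg (fun z : H.domain => phaseMul φ (H z)) (Subtype.ext h1.symm)

lemma gaugeConj_neg_gaugeConj (hφ : Measurable φ) (H : L2Space d →ₗ.[ℂ] L2Space d) :
    gaugeConj (fun x => -φ x) (gaugeConj φ H) = H := by
  refine LinearPMap.eq_of_eq_graph ?_
  ext ⟨f, g⟩
  rw [mem_graph_gaugeConj_iff hφ.fun_neg, mem_graph_gaugeConj_iff hφ]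
  simp only [neg_neg]
  rw [phaseMul_neg_phaseMul hφ, phaseMul_neg_phaseMul hφ]

lemma IsUnitaryGroup.gaugeConj (hφ : Measurable φ) (hU : IsUnitaryGroup H U) :
    IsUnitaryGroup (gaugeConj φ H)
      fun t => (phaseMul φ).comp ((U t).comp (phaseMul fun x => -φ x)) where
  zero := by
    ext1 f
    simp [hU.zero_apply, phaseMul_phaseMul_neg hφ]
  add s t := by
    ext1 f
    simp [hU.add_apply, phaseMul_neg_phaseMul hφ]
  norm_map t f := by
    simp [norm_phaseMul hφ, hU.norm_map, norm_phaseMul hφ.fun_neg]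
  continuous f := (phaseMul φ).continuous.comp (hU.continuous _)
  generator f g := by
    rw [mem_graph_gaugeConj_iff hφ, hU.generator]
    have h0 : ∀ t : ℝ, ((t⁻¹ : ℝ) : ℂ) • (U t (phaseMul (fun x => -φ x) f)
        - phaseMul (fun x => -φ x) f) = phaseMul (fun x => -φ x) (((t⁻¹ : ℝ) : ℂ) •
          ((phaseMul φ).comp ((U t).comp (phaseMul fun x => -φ x)) f - f)) := by
      intro t
      simp [phaseMul_neg_phaseMul hφ]
    constructor
    · intro h
      have h1 := ((phaseMul φ).continuous.tendsto _).comp h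
      rw [map_smul, phaseMul_phaseMul_neg hφ] at h1
      refine h1.congr fun t => ?_
      rw [Function.comp_apply, h0, phaseMul_phaseMul_neg hφ]
    · intro h
      have h1 := ((phaseMul fun x => -φ x).continuous.tendsto _).comp h
      rw [map_smul] at h1
      refine h1.congr fun t => ?_
      rw [Function.comp_apply, h0]

/-- By uniqueness it suffices that conjugation carries a group of H to one of the conjugated
operator. Conjugating back by -φ shows that one operator generates a group exactly when the other
does, so the formula also holds for the default value 0 and self-adjointness of H is not needed. -/
lemma unitaryGroup_gaugeConj (hφ : Measurable φ) (H : L2Space d →ₗ.[ℂ] L2Space d) (t : ℝ)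
    (f : L2Space d) :
    unitaryGroup (gaugeConj φ H) t f
      = phaseMul φ (unitaryGroup H t (phaseMul (fun x => -φ x) f)) := by
  by_cases h : ∃ U, IsUnitaryGroup H U
  · obtain ⟨U, hU⟩ := h
    rw [(hU.gaugeConj hφ).unitaryGroup_eq, hU.unitaryGroup_eq]
    rfl
  · have h' : ¬ ∃ U, IsUnitaryGroup (gaugeConj φ H) U := by
      rintro ⟨U, hU⟩
      have := hU.gaugeConj hφ.fun_neg
      rw [gaugeConj_neg_gaugeConj hφ] at this
      exact h ⟨_, this⟩
    rw [unitaryGroup, dif_neg h', unitaryGroup, dif_neg h]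
    simp

end UnitaryGroup

/-! ### Mollification: admitting test functions that are only differentiable. -/

section Translation

variable {d : ℕ} {𝕜 : Type*} [RCLike 𝕜]

/-- Translations act strongly continuously on L₂, and the integral is an inner product with a
translate. The scalar field is left general so that the same lemma applies to the norms of u and k.
-/
lemma continuous_integral_mul_translate {u k : RSpace d → 𝕜} (hu : MemLp u 2 volume)
    (hk : MemLp k 2 volume) : Continuous fun y => ∫ x, u x * k (x - y) := by
  have hmp : ∀ y : RSpace d, MeasurePreserving (fun x : RSpace d => x - y) volume volume :=
    fun y => measurePreserving_sub_right volume y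
  let g : C(RSpace d, C(RSpace d, RSpace d)) :=
    (ContinuousMap.mk (fun a : RSpace d × RSpace d => a.2 - a.1)
      (continuous_snd.sub continuous_fst)).curry
  have h1 : Continuous fun y => Lp.compMeasurePreserving (fun x : RSpace d => x - y) (hmp y)
      (hk.toLp k) :=
    Continuous.compMeasurePreservingLp (f := fun _ : RSpace d => hk.toLp k) (g := g)
      continuous_const g.continuous hmp (by simp)
  have hu' : MemLp (fun x => (starRingEnd 𝕜) (u x)) 2 volume := hu.star
  have h2 : Continuous fun y => inner 𝕜 (hu'.toLp _)
      (Lp.compMeasurePreserving (fun x : RSpace d => x - y) (hmp y) (hk.toLp k)) :=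
    continuous_const.inner h1
  refine h2.congr fun y => ?_
  rw [L2.inner_def]
  refine integral_congr_ae ?_
  filter_upwards [hu'.coeFn_toLp, Lp.coeFn_compMeasurePreserving (hk.toLp k) (hmp y),
    (hmp y).quasiMeasurePreserving.ae_eq_comp hk.coeFn_toLp] with x a1 a2 a3
  rw [a1, a2, a3]
  simp [mul_comm]

lemma integrable_mul_translate {u k : RSpace d → 𝕜} (hu : MemLp u 2 volume)
    (hk : MemLp k 2 volume) (y : RSpace d) : Integrable (fun x => u x * k (x - y)) volume :=
  hu.integrable_mul (hk.comp_measurePreserving (measurePreserving_sub_right volume y))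

lemma continuous_integral_locallyIntegrable_mul_translate {u k : RSpace d → 𝕜}
    (hu : LocallyIntegrable u volume) (hk : Continuous k) (hc : HasCompactSupport k) :
    Continuous fun y => ∫ x, u x * k (x - y) := by
  have hc' : HasCompactSupport fun x => k (-x) := hc.comp_homeomorph (Homeomorph.neg (RSpace d))
  have := hc'.continuous_convolution_right (ContinuousLinearMap.mul 𝕜 𝕜) hu
    (hk.comp continuous_neg)
  refine this.congr fun y => ?_
  simp [convolution_def]

lemma integrable_locallyIntegrable_mul_translate {u k : RSpace d → 𝕜}
    (hu : LocallyIntegrable u volume) (hk : Continuous k) (hc : HasCompactSupport k)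
    (y : RSpace d) : Integrable (fun x => u x * k (x - y)) volume := by
  have h := hu.integrable_smul_left_of_hasCompactSupport
    (hk.comp (continuous_sub_right y)) (hc.comp_homeomorph (Homeomorph.subRight y))
  simpa [smul_eq_mul, mul_comm] using h

/-- Fubini. Joint integrability holds because the inner integral of the norms is continuous in y and
ρ has compact support. -/
lemma integral_mul_convolution_eq {u k : RSpace d → ℂ} {ρ : RSpace d → ℝ}
    (hu : AEStronglyMeasurable u volume) (hk : AEStronglyMeasurable k volume)
    (hint : ∀ y, Integrable (fun x => u x * k (x - y)) volume)
    (hcont : Continuous fun y => ∫ x, ‖u x‖ * ‖k (x - y)‖)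
    (hρ : Continuous ρ) (hρc : HasCompactSupport ρ) :
    ∫ x, u x * ∫ y, ρ y • k (x - y) = ∫ y, ρ y • ∫ x, u x * k (x - y) := by
  have hmeas : AEStronglyMeasurable
      (fun p : RSpace d × RSpace d => ρ p.2 • (u p.1 * k (p.1 - p.2)))
      ((volume : Measure (RSpace d)).prod volume) :=
    (hρ.comp continuous_snd).aestronglyMeasurable.smul
      (hu.comp_fst.mul (hk.comp_quasiMeasurePreserving
        (quasiMeasurePreserving_sub volume volume)))
  have hprod : Integrable (fun p : RSpace d × RSpace d => ρ p.2 • (u p.1 * k (p.1 - p.2)))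
      ((volume : Measure (RSpace d)).prod volume) := by
    rw [integrable_prod_iff' hmeas]
    refine ⟨ae_of_all _ fun y => (hint y).smul (ρ y), ?_⟩
    have : Continuous fun y => ‖ρ y‖ * ∫ x, ‖u x‖ * ‖k (x - y)‖ := hρ.norm.mul hcont
    refine (this.integrable_of_hasCompactSupport hρc.norm.mul_right).congr (ae_of_all _ fun y => ?_)
    simp only [norm_smul, norm_mul]
    rw [integral_const_mul]
  calc ∫ x, u x * ∫ y, ρ y • k (x - y) = ∫ x, ∫ y, ρ y • (u x * k (x - y)) := by
        refine integral_congr_ae (ae_of_all _ fun x => ?_)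
        simp only
        rw [← integral_const_mul]
        simp only [mul_smul_comm]
    _ = ∫ y, ∫ x, ρ y • (u x * k (x - y)) := integral_integral_swap hprod
    _ = _ := by simp only [integral_smul]

/-- The partial derivatives of `ρ * χ` may be moved to `χ`, if `χ` is merely differentiable. -/
lemma partialD_convolution {ρ : RSpace d → ℝ} {χ : RSpace d → ℂ} (hρ : ContDiff ℝ (⊤ : ℕ∞) ρ)
    (hρc : HasCompactSupport ρ) (hχ : Differentiable ℝ χ) (j : Fin d)
    (hint : LocallyIntegrable (partialD j χ) volume) (x : RSpace d) :
    partialD j (fun x => ∫ y, ρ y • χ (x - y)) x = ∫ y, ρ y • partialD j χ (x - y) := by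
  have h1 := hρc.hasFDerivAt_convolution_left (ContinuousLinearMap.lsmul ℝ ℝ)
    (hρ.of_le (by exact_mod_cast le_top)) (hχ.continuous.locallyIntegrable (μ := volume)) x
  let L : ℝ →L[ℝ] ℂ →L[ℝ] ℂ := ContinuousLinearMap.lsmul ℝ ℝ
  have hex : ConvolutionExistsAt (fderiv ℝ ρ) χ x (L.precompL (RSpace d)) volume :=
    (hρc.fderiv (𝕜 := ℝ)).convolutionExists_left (L.precompL (RSpace d))
      (hρ.continuous_fderiv (by simp)) (hχ.continuous.locallyIntegrable (μ := volume)) x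
  have h2 : partialD j (fun x => ∫ y, ρ y • χ (x - y)) x
      = ∫ y, (fderiv ℝ ρ y (EuclideanSpace.single j 1)) • χ (x - y) := by
    rw [partialD, show (fun x => ∫ y, ρ y • χ (x - y))
      = convolution ρ χ (ContinuousLinearMap.lsmul ℝ ℝ) volume from rfl, h1.fderiv,
      convolution_def, ContinuousLinearMap.integral_apply hex]
    rfl
  have hd : ∀ y, HasFDerivAt (fun y => χ (x - y)) (-(fderiv ℝ χ (x - y))) y := by
    intro y
    have h3 := ((hχ (x - y)).hasFDerivAt).comp y ((hasFDerivAt_id y).const_sub x)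
    refine h3.congr_fderiv ?_
    ext v
    simp
  have hf : ∀ y, fderiv ℝ (fun y => χ (x - y)) y (EuclideanSpace.single j 1)
      = -partialD j χ (x - y) := fun y => by rw [(hd y).fderiv]; rfl
  have hcont : Continuous fun y => χ (x - y) := hχ.continuous.comp (continuous_sub_left x)
  have hdρ : HasCompactSupport fun y => fderiv ℝ ρ y (EuclideanSpace.single j 1) :=
    hρc.fderiv_apply (𝕜 := ℝ) _
  -- This integration by parts asks for pointwise differentiability and integrability of the three
  -- products, but not for continuity of the derivative of χ.
  have key := integral_smul_fderiv_eq_neg_fderiv_smul_of_integrable (μ := volume) (𝕜 := ℝ)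
    (f := ρ) (g := fun y => χ (x - y)) (v := EuclideanSpace.single j 1) ?_ ?_ ?_
    (fun y _ => hρ.differentiable (by simp) y) (fun y _ => (hd y).differentiableAt)
  · rw [h2]
    simp only [hf, smul_neg, integral_neg] at key
    exact (neg_injective key).symm
  · exact (((hρ.continuous_fderiv (by simp)).clm_apply continuous_const).smul
      hcont).integrable_of_hasCompactSupport hdρ.smul_right
  · simp only [hf, smul_neg]
    refine Integrable.neg ?_
    have hmp := Measure.measurePreserving_sub_left (volume : Measure (RSpace d)) x
    have h4 : LocallyIntegrable (fun y => partialD j χ (x - y)) volume := by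
      rw [locallyIntegrable_iff] at hint ⊢
      intro K hK
      have h5 := hint ((fun y => x - y) '' K) (hK.image (continuous_sub_left x))
      have h6 := (hmp.integrableOn_comp_preimage
        (Homeomorph.subLeft x).measurableEmbedding).2 h5
      rwa [preimage_image_eq _ (sub_right_injective)] at h6
    exact h4.integrable_smul_left_of_hasCompactSupport hρ.continuous hρc
  · exact (hρ.continuous.smul hcont).integrable_of_hasCompactSupport hρc.smul_right

/-- A distributional identity `∂ⱼu = -w` may be tested on differentiable functions of compact
support, the derivative of which is in `L₂`. -/
lemma integral_mul_partialD_of_forall_contDiff {u w : RSpace d → ℂ} (hu : MemLp u 2 volume)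
    (hw : LocallyIntegrable w volume) (j : Fin d)
    (h : ∀ ψ : RSpace d → ℂ, ContDiff ℝ (⊤ : ℕ∞) ψ → HasCompactSupport ψ →
      ∫ x, u x * partialD j ψ x = ∫ x, w x * ψ x)
    {χ : RSpace d → ℂ} (hχ : Differentiable ℝ χ) (hc : HasCompactSupport χ)
    (h2 : MemLp (partialD j χ) 2 volume) :
    ∫ x, u x * partialD j χ x = ∫ x, w x * χ x := by
  -- G(y) is the defect of the identity for the translate of χ by y. Its integral against a smooth ρ
  -- is the defect for the smooth function ρ * χ, which vanishes; since G is continuous it is zero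
  -- everywhere, and y = 0 is the claim.
  set G : RSpace d → ℂ := fun y => (∫ x, u x * partialD j χ (x - y)) - ∫ x, w x * χ (x - y)
    with hG
  have hc1 : Continuous fun y => ∫ x, u x * partialD j χ (x - y) :=
    continuous_integral_mul_translate hu h2
  have hc2 : Continuous fun y => ∫ x, w x * χ (x - y) :=
    continuous_integral_locallyIntegrable_mul_translate hw hχ.continuous hc
  have hGc : Continuous G := hc1.sub hc2
  have hzero : ∀ᵐ y ∂(volume : Measure (RSpace d)), G y = 0 := by
    refine ae_eq_zero_of_integral_contDiff_smul_eq_zero hGc.locallyIntegrable ?_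
    intro ρ hρ hρc
    have e1 := integral_mul_convolution_eq hu.1 h2.1 (integrable_mul_translate hu h2)
      (continuous_integral_mul_translate (𝕜 := ℝ) hu.norm h2.norm) hρ.continuous hρc
    have e2 := integral_mul_convolution_eq hw.aestronglyMeasurable
      hχ.continuous.aestronglyMeasurable
      (integrable_locallyIntegrable_mul_translate hw hχ.continuous hc)
      (continuous_integral_locallyIntegrable_mul_translate (𝕜 := ℝ)
        (fun x => (hw x).norm) hχ.continuous.norm
        hc.norm) hρ.continuous hρc
    have e3 := h (convolution ρ χ (ContinuousLinearMap.lsmul ℝ ℝ) volume)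
      (hρc.contDiff_convolution_left _ hρ hχ.continuous.locallyIntegrable)
      (hρc.convolution _ hc)
    have e4 : (∫ x, u x * partialD j (convolution ρ χ (ContinuousLinearMap.lsmul ℝ ℝ) volume) x)
        = ∫ x, u x * ∫ y, ρ y • partialD j χ (x - y) := by
      refine integral_congr_ae (ae_of_all _ fun x => ?_)
      exact congrArg (u x * ·) (partialD_convolution hρ hρc hχ j
        (h2.locallyIntegrable (by norm_num)) x)
    rw [e4, e1] at e3
    have e5 : (∫ x, w x * convolution ρ χ (ContinuousLinearMap.lsmul ℝ ℝ) volume x)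
        = ∫ x, w x * ∫ y, ρ y • χ (x - y) := rfl
    rw [e5, e2] at e3
    simp only [hG, smul_sub]
    rw [integral_sub, e3, sub_self]
    · exact (hρ.continuous.smul hc1).integrable_of_hasCompactSupport hρc.smul_right
    · exact (hρ.continuous.smul hc2).integrable_of_hasCompactSupport hρc.smul_right
  have hG0 : G = fun _ => 0 := Continuous.ae_eq_iff_eq volume hGc continuous_const |>.1 hzero
  have := congrFun hG0 0
  simp only [hG, sub_zero] at this
  exact sub_eq_zero.1 this

end Translation

/-! ### Gauge covariance of the magnetic gradient and of the operator. -/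

section Gauge

variable {d : ℕ} {A : RSpace d → RSpace d} {φ : RSpace d → ℝ}

lemma LocallyL2.coord (hA : LocallyL2 A) (j : Fin d) {K : Set (RSpace d)} (hK : IsCompact K) :
    MemLp (fun x => ((A x j : ℝ) : ℂ)) 2 (volume.restrict K) := by
  have h1 : MemLp (fun x => (EuclideanSpace.proj j : RSpace d →L[ℝ] ℝ) (A x)) 2
      (volume.restrict K) := (EuclideanSpace.proj j : RSpace d →L[ℝ] ℝ).comp_memLp' (hA K hK)
  exact h1.ofReal

lemma LocallyL2.locallyIntegrable_mul (hA : LocallyL2 A) (j : Fin d) (u : L2Space d) :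
    LocallyIntegrable (fun x => ((A x j : ℝ) : ℂ) * u x) volume := by
  rw [locallyIntegrable_iff]
  intro K hK
  exact (hA.coord j hK).integrable_mul ((Lp.memLp u).restrict K)

lemma LocallyL2.memLp_mul (hA : LocallyL2 A) (j : Fin d) {ψ : RSpace d → ℂ} (hψ : Continuous ψ)
    (hc : HasCompactSupport ψ) : MemLp (fun x => ((A x j : ℝ) : ℂ) * ψ x) 2 volume := by
  have hK : IsCompact (tsupport ψ) := hc
  have h1 : MemLp (fun x => ((A x j : ℝ) : ℂ) * ψ x) 2 (volume.restrict (tsupport ψ)) :=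
    (hψ.memLp_top_of_hasCompactSupport hc (volume.restrict (tsupport ψ))).mul (r := 2)
      (hA.coord j hK)
  rw [← memLp_indicator_iff_restrict hK.measurableSet] at h1
  refine (memLp_congr_ae (ae_of_all _ fun x => ?_)).1 h1
  by_cases hx : x ∈ tsupport ψ
  · rw [indicator_of_mem hx]
  · rw [indicator_of_notMem hx, image_eq_zero_of_notMem_tsupport hx, mul_zero]

lemma LocallyL2.sub {B : RSpace d → RSpace d} (hA : LocallyL2 A) (hB : LocallyL2 B) :
    LocallyL2 fun x => A x - B x := fun K hK => (hA K hK).sub (hB K hK)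

lemma gradient_coord (hφ : Differentiable ℝ φ) (x : RSpace d) (j : Fin d) :
    gradient φ x j = fderiv ℝ φ x (EuclideanSpace.single j 1) := by
  have h := (hφ x).hasGradientAt.hasFDerivAt.fderiv
  have h2 := congrArg (fun L : RSpace d →L[ℝ] ℝ => L (EuclideanSpace.single j 1)) h
  simp only [InnerProductSpace.toDual_apply_apply, EuclideanSpace.inner_single_right] at h2
  simpa using h2.symm

lemma hasFDerivAt_phase_mul (hφ : Differentiable ℝ φ) {ψ : RSpace d → ℂ}
    (hψ : Differentiable ℝ ψ) (x : RSpace d) :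
    HasFDerivAt (fun x => Complex.exp (Complex.I * (φ x : ℂ)) * ψ x)
      (Complex.exp (Complex.I * (φ x : ℂ)) • fderiv ℝ ψ x + ψ x •
        (Complex.exp (Complex.I * (φ x : ℂ)) • Complex.I •
          (Complex.ofRealCLM.comp (fderiv ℝ φ x)))) x := by
  have h1 : HasFDerivAt (fun x => (φ x : ℂ)) (Complex.ofRealCLM.comp (fderiv ℝ φ x)) x :=
    Complex.ofRealCLM.hasFDerivAt.comp x (hφ x).hasFDerivAt
  exact (h1.const_mul Complex.I).cexp.mul (hψ x).hasFDerivAt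

lemma partialD_phase_mul (hφ : Differentiable ℝ φ) {ψ : RSpace d → ℂ} (hψ : Differentiable ℝ ψ)
    (j : Fin d) (x : RSpace d) :
    partialD j (fun x => Complex.exp (Complex.I * (φ x : ℂ)) * ψ x) x
      = Complex.exp (Complex.I * (φ x : ℂ)) * (partialD j ψ x
        + Complex.I * ((gradient φ x j : ℝ) : ℂ) * ψ x) := by
  rw [partialD, (hasFDerivAt_phase_mul hφ hψ x).fderiv, gradient_coord hφ]
  simp only [add_apply, smul_apply, smul_eq_mul,
    ContinuousLinearMap.comp_apply, Complex.ofRealCLM_apply, partialD]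
  ring

/-- The gauge transformation of `(i∇ + A) u`. -/
lemma IsMagneticGradient.gauge (hA : LocallyL2 A) (hφ : Differentiable ℝ φ)
    (hB : LocallyL2 fun x => A x + gradient φ x) {u : L2Space d} {g : Fin d → L2Space d}
    (h : IsMagneticGradient A u g) :
    IsMagneticGradient (fun x => A x + gradient φ x) (phaseMul φ u) fun j => phaseMul φ (g j) := by
  have hφm : Measurable φ := hφ.continuous.measurable
  -- Differentiability alone gives no integrability of the gradient; it comes from writing it as the
  -- difference of the two potentials.
  have hG : LocallyL2 (gradient φ) := by
    have := hB.sub hA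
    simpa using this
  intro j
  refine ⟨hB.locallyIntegrable_mul j _, fun ψ hψ hc => ?_⟩
  set e : RSpace d → ℂ := fun x => Complex.exp (Complex.I * (φ x : ℂ)) with he
  have hec : Continuous e := by
    have := hφ.continuous
    fun_prop
  have hψd : Differentiable ℝ ψ := hψ.differentiable (by simp)
  -- Testing e^{iφ}u against ψ amounts to testing u against χ = e^{iφ}ψ, and the product rule for χ
  -- produces the extra potential grad φ.
  set χ : RSpace d → ℂ := fun x => e x * ψ x with hχ
  have hχd : Differentiable ℝ χ := fun x => (hasFDerivAt_phase_mul hφ hψd x).differentiableAt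
  have hχs : HasCompactSupport χ := hc.mul_left
  have hpd : ∀ x, partialD j χ x = e x * (partialD j ψ x
      + Complex.I * ((gradient φ x j : ℝ) : ℂ) * ψ x) := partialD_phase_mul hφ hψd j
  have hdc := continuous_partialD j hψ
  have hds := hasCompactSupport_partialD j hc
  have h2 : MemLp (partialD j χ) 2 volume := by
    have m1 : MemLp (fun x => e x * partialD j ψ x) 2 volume :=
      (hec.mul hdc).memLp_of_hasCompactSupport hds.mul_left
    have m2 := (hG.memLp_mul j hχd.continuous hχs).const_mul Complex.I
    refine (memLp_congr_ae (ae_of_all _ fun x => ?_)).1 (m1.add m2)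
    rw [hpd]
    simp only [Pi.add_apply, hχ]
    ring
  have hw : LocallyIntegrable (fun x => Complex.I * (g j x - ((A x j : ℝ) : ℂ) * u x)) volume :=
    (((Lp.memLp (g j)).locallyIntegrable (by norm_num)).sub (h j).1).smul Complex.I
  -- The weak equation solved for the derivative: ∫ u ∂ⱼη = ∫ i(gⱼ - Aⱼu) η for smooth η, now
  -- extended to χ.
  have key := integral_mul_partialD_of_forall_contDiff (Lp.memLp u) hw j (fun η hη hηc => by
    have h3 := (h j).2 η hη hηc
    have i1 := integrable_L2_mul (g j) hη.continuous hηc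
    have i2 := integrable_loc_mul (h j).1 hη.continuous hηc
    have : (∫ x, Complex.I * (g j x - ((A x j : ℝ) : ℂ) * u x) * η x)
        = Complex.I * ((∫ x, g j x * η x) - ∫ x, ((A x j : ℝ) : ℂ) * u x * η x) := by
      rw [← integral_sub i1 i2, ← integral_const_mul]
      congr 1
      ext x
      ring
    rw [this, ← h3, add_sub_cancel_right, ← mul_assoc, mul_neg, Complex.I_mul_I, neg_neg,
      one_mul]) hχd hχs h2
  have j1 : Integrable (fun x => u x * partialD j χ x) volume := (Lp.memLp u).integrable_mul h2
  have j2 : Integrable (fun x => ((A x j : ℝ) : ℂ) * u x * χ x) volume :=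
    integrable_loc_mul (h j).1 hχd.continuous hχs
  have j3 : Integrable (fun x => g j x * χ x) volume :=
    integrable_L2_mul (g j) hχd.continuous hχs
  have j4 := integrable_L2_mul (phaseMul φ u) hdc hds
  have j5 := integrable_loc_mul (hB.locallyIntegrable_mul j (phaseMul φ u)) hψ.continuous hc
  have k1 : (∫ x, Complex.I * (g j x - ((A x j : ℝ) : ℂ) * u x) * χ x)
      = Complex.I * ((∫ x, g j x * χ x) - ∫ x, ((A x j : ℝ) : ℂ) * u x * χ x) := by
    rw [← integral_sub j3 j2, ← integral_const_mul]
    congr 1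
    ext x
    ring
  have k2 : (∫ x, phaseMul φ (g j) x * ψ x) = ∫ x, g j x * χ x := by
    refine integral_congr_ae ?_
    filter_upwards [phaseMul_coeFn hφm (g j)] with x hx
    simp only [hx, hχ, he]
    ring
  have k3 : -Complex.I * (∫ x, phaseMul φ u x * partialD j ψ x)
      + (∫ x, (((A x + gradient φ x) j : ℝ) : ℂ) * phaseMul φ u x * ψ x)
      = -Complex.I * (∫ x, u x * partialD j χ x) + ∫ x, ((A x j : ℝ) : ℂ) * u x * χ x := by
    rw [← integral_const_mul, ← integral_const_mul,
      ← integral_add (j4.const_mul _) j5, ← integral_add (j1.const_mul _) j2]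
    refine integral_congr_ae ?_
    filter_upwards [phaseMul_coeFn hφm u] with x hx
    simp only [hx, hpd, PiLp.add_apply, Complex.ofReal_add]
    simp only [hχ, he]
    linear_combination (u x * Complex.exp (Complex.I * (φ x : ℂ)) *
      ((gradient φ x j : ℝ) : ℂ) * ψ x) * Complex.I_mul_I
  rw [k3, k2, key, k1]
  linear_combination (-(∫ x, g j x * χ x) + ∫ x, ((A x j : ℝ) : ℂ) * u x * χ x) * Complex.I_mul_I

lemma isMagneticGradient_gauge_iff (hA : LocallyL2 A) (hφ : Differentiable ℝ φ)
    (hB : LocallyL2 fun x => A x + gradient φ x) {u : L2Space d} {g : Fin d → L2Space d} :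
    IsMagneticGradient (fun x => A x + gradient φ x) u g ↔
      IsMagneticGradient A (phaseMul (fun x => -φ x) u) fun j => phaseMul (fun x => -φ x) (g j) := by
  have hφm : Measurable φ := hφ.continuous.measurable
  have hgrad : ∀ x, gradient (fun x => -φ x) x = -gradient φ x := fun x => by
    simp only [gradient]
    rw [fderiv_fun_neg, map_neg]
  constructor
  · intro h
    have h1 := IsMagneticGradient.gauge (φ := fun x => -φ x) hB hφ.fun_neg
      (by simpa only [hgrad, add_neg_cancel_right] using hA) h
    simpa only [hgrad, add_neg_cancel_right] using h1
  · intro h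
    have h1 := h.gauge hA hφ hB
    simpa only [phaseMul_phaseMul_neg hφm] using h1

lemma mem_magneticGraph_gauge_iff (hA : LocallyL2 A) (hφ : Differentiable ℝ φ)
    (hB : LocallyL2 fun x => A x + gradient φ x) {u f : L2Space d} :
    (u, f) ∈ magneticGraph (fun x => A x + gradient φ x) ↔
      (phaseMul (fun x => -φ x) u, phaseMul (fun x => -φ x) f) ∈ magneticGraph A := by
  have hφm : Measurable φ := hφ.continuous.measurable
  constructor
  · rintro ⟨g, hg, h⟩
    refine ⟨_, (isMagneticGradient_gauge_iff hA hφ hB).1 hg, fun v k hv => ?_⟩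
    have h1 := h _ _ (hv.gauge hA hφ hB)
    rw [← inner_phaseMul hφm, phaseMul_phaseMul_neg hφm, ← h1]
    refine Finset.sum_congr rfl fun j _ => ?_
    rw [← inner_phaseMul hφm, phaseMul_phaseMul_neg hφm]
  · rintro ⟨g, hg, h⟩
    refine ⟨_, (isMagneticGradient_gauge_iff (g := fun j => phaseMul φ (g j)) hA hφ hB).2
      (by simpa only [phaseMul_neg_phaseMul hφm] using hg), fun v k hv => ?_⟩
    have h1 := h _ _ ((isMagneticGradient_gauge_iff hA hφ hB).1 hv)
    rw [inner_phaseMul hφm.fun_neg] at h1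
    rw [← h1]
    refine Finset.sum_congr rfl fun j _ => ?_
    rw [← inner_phaseMul hφm (phaseMul (fun x => -φ x) (k j)), phaseMul_phaseMul_neg hφm]

/-- The phase e^{iφ} is unitary and maps the form domain and the form of A onto those of A + grad φ,
so the two graphs correspond. `Submodule.toLinearPMap` yields the zero map on a relation that is not
single-valued; single-valuedness is gauge invariant, and that case is matched separately, so density
of the form domain is not required. -/
lemma gaugeConj_magneticSchrodinger (hA : LocallyL2 A) (hφ : Differentiable ℝ φ)
    (hB : LocallyL2 fun x => A x + gradient φ x) :
    gaugeConj φ (magneticSchrodinger A) = magneticSchrodinger fun x => A x + gradient φ x := by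
  have hφm : Measurable φ := hφ.continuous.measurable
  have hiff := fun {u f : L2Space d} => mem_magneticGraph_gauge_iff (u := u) (f := f) hA hφ hB
  by_cases hfun : ∀ p ∈ magneticGraph A, p.1 = 0 → p.2 = 0
  · have hfun' : ∀ p ∈ magneticGraph (fun x => A x + gradient φ x), p.1 = 0 → p.2 = 0 := by
      rintro ⟨u, f⟩ hp (rfl : u = 0)
      have h1 := hfun _ (hiff.1 hp) (map_zero _)
      rw [← phaseMul_phaseMul_neg hφm f]
      exact (congrArg (phaseMul φ) h1).trans (phaseMul φ).map_zero
    refine LinearPMap.eq_of_eq_graph ?_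
    ext ⟨u, f⟩
    rw [mem_graph_gaugeConj_iff hφm, magneticSchrodinger, magneticSchrodinger,
      Submodule.toLinearPMap_graph_eq _ hfun, Submodule.toLinearPMap_graph_eq _ hfun', hiff]
  · have hfun' : ¬ ∀ p ∈ magneticGraph (fun x => A x + gradient φ x), p.1 = 0 → p.2 = 0 := by
      intro h'
      apply hfun
      rintro ⟨u, f⟩ hp (rfl : u = 0)
      have h1 := h' (phaseMul φ 0, phaseMul φ f) (hiff.2 (by
        simpa only [phaseMul_neg_phaseMul hφm] using hp)) (map_zero _)
      rw [← phaseMul_neg_phaseMul hφm f]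
      exact (congrArg (phaseMul fun x => -φ x) h1).trans (phaseMul fun x => -φ x).map_zero
    have z1 : (magneticSchrodinger A).toFun = 0 := by
      simp only [magneticSchrodinger, Submodule.toLinearPMap]
      exact dif_neg hfun
    have z2 : (magneticSchrodinger fun x => A x + gradient φ x).toFun = 0 := by
      simp only [magneticSchrodinger, Submodule.toLinearPMap]
      exact dif_neg hfun'
    refine LinearPMap.ext ?_ ?_
    · ext u
      change phaseMul (fun x => -φ x) u ∈ (magneticGraph A).map _ ↔ u ∈ Submodule.map _ _
      simp only [Submodule.mem_map, LinearMap.fst_apply, Prod.exists, exists_and_right,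
        exists_eq_right]
      constructor
      · rintro ⟨f, hf⟩
        exact ⟨phaseMul φ f, hiff.2 (by simpa only [phaseMul_neg_phaseMul hφm] using hf)⟩
      · rintro ⟨f, hf⟩
        exact ⟨_, hiff.1 hf⟩
    · intro u h1 h2
      have e1 : magneticSchrodinger A ⟨phaseMul (fun x => -φ x) u, h1⟩ = 0 :=
        LinearMap.congr_fun z1 _
      have e2 : magneticSchrodinger (fun x => A x + gradient φ x) ⟨u, h2⟩ = 0 :=
        LinearMap.congr_fun z2 _
      rw [e2]
      exact (congrArg (phaseMul φ) e1).trans (phaseMul φ).map_zero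

end Gauge

/-! ### Dominated convergence in L₂ and generators of multiplication groups. -/

section Dominated

variable {α : Type*} [MeasurableSpace α] {μ : Measure α}

/-- Dominated convergence in `L₂`. -/
lemma tendsto_L2_of_dominated {ι : Type*} {l : Filter ι} [l.IsCountablyGenerated]
    {F : ι → Lp ℂ 2 μ} {G : Lp ℂ 2 μ} (f : ι → α → ℂ) (bound : α → ℝ) (hb : MemLp bound 2 μ)
    (hF : ∀ i, F i =ᵐ[μ] f i) (hle : ∀ᶠ i in l, ∀ᵐ x ∂μ, ‖f i x‖ ≤ bound x)
    (hlim : ∀ᵐ x ∂μ, Tendsto (fun i => f i x) l (𝓝 (G x))) : Tendsto F l (𝓝 G) := by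
  rw [tendsto_iff_norm_sub_tendsto_zero]
  have hsq : ∀ i, ‖F i - G‖ ^ 2 = ∫ x, ‖f i x - G x‖ ^ 2 ∂μ := by
    intro i
    rw [← RCLike.ofReal_inj (K := ℂ)]
    have := inner_self_eq_norm_sq_to_K (𝕜 := ℂ) (F i - G)
    push_cast
    rw [← this, L2.inner_def, ← integral_ofReal]
    refine integral_congr_ae ?_
    filter_upwards [hF i, Lp.coeFn_sub (F i) G] with x h1 h2
    rw [h2, Pi.sub_apply, h1]
    simp [inner_self_eq_norm_sq_to_K]
  have h0 : Tendsto (fun i => ∫ x, ‖f i x - G x‖ ^ 2 ∂μ) l (𝓝 (∫ _, (0 : ℝ) ∂μ)) := by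
    refine tendsto_integral_filter_of_dominated_convergence
      (fun x => (bound x + ‖G x‖) ^ 2) (Eventually.of_forall fun i => ?_) ?_ ?_ ?_
    · have : AEStronglyMeasurable (f i) μ := (Lp.aestronglyMeasurable (F i)).congr (hF i)
      exact ((this.sub (Lp.aestronglyMeasurable G)).norm.pow 2)
    · filter_upwards [hle] with i hi
      filter_upwards [hi] with x hx
      rw [Real.norm_of_nonneg (by positivity)]
      gcongr
      exact (norm_sub_le _ _).trans (by gcongr)
    · exact (hb.add (Lp.memLp G).norm).integrable_sq
    · filter_upwards [hlim] with x hx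
      have h1 := ((hx.sub_const (G x)).norm).pow 2
      simpa using h1
  rw [integral_zero] at h0
  have h1 : Tendsto (fun i => ‖F i - G‖ ^ 2) l (𝓝 0) := h0.congr fun i => (hsq i).symm
  have h2 := h1.sqrt
  simpa [Real.sqrt_sq] using h2

lemma tendsto_phase_slope (a : ℝ) :
    Tendsto (fun t : ℝ => ((t⁻¹ : ℝ) : ℂ) *
      (Complex.exp (Complex.I * ((-t * a : ℝ) : ℂ)) - 1)) (𝓝[≠] 0)
      (𝓝 (-Complex.I * a)) := by
  have h1 : HasDerivAt (fun t : ℝ => Complex.exp (Complex.I * ((-t * a : ℝ) : ℂ)))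
      (-Complex.I * a) 0 := by
    have h2 : HasDerivAt (fun t : ℝ => Complex.I * ((-t * a : ℝ) : ℂ)) (-Complex.I * a) 0 := by
      have h3 : HasDerivAt (fun t : ℝ => ((-t * a : ℝ) : ℂ)) ((-1 * a : ℝ) : ℂ) 0 :=
        (((hasDerivAt_id (0 : ℝ)).neg).mul_const a).ofReal_comp
      have h4 := h3.const_mul Complex.I
      refine h4.congr_deriv ?_
      push_cast; ring
    simpa using h2.cexp
  rw [hasDerivAt_iff_tendsto_slope_zero] at h1
  refine h1.congr fun t => ?_
  simp

/-- From |e^{iθ} - 1| ≤ |θ|. Being uniform in t, it dominates the difference quotients of e^{-itm}f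
by |m f|. -/
lemma norm_phase_slope_le (t a : ℝ) :
    ‖((t⁻¹ : ℝ) : ℂ) * (Complex.exp (Complex.I * ((-t * a : ℝ) : ℂ)) - 1)‖ ≤ |a| := by
  rcases eq_or_ne t 0 with rfl | ht
  · simp
  rw [norm_mul, Complex.norm_real]
  have h1 := Real.norm_exp_I_mul_ofReal_sub_one_le (x := -t * a)
  calc ‖t⁻¹‖ * ‖Complex.exp (Complex.I * ((-t * a : ℝ) : ℂ)) - 1‖
      ≤ ‖t⁻¹‖ * ‖-t * a‖ := by gcongr
    _ = |a| := by
        rw [← norm_mul, neg_mul, mul_neg, ← mul_assoc, inv_mul_cancel₀ ht, one_mul, norm_neg,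
          Real.norm_eq_abs]

/-- The generator of the group of multiplication operators `e^{-itm}`. -/
lemma tendsto_phaseMul_slope_iff {m : α → ℝ} (hm : Measurable m) (f g : Lp ℂ 2 μ) :
    Tendsto (fun t : ℝ => ((t⁻¹ : ℝ) : ℂ) • (phaseMul (fun x => -t * m x) f - f)) (𝓝[≠] 0)
      (𝓝 (-Complex.I • g)) ↔ g =ᵐ[μ] fun x => (m x : ℂ) * f x := by
  set q : ℝ → α → ℂ := fun t x => ((t⁻¹ : ℝ) : ℂ) *
    (Complex.exp (Complex.I * ((-t * m x : ℝ) : ℂ)) - 1) * f x with hq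
  have hF : ∀ t : ℝ, (((t⁻¹ : ℝ) : ℂ) • (phaseMul (fun x => -t * m x) f - f) : Lp ℂ 2 μ)
      =ᵐ[μ] q t := by
    intro t
    filter_upwards [Lp.coeFn_smul ((t⁻¹ : ℝ) : ℂ) (phaseMul (fun x => -t * m x) f - f),
      Lp.coeFn_sub (phaseMul (fun x => -t * m x) f) f,
      phaseMul_coeFn (hm.const_mul (-t)) f] with x h1 h2 h3
    rw [h1, Pi.smul_apply, h2, Pi.sub_apply, h3, smul_eq_mul]
    simp only [hq]
    ring
  have hpt : ∀ x, Tendsto (fun t => q t x) (𝓝[≠] 0) (𝓝 (-Complex.I * m x * f x)) := fun x =>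
    (tendsto_phase_slope (m x)).mul_const (f x)
  constructor
  · intro h
    -- Convergence in L₂ along a sequence gives a.e. convergence of a subsequence, which identifies
    -- the limit pointwise.
    set s : ℕ → ℝ := fun n => 1 / ((n : ℝ) + 1) with hs
    have hs0 : Tendsto s atTop (𝓝[≠] 0) := by
      refine tendsto_nhdsWithin_iff.2 ⟨tendsto_one_div_add_atTop_nhds_zero_nat,
        Eventually.of_forall fun n => ?_⟩
      have : (0 : ℝ) < s n := Nat.one_div_pos_of_nat
      exact this.ne'
    obtain ⟨ns, hns, hae⟩ := (tendstoInMeasure_of_tendsto_Lp (h.comp hs0)).exists_seq_tendsto_ae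
    filter_upwards [hae, Lp.coeFn_smul (-Complex.I) g,
      ae_all_iff.2 fun n => hF (s n)] with x h1 h2 h3
    have h4 : Tendsto (fun i => q (s (ns i)) x) atTop (𝓝 (-Complex.I * m x * f x)) :=
      (hpt x).comp (hs0.comp hns.tendsto_atTop)
    have h5 := tendsto_nhds_unique (h1.congr fun i => h3 (ns i)) h4
    rw [h2, Pi.smul_apply, smul_eq_mul, mul_assoc] at h5
    exact mul_left_cancel₀ (neg_ne_zero.2 Complex.I_ne_zero) h5
  · intro h
    refine tendsto_L2_of_dominated q (fun x => ‖g x‖) (Lp.memLp g).norm hF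
      (Eventually.of_forall fun t => ?_) ?_
    · filter_upwards [h] with x hx
      rw [hx, hq, norm_mul, norm_mul (m x : ℂ), Complex.norm_real]
      gcongr
      exact norm_phase_slope_le t (m x)
    · filter_upwards [h, Lp.coeFn_smul (-Complex.I) g] with x h1 h2
      rw [h2, Pi.smul_apply, smul_eq_mul, h1, ← mul_assoc]
      exact hpt x

lemma continuous_phaseMul_mul {m : α → ℝ} (hm : Measurable m) (f : Lp ℂ 2 μ) :
    Continuous fun t : ℝ => phaseMul (fun x => -t * m x) f := by
  refine continuous_iff_continuousAt.2 fun s => ?_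
  refine tendsto_L2_of_dominated
    (fun t x => Complex.exp (Complex.I * ((-t * m x : ℝ) : ℂ)) * f x) (fun x => ‖f x‖)
    (Lp.memLp f).norm (fun t => phaseMul_coeFn (hm.const_mul (-t)) f)
    (Eventually.of_forall fun t => ae_of_all _ fun x => ?_) ?_
  · rw [norm_mul, norm_cexp_I_mul_ofReal, one_mul]
  · filter_upwards [phaseMul_coeFn (hm.const_mul (-s)) f] with x hx
    rw [hx]
    have : Continuous fun t : ℝ => Complex.exp (Complex.I * ((-t * m x : ℝ) : ℂ)) * f x := by
      fun_prop
    exact this.tendsto s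

end Dominated

/-! ### The free gradient on the Fourier side. -/

section FreeGradient

variable {d : ℕ}

open scoped FourierTransform SchwartzMap LineDeriv

/-- A distributional identity in `L₂` may be tested on smooth functions in the Sobolev class. -/
lemma integral_mul_partialD_of_forall_compact {u w : RSpace d → ℂ} (hu : MemLp u 2 volume)
    (hw : MemLp w 2 volume) (j : Fin d)
    (h : ∀ ψ : RSpace d → ℂ, ContDiff ℝ (⊤ : ℕ∞) ψ → HasCompactSupport ψ →
      ∫ x, u x * partialD j ψ x = ∫ x, w x * ψ x)
    {ψ : RSpace d → ℂ} (hψ : ContDiff ℝ (⊤ : ℕ∞) ψ) (h1 : MemLp ψ 2 volume)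
    (h2 : MemLp (partialD j ψ) 2 volume) :
    ∫ x, u x * partialD j ψ x = ∫ x, w x * ψ x := by
  -- Cut-offs θₙ(x) = b(x/(n + 1)): they are eventually 1 at each point and their derivatives are
  -- O(1/(n + 1)), so the extra term of the product rule disappears in the limit.
  let b : ContDiffBump (0 : RSpace d) := ⟨1, 2, one_pos, one_lt_two⟩
  let s : ℕ → ℝ := fun n => ((n : ℝ) + 1)⁻¹
  have hs : ∀ n, 0 < s n := fun n => by positivity
  have hs1 : ∀ n, s n ≤ 1 := fun n => inv_le_one_of_one_le₀ (by simp)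
  have hs0 : Tendsto s atTop (𝓝 0) := by
    simpa [s] using tendsto_one_div_add_atTop_nhds_zero_nat (𝕜 := ℝ)
  let θ : ℕ → RSpace d → ℂ := fun n x => ((b (s n • x) : ℝ) : ℂ)
  have hb : ContDiff ℝ (⊤ : ℕ∞) (fun x => ((b x : ℝ) : ℂ)) :=
    Complex.ofRealCLM.contDiff.comp b.contDiff
  have hbc : HasCompactSupport (fun x => ((b x : ℝ) : ℂ)) :=
    b.hasCompactSupport.comp_left (g := fun r : ℝ => (r : ℂ)) Complex.ofReal_zero
  have hθ : ∀ n, ContDiff ℝ (⊤ : ℕ∞) (θ n) := fun n => hb.comp (contDiff_const_smul (s n))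
  have hθc : ∀ n, HasCompactSupport (θ n) := fun n =>
    hbc.comp_homeomorph (Homeomorph.smulOfNeZero (s n) (hs n).ne')
  have hθd : ∀ n x, partialD j (θ n) x = s n * partialD j (fun x => ((b x : ℝ) : ℂ)) (s n • x) := by
    intro n x
    have e1 : HasFDerivAt (θ n) ((fderiv ℝ (fun x => ((b x : ℝ) : ℂ)) (s n • x)).comp
        (s n • ContinuousLinearMap.id ℝ (RSpace d))) x :=
      (hb.differentiable (by simp) _).hasFDerivAt.comp x ((hasFDerivAt_id x).const_smul (s n))
    rw [partialD, e1.fderiv]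
    simp [partialD]
  obtain ⟨C, hC⟩ := (continuous_partialD j hb).bounded_above_of_compact_support
    (hasCompactSupport_partialD j hbc)
  have hθ1 : ∀ n x, ‖θ n x‖ ≤ 1 := fun n x => by
    rw [Complex.norm_real, Real.norm_of_nonneg b.nonneg]
    exact b.le_one
  have hC0 : 0 ≤ C := (norm_nonneg _).trans (hC 0)
  have hev : ∀ x, ∀ᶠ n in atTop, θ n x = 1 := by
    intro x
    have e1 : Tendsto (fun n => s n • x) atTop (𝓝 ((0 : ℝ) • x)) := hs0.smul_const x
    rw [zero_smul] at e1
    filter_upwards [e1.eventually (b.eventuallyEq_one)] with n hn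
    simp only [θ]
    rw [hn]
    simp
  have hprod : ∀ n x, partialD j (fun x => θ n x * ψ x) x
      = θ n x * partialD j ψ x + partialD j (θ n) x * ψ x := by
    intro n x
    have := ((hθ n).differentiable (by simp) x).hasFDerivAt.mul
      (hψ.differentiable (by simp) x).hasFDerivAt
    rw [partialD, show (fun x => θ n x * ψ x) = θ n * ψ from rfl, this.fderiv]
    simp [partialD, mul_comm]
  have hlim1 : Tendsto (fun n => ∫ x, u x * partialD j (fun x => θ n x * ψ x) x) atTop
      (𝓝 (∫ x, u x * partialD j ψ x)) := by
    refine tendsto_integral_of_dominated_convergence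
      (fun x => ‖u x * partialD j ψ x‖ + C * ‖u x * ψ x‖) (fun n => ?_) ?_ (fun n => ?_) ?_
    · exact hu.1.mul (continuous_partialD j ((hθ n).mul hψ)).aestronglyMeasurable
    · exact (hu.integrable_mul h2).norm.add ((hu.integrable_mul h1).norm.const_mul C)
    · refine ae_of_all _ fun x => ?_
      have e3 : ‖partialD j (θ n) x‖ ≤ C := by
        rw [hθd, norm_mul, Complex.norm_real, Real.norm_of_nonneg (hs n).le]
        exact (mul_le_mul (hs1 n) (hC _) (norm_nonneg _) zero_le_one).trans (one_mul C).le
      rw [hprod, mul_add]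
      refine (norm_add_le _ _).trans (add_le_add ?_ ?_)
      · rw [norm_mul, norm_mul, norm_mul]
        gcongr
        exact mul_le_of_le_one_left (norm_nonneg _) (hθ1 n x)
      · rw [norm_mul, norm_mul, norm_mul]
        calc ‖u x‖ * (‖partialD j (θ n) x‖ * ‖ψ x‖) ≤ ‖u x‖ * (C * ‖ψ x‖) := by gcongr
          _ = _ := by ring
    · refine ae_of_all _ fun x => ?_
      have e4 : Tendsto (fun n => partialD j (θ n) x) atTop (𝓝 0) := by
        refine squeeze_zero_norm (fun n => ?_) (by simpa using hs0.mul_const C)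
        rw [hθd, norm_mul, Complex.norm_real, Real.norm_of_nonneg (hs n).le]
        gcongr
        exact hC _
      have e5 : Tendsto (fun n => θ n x) atTop (𝓝 1) :=
        tendsto_const_nhds.congr' ((hev x).mono fun n hn => hn.symm)
      simp only [hprod]
      have := ((e5.mul_const (partialD j ψ x)).add (e4.mul_const (ψ x))).const_mul (u x)
      simpa using this
  have hlim2 : Tendsto (fun n => ∫ x, w x * (θ n x * ψ x)) atTop (𝓝 (∫ x, w x * ψ x)) := by
    refine tendsto_integral_of_dominated_convergence (fun x => ‖w x * ψ x‖) (fun n => ?_)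
      (hw.integrable_mul h1).norm (fun n => ?_) ?_
    · exact hw.1.mul ((hθ n).continuous.mul hψ.continuous).aestronglyMeasurable
    · refine ae_of_all _ fun x => ?_
      rw [norm_mul, norm_mul, norm_mul]
      gcongr
      exact mul_le_of_le_one_left (norm_nonneg _) (hθ1 n x)
    · refine ae_of_all _ fun x => tendsto_const_nhds.congr' ?_
      filter_upwards [hev x] with n hn
      rw [hn, one_mul]
  refine tendsto_nhds_unique (hlim1.congr fun n => ?_) hlim2
  exact h _ ((hθ n).mul hψ) (hθc n).mul_right

/-- The L₂ transform agrees with that of tempered distributions, which is defined by this duality.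
-/
lemma integral_fourierTransform_mul (u : L2Space d) (η : 𝓢(RSpace d, ℂ)) :
    ∫ x, u x * 𝓕 η x = ∫ ξ, (Lp.fourierTransformₗᵢ (RSpace d) ℂ u) ξ * η ξ := by
  have h := congrArg (fun T => T η) (Lp.fourier_toTemperedDistribution_eq u)
  simp only [TemperedDistribution.fourier_apply, Lp.toTemperedDistribution_apply, smul_eq_mul] at h
  simp only [mul_comm (u _), mul_comm ((Lp.fourierTransformₗᵢ (RSpace d) ℂ u : L2Space d) _)]
  exact h

lemma partialD_schwartz (j : Fin d) (η : 𝓢(RSpace d, ℂ)) (x : RSpace d) :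
    partialD j η x = (∂_{EuclideanSpace.single j (1 : ℝ)} η) x := by
  rw [SchwartzMap.lineDerivOp_apply_eq_fderiv]
  rfl

lemma hasTemperateGrowth_coord (j : Fin d) :
    Function.HasTemperateGrowth (fun y : RSpace d => ((y j : ℝ) : ℝ)) :=
  (EuclideanSpace.proj j : RSpace d →L[ℝ] ℝ).hasTemperateGrowth

lemma partialD_fourier_schwartz (j : Fin d) (η : 𝓢(RSpace d, ℂ)) (x : RSpace d) :
    partialD j (𝓕 η : 𝓢(RSpace d, ℂ)) x = (𝓕 (-(2 * Real.pi * Complex.I) •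
      SchwartzMap.smulLeftCLM ℂ (fun y : RSpace d => y j) η) : 𝓢(RSpace d, ℂ)) x := by
  rw [partialD_schwartz, SchwartzMap.lineDerivOp_fourier_eq]
  simp [EuclideanSpace.inner_single_right]

lemma fourierL2_coeFn (f : L2Space d) :
    fourierL2 d f =ᵐ[volume] fun ξ => (((2 * Real.pi) ^ (-(d : ℝ) / 2) : ℝ) : ℂ) *
      (Lp.fourierTransformₗᵢ (RSpace d) ℂ f) ((2 * Real.pi)⁻¹ • ξ) := by
  rw [fourierL2_apply]
  refine (Lp.coeFn_smul _ _).trans ?_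
  filter_upwards [compSMul_coeFn (c := (2 * Real.pi)⁻¹) (by positivity)
    (Lp.fourierTransformₗᵢ (RSpace d) ℂ f)] with x hx
  rw [Pi.smul_apply, hx, smul_eq_mul]

lemma fourierL2_comp_smul (f : L2Space d) :
    (fun ξ => fourierL2 d f ((2 * Real.pi) • ξ)) =ᵐ[volume]
      fun ξ => (((2 * Real.pi) ^ (-(d : ℝ) / 2) : ℝ) : ℂ) *
        (Lp.fourierTransformₗᵢ (RSpace d) ℂ f) ξ := by
  have hpi : 2 * Real.pi ≠ 0 := by positivity
  filter_upwards [(quasiMeasurePreserving_const_smul hpi).ae_eq_comp (fourierL2_coeFn f)] with x hx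
  simpa only [Function.comp_apply, smul_smul, inv_mul_cancel₀ hpi, one_smul] using hx

lemma locallyL2_id : LocallyL2 (fun x : RSpace d => x) := by
  intro K hK
  have : IsFiniteMeasure (volume.restrict K) := ⟨by simpa using hK.measure_lt_top⟩
  obtain ⟨C, hC⟩ := hK.isBounded.exists_norm_le
  exact MemLp.of_bound measurable_id.aestronglyMeasurable C
    (ae_restrict_of_forall_mem hK.measurableSet hC)

/-- `i∇u = g` in terms of Mathlib's Fourier transform. -/
lemma isMagneticGradient_zero_iff_fourierTransform {u : L2Space d} {g : Fin d → L2Space d} :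
    IsMagneticGradient (fun _ => 0) u g ↔
      ∀ j, Lp.fourierTransformₗᵢ (RSpace d) ℂ (g j) =ᵐ[volume]
        fun ξ => -(2 * Real.pi) * (((ξ j : ℝ) : ℂ) * Lp.fourierTransformₗᵢ (RSpace d) ℂ u ξ) := by
  refine forall_congr' fun j => ?_
  have hpd : ∀ η : 𝓢(RSpace d, ℂ), ∫ x, u x * partialD j (𝓕 η : 𝓢(RSpace d, ℂ)) x
      = -(2 * Real.pi * Complex.I) * ∫ ξ, ((ξ j : ℝ) : ℂ) *
        Lp.fourierTransformₗᵢ (RSpace d) ℂ u ξ * η ξ := by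
    intro η
    simp only [partialD_fourier_schwartz]
    rw [integral_fourierTransform_mul, ← integral_const_mul]
    refine integral_congr_ae (ae_of_all _ fun ξ => ?_)
    simp only [smul_apply, smul_eq_mul,
      SchwartzMap.smulLeftCLM_apply_apply (hasTemperateGrowth_coord j), Complex.real_smul]
    ring
  constructor
  · rintro ⟨-, h⟩
    have h' : ∀ ψ : RSpace d → ℂ, ContDiff ℝ (⊤ : ℕ∞) ψ → HasCompactSupport ψ →
        ∫ x, u x * partialD j ψ x = ∫ x, Complex.I * g j x * ψ x := by
      intro ψ hψ hc
      have h1 := h ψ hψ hc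
      simp only [PiLp.zero_apply, Complex.ofReal_zero, zero_mul, integral_zero, add_zero] at h1
      simp only [mul_assoc]
      rw [integral_const_mul, ← h1, ← mul_assoc, mul_neg, Complex.I_mul_I, neg_neg, one_mul]
    refine ae_eq_of_integral_contDiff_smul_eq ((Lp.memLp _).locallyIntegrable (by norm_num))
      ((locallyL2_id.locallyIntegrable_mul j _).smul (-(2 * Real.pi) : ℂ)) fun ρ hρ hρc => ?_
    have hρ1 : HasCompactSupport (Complex.ofRealCLM ∘ ρ) := hρc.comp_left rfl
    have hρ2 : ContDiff ℝ (⊤ : ℕ∞) (Complex.ofRealCLM ∘ ρ) := by fun_prop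
    set η : 𝓢(RSpace d, ℂ) := hρ1.toSchwartzMap hρ2 with hη
    have hηx : ∀ x, η x = ρ x := fun x => rfl
    -- The test function 𝓕η is Schwartz but not, in general, compactly supported; hence the
    -- extension of the weak identity beyond compact supports.
    have h2 := integral_mul_partialD_of_forall_compact (Lp.memLp u)
      ((Lp.memLp (g j)).const_mul Complex.I) j h' (ψ := (𝓕 η : 𝓢(RSpace d, ℂ)))
      ((𝓕 η : 𝓢(RSpace d, ℂ)).smooth _) ((𝓕 η : 𝓢(RSpace d, ℂ)).memLp 2)
      (by
        rw [show partialD j (𝓕 η : 𝓢(RSpace d, ℂ)) = _ from funext (partialD_fourier_schwartz j η)]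
        exact SchwartzMap.memLp _ 2 volume)
    rw [hpd] at h2
    simp only [mul_assoc] at h2
    rw [integral_const_mul, integral_fourierTransform_mul] at h2
    have h3 : (∫ x, ρ x • Lp.fourierTransformₗᵢ (RSpace d) ℂ (g j) x)
        = ∫ ξ, Lp.fourierTransformₗᵢ (RSpace d) ℂ (g j) ξ * η ξ :=
      integral_congr_ae (ae_of_all _ fun x => by
        simp only [hηx, Complex.real_smul]; ring)
    have h4 : (∫ x, ρ x • (-(2 * Real.pi) * (((x j : ℝ) : ℂ) *
        Lp.fourierTransformₗᵢ (RSpace d) ℂ u x)))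
        = -(2 * Real.pi) * ∫ ξ, ((ξ j : ℝ) : ℂ) *
          (Lp.fourierTransformₗᵢ (RSpace d) ℂ u ξ * η ξ) := by
      rw [← integral_const_mul]
      refine integral_congr_ae (ae_of_all _ fun x => ?_)
      simp only [hηx, Complex.real_smul]; ring
    rw [h3]
    refine Eq.trans ?_ h4.symm
    refine mul_left_cancel₀ Complex.I_ne_zero ?_
    rw [← h2]
    ring
  · intro h
    refine ⟨by simpa using locallyIntegrable_zero (X := RSpace d) (ε'' := ℂ) (μ := volume), ?_⟩
    intro ψ hψ hc
    simp only [PiLp.zero_apply, Complex.ofReal_zero, zero_mul, integral_zero, add_zero]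
    set ψs : 𝓢(RSpace d, ℂ) := hc.toSchwartzMap hψ with hψs
    -- Every test function is itself a Fourier transform, so the duality formula applies to it.
    set η : 𝓢(RSpace d, ℂ) := 𝓕⁻ ψs with hη
    have hηψ : (𝓕 η : 𝓢(RSpace d, ℂ)) = ψs := FourierTransform.fourier_fourierInv_eq ψs
    have hcoe : ψ = (𝓕 η : 𝓢(RSpace d, ℂ)) := by rw [hηψ]; rfl
    rw [hcoe, hpd, integral_fourierTransform_mul, ← mul_assoc, ← integral_const_mul]
    refine integral_congr_ae ?_
    filter_upwards [h] with x hx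
    rw [hx]
    linear_combination (2 * Real.pi * ((x j : ℝ) : ℂ) *
      Lp.fourierTransformₗᵢ (RSpace d) ℂ u x * η x) * Complex.I_mul_I

/-- `i∇u = g` in terms of the Fourier transforms. -/
lemma isMagneticGradient_zero_iff {u : L2Space d} {g : Fin d → L2Space d} :
    IsMagneticGradient (fun _ => 0) u g ↔
      ∀ j, fourierL2 d (g j) =ᵐ[volume] fun ξ => -((ξ j : ℝ) : ℂ) * fourierL2 d u ξ := by
  rw [isMagneticGradient_zero_iff_fourierTransform]
  have hpi : 2 * Real.pi ≠ 0 := by positivity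
  have hc : (((2 * Real.pi) ^ (-(d : ℝ) / 2) : ℝ) : ℂ) ≠ 0 := by
    exact_mod_cast (by positivity : (0 : ℝ) < (2 * Real.pi) ^ (-(d : ℝ) / 2)).ne'
  refine forall_congr' fun j => ⟨fun h => ?_, fun h => ?_⟩
  · filter_upwards [fourierL2_coeFn (g j), fourierL2_coeFn u,
      (quasiMeasurePreserving_const_smul (inv_ne_zero hpi)).ae_eq_comp h] with ξ h1 h2 h3
    simp only [Function.comp_apply] at h3
    rw [h1, h2, h3, PiLp.smul_apply, smul_eq_mul]
    push_cast
    have : (Real.pi : ℂ) ≠ 0 := by exact_mod_cast Real.pi_ne_zero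
    field_simp
  · filter_upwards [fourierL2_comp_smul (g j), fourierL2_comp_smul u,
      (quasiMeasurePreserving_const_smul hpi).ae_eq_comp h] with ξ h1 h2 h3
    simp only [Function.comp_apply] at h3
    rw [h1, h2, PiLp.smul_apply, smul_eq_mul] at h3
    refine mul_left_cancel₀ hc ?_
    rw [h3]
    push_cast
    ring

end FreeGradient

/-! ### The free Hamiltonian and its group as Fourier multipliers. -/

section FreeHamiltonian

variable {d : ℕ}

/-- Plancherel in each component, followed by ∑ ξⱼ² = |ξ|². -/
lemma sum_inner_freeGradient {u v : L2Space d} {g h : Fin d → L2Space d}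
    (hg : IsMagneticGradient (fun _ => 0) u g) (hh : IsMagneticGradient (fun _ => 0) v h) :
    Integrable (fun ξ => (starRingEnd ℂ) (fourierL2 d v ξ) *
      (((‖ξ‖ ^ 2 : ℝ) : ℂ) * fourierL2 d u ξ)) volume ∧
    ∑ j, inner ℂ (h j) (g j) = ∫ ξ, (starRingEnd ℂ) (fourierL2 d v ξ) *
      (((‖ξ‖ ^ 2 : ℝ) : ℂ) * fourierL2 d u ξ) := by
  rw [isMagneticGradient_zero_iff] at hg hh
  have hint : ∀ j, Integrable (fun ξ => inner ℂ (fourierL2 d (h j) ξ) (fourierL2 d (g j) ξ))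
      volume := fun j => L2.integrable_inner _ _
  have hsum : (fun ξ => ∑ j, inner ℂ (fourierL2 d (h j) ξ) (fourierL2 d (g j) ξ))
      =ᵐ[volume] fun ξ => (starRingEnd ℂ) (fourierL2 d v ξ) *
        (((‖ξ‖ ^ 2 : ℝ) : ℂ) * fourierL2 d u ξ) := by
    filter_upwards [ae_all_iff.2 hg, ae_all_iff.2 hh] with ξ h1 h2
    simp only [h1, h2, RCLike.inner_apply, map_mul, map_neg, Complex.conj_ofReal]
    rw [EuclideanSpace.norm_sq_eq, Complex.ofReal_sum, Finset.sum_mul, Finset.mul_sum]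
    refine Finset.sum_congr rfl fun j _ => ?_
    rw [Real.norm_eq_abs, sq_abs]
    push_cast
    ring
  refine ⟨(integrable_finsetSum _ fun j _ => hint j).congr hsum, ?_⟩
  rw [← integral_congr_ae hsum, integral_finsetSum _ fun j _ => hint j]
  refine Finset.sum_congr rfl fun j _ => ?_
  rw [← inner_fourierL2, L2.inner_def]

/-- Forward, the form identity is tested on functions with Fourier transform supported in a ball,
which lie in the form domain. Backward, |ξⱼ| ≤ 1 + |ξ|² places u in the form domain. -/
lemma mem_magneticGraph_zero_iff {u f : L2Space d} :
    (u, f) ∈ magneticGraph (fun _ : RSpace d => 0) ↔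
      fourierL2 d f =ᵐ[volume] fun ξ => ((‖ξ‖ ^ 2 : ℝ) : ℂ) * fourierL2 d u ξ := by
  constructor
  · rintro ⟨g, hg, hpair⟩
    have hmem : ∀ n : ℕ, MemLp ((Metric.ball (0 : RSpace d) n).indicator
        fun ξ => ((‖ξ‖ ^ 2 : ℝ) : ℂ) * fourierL2 d u ξ) 2 volume := by
      intro n
      refine MemLp.of_le_mul (c := (n : ℝ) ^ 2) (Lp.memLp (fourierL2 d u)) ?_
        (ae_of_all _ fun ξ => ?_)
      · refine AEStronglyMeasurable.indicator ?_ Metric.isOpen_ball.measurableSet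
        exact (Continuous.aestronglyMeasurable (by fun_prop)).mul (Lp.aestronglyMeasurable _)
      · by_cases hξ : ξ ∈ Metric.ball (0 : RSpace d) n
        · rw [indicator_of_mem hξ, norm_mul, Complex.norm_real, norm_pow, norm_norm]
          rw [mem_ball_zero_iff] at hξ
          gcongr
        · rw [indicator_of_notMem hξ, norm_zero]
          positivity
    have hball : ∀ n : ℕ, ∀ᵐ ξ ∂(volume : Measure (RSpace d)), ξ ∈ Metric.ball (0 : RSpace d) n →
        fourierL2 d f ξ = ((‖ξ‖ ^ 2 : ℝ) : ℂ) * fourierL2 d u ξ := by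
      intro n
      set B := Metric.ball (0 : RSpace d) n with hB
      have hBm : MeasurableSet B := Metric.isOpen_ball.measurableSet
      have hf : MemLp (B.indicator (fourierL2 d f)) 2 volume := (Lp.memLp _).indicator hBm
      -- The test function is the defect itself: taking v with transform r, the restriction of f̂ -
      -- |ξ|²û to the ball, turns the form identity into ⟨r, r⟩ = 0.
      set r : L2Space d := (hf.sub (hmem n)).toLp _ with hr
      have hrx : r =ᵐ[volume] fun ξ => B.indicator (fun ξ => fourierL2 d f ξ
          - ((‖ξ‖ ^ 2 : ℝ) : ℂ) * fourierL2 d u ξ) ξ := by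
        filter_upwards [(hf.sub (hmem n)).coeFn_toLp] with ξ h1
        rw [h1, Pi.sub_apply]
        by_cases hξ : ξ ∈ B
        · rw [indicator_of_mem hξ, indicator_of_mem hξ, indicator_of_mem hξ]
        · rw [indicator_of_notMem hξ, indicator_of_notMem hξ, indicator_of_notMem hξ, sub_zero]
      have hrj : ∀ j, MemLp (fun ξ => -((ξ j : ℝ) : ℂ) * r ξ) 2 volume := by
        intro j
        refine MemLp.of_le_mul (c := (n : ℝ)) (Lp.memLp r) ?_ ?_
        · exact (Continuous.aestronglyMeasurable (by fun_prop)).mul (Lp.aestronglyMeasurable _)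
        · filter_upwards [hrx] with ξ h1
          by_cases hξ : ξ ∈ B
          · rw [norm_mul, norm_neg, Complex.norm_real]
            rw [hB, mem_ball_zero_iff] at hξ
            gcongr
            exact (PiLp.norm_apply_le ξ j).trans hξ.le
          · rw [h1, indicator_of_notMem hξ]
            simp
      set v := ContinuousLinearMap.adjoint (fourierL2 d) r with hv
      have hFv : fourierL2 d v = r := fourierL2_adjoint_fourierL2 r
      have hgrad : IsMagneticGradient (fun _ => 0) v
          fun j => ContinuousLinearMap.adjoint (fourierL2 d) ((hrj j).toLp _) := by
        rw [isMagneticGradient_zero_iff]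
        intro j
        rw [fourierL2_adjoint_fourierL2, hFv]
        exact (hrj j).coeFn_toLp
      obtain ⟨i1, e1⟩ := sum_inner_freeGradient hg hgrad
      have e2 := hpair _ _ hgrad
      rw [e1, ← inner_fourierL2, L2.inner_def] at e2
      have i2 := L2.integrable_inner (𝕜 := ℂ) (fourierL2 d v) (fourierL2 d f)
      have e3 : inner ℂ r r = (0 : ℂ) := by
        rw [← sub_eq_zero.2 e2.symm, ← integral_sub i2 i1, L2.inner_def]
        refine integral_congr_ae ?_
        rw [hFv]
        filter_upwards [hrx] with ξ h1
        simp only [RCLike.inner_apply]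
        by_cases hξ : ξ ∈ B
        · rw [h1, indicator_of_mem hξ]
          ring
        · rw [h1, indicator_of_notMem hξ]
          simp
      have e4 : r = 0 := inner_self_eq_zero.1 e3
      have e5 := Lp.coeFn_zero ℂ 2 (volume : Measure (RSpace d))
      rw [← e4] at e5
      filter_upwards [hrx, e5] with ξ h1 h2 hξ
      rw [h2, indicator_of_mem hξ] at h1
      exact (sub_eq_zero.1 h1.symm)
    filter_upwards [ae_all_iff.2 hball] with ξ hξ
    obtain ⟨n, hn⟩ := exists_nat_gt ‖ξ‖
    exact hξ n (mem_ball_zero_iff.2 hn)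
  · intro h
    have hmem : ∀ j, MemLp (fun ξ => -((ξ j : ℝ) : ℂ) * fourierL2 d u ξ) 2 volume := by
      intro j
      refine MemLp.of_le ((Lp.memLp (fourierL2 d u)).norm.add (Lp.memLp (fourierL2 d f)).norm) ?_ ?_
      · exact (Continuous.aestronglyMeasurable (by fun_prop)).mul (Lp.aestronglyMeasurable _)
      · filter_upwards [h] with ξ h1
        have h2 : ‖ξ j‖ ≤ 1 + ‖ξ‖ ^ 2 := by
          have := PiLp.norm_apply_le ξ j
          nlinarith [sq_nonneg (‖ξ‖ - 1), norm_nonneg ξ]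
        have h3 : ‖-((ξ j : ℝ) : ℂ) * fourierL2 d u ξ‖ = ‖ξ j‖ * ‖fourierL2 d u ξ‖ := by
          rw [norm_mul, norm_neg, Complex.norm_real]
        have h4 : ‖fourierL2 d f ξ‖ = ‖ξ‖ ^ 2 * ‖fourierL2 d u ξ‖ := by
          rw [h1, norm_mul, Complex.norm_real, norm_pow, norm_norm]
        rw [Pi.add_apply, h3, h4]
        refine le_trans ?_ (le_abs_self _)
        calc ‖ξ j‖ * ‖fourierL2 d u ξ‖ ≤ (1 + ‖ξ‖ ^ 2) * ‖fourierL2 d u ξ‖ := by gcongr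
          _ = _ := by ring
    have hgrad : IsMagneticGradient (fun _ => 0) u
        fun j => ContinuousLinearMap.adjoint (fourierL2 d) ((hmem j).toLp _) := by
      rw [isMagneticGradient_zero_iff]
      intro j
      rw [fourierL2_adjoint_fourierL2]
      exact (hmem j).coeFn_toLp
    refine ⟨_, hgrad, fun v k hv => ?_⟩
    rw [(sum_inner_freeGradient hgrad hv).2, ← inner_fourierL2, L2.inner_def]
    refine integral_congr_ae ?_
    filter_upwards [h] with ξ h1
    simp only [RCLike.inner_apply, h1]
    ring

lemma mem_graph_freeHamiltonian_iff {u f : L2Space d} :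
    (u, f) ∈ (freeHamiltonian d).graph ↔
      fourierL2 d f =ᵐ[volume] fun ξ => ((‖ξ‖ ^ 2 : ℝ) : ℂ) * fourierL2 d u ξ := by
  rw [freeHamiltonian, magneticSchrodinger, Submodule.toLinearPMap_graph_eq]
  · exact mem_magneticGraph_zero_iff
  · rintro ⟨v, g⟩ hp (rfl : v = 0)
    rw [mem_magneticGraph_zero_iff, map_zero] at hp
    refine fourierL2_injective ?_
    rw [map_zero]
    refine Lp.ext ?_
    filter_upwards [hp, Lp.coeFn_zero ℂ 2 (volume : Measure (RSpace d))] with x h1 h2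
    rw [h1, h2]
    simp

/-- After 𝓕 this is the group of multiplications by e^{-it|ξ|²}, the generator of which is known. It
replaces the abstractly chosen group of H₀ by an explicit one. -/
lemma isUnitaryGroup_freeHamiltonian :
    IsUnitaryGroup (freeHamiltonian d) fun t => fourierPhase fun ξ => -t * ‖ξ‖ ^ 2 where
  zero := by
    ext1 f
    refine fourierL2_injective ?_
    rw [fourierL2_fourierPhase]
    simp [phaseMul_zero]
  add s t := by
    ext1 f
    refine fourierL2_injective ?_
    rw [ContinuousLinearMap.comp_apply, fourierL2_fourierPhase, fourierL2_fourierPhase,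
      fourierL2_fourierPhase, phaseMul_phaseMul (by fun_prop) (by fun_prop)]
    congr 3
    ext x
    ring
  norm_map t f := norm_fourierPhase (by fun_prop) f
  continuous f := (ContinuousLinearMap.adjoint (fourierL2 d)).continuous.comp
    (continuous_phaseMul_mul (m := fun ξ => ‖ξ‖ ^ 2) (by fun_prop) (fourierL2 d f))
  generator f g := by
    rw [mem_graph_freeHamiltonian_iff, ← tendsto_phaseMul_slope_iff (m := fun ξ => ‖ξ‖ ^ 2)
      (by fun_prop)]
    constructor
    · intro h
      have h1 := ((ContinuousLinearMap.adjoint (fourierL2 d)).continuous.tendsto _).comp h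
      rw [map_smul, adjoint_fourierL2_fourierL2] at h1
      refine h1.congr fun t => ?_
      simp only [Function.comp_apply, map_smul, map_sub, adjoint_fourierL2_fourierL2]
      rfl
    · intro h
      have h1 := ((fourierL2 d).continuous.tendsto _).comp h
      rw [map_smul] at h1
      refine h1.congr fun t => ?_
      simp only [Function.comp_apply, map_smul, map_sub, fourierL2_fourierPhase]

lemma unitaryGroup_freeHamiltonian (t : ℝ) (f : L2Space d) :
    unitaryGroup (freeHamiltonian d) t f = fourierPhase (fun ξ => -t * ‖ξ‖ ^ 2) f := by
  rw [isUnitaryGroup_freeHamiltonian.unitaryGroup_eq]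

end FreeHamiltonian

/-! ### The free propagator on Schwartz functions. -/

section Propagator

variable {d : ℕ}

open scoped FourierTransform SchwartzMap

lemma hasTemperateGrowth_cexp_I_mul :
    Function.HasTemperateGrowth (fun t : ℝ => Complex.exp (Complex.I * (t : ℂ))) := by
  have hd : ∀ n : ℕ, iteratedDeriv n (fun t : ℝ => Complex.exp (Complex.I * (t : ℂ)))
      = fun t : ℝ => Complex.I ^ n * Complex.exp (Complex.I * (t : ℂ)) := by
    intro n
    induction n with
    | zero => simp
    | succ k ih =>
      rw [iteratedDeriv_succ, ih]
      ext t
      have h1 : HasDerivAt (fun t : ℝ => Complex.I * (t : ℂ)) Complex.I t := by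
        simpa using (Complex.ofRealCLM.hasDerivAt (x := t)).const_mul Complex.I
      rw [(h1.cexp.const_mul (Complex.I ^ k)).deriv, pow_succ]
      ring
  refine ⟨?_, fun n => ⟨0, 1, fun t => ?_⟩⟩
  · exact (contDiff_const.mul Complex.ofRealCLM.contDiff).cexp
  · rw [norm_iteratedFDeriv_eq_norm_iteratedDeriv, hd, norm_mul, norm_pow, Complex.norm_I,
      norm_cexp_I_mul_ofReal]
    simp

lemma hasTemperateGrowth_quadratic_phase (a : ℝ) :
    Function.HasTemperateGrowth
      (fun x : RSpace d => Complex.exp (Complex.I * ((a * ‖x‖ ^ 2 : ℝ) : ℂ))) :=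
  hasTemperateGrowth_cexp_I_mul.comp
    ((Function.HasTemperateGrowth.const a).mul (Function.hasTemperateGrowth_norm_sq (RSpace d)))

/-- Multiplication by `e^{ia|x|²}` in the Schwartz space. -/
def schwartzPhase (a : ℝ) (η : 𝓢(RSpace d, ℂ)) : 𝓢(RSpace d, ℂ) :=
  SchwartzMap.smulLeftCLM ℂ
    (fun x : RSpace d => Complex.exp (Complex.I * ((a * ‖x‖ ^ 2 : ℝ) : ℂ))) η

lemma schwartzPhase_apply (a : ℝ) (η : 𝓢(RSpace d, ℂ)) (x : RSpace d) :
    schwartzPhase a η x = Complex.exp (Complex.I * ((a * ‖x‖ ^ 2 : ℝ) : ℂ)) * η x := by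
  rw [schwartzPhase, SchwartzMap.smulLeftCLM_apply_apply (hasTemperateGrowth_quadratic_phase a),
    smul_eq_mul]

lemma phaseMul_toLp (a : ℝ) (η : 𝓢(RSpace d, ℂ)) :
    phaseMul (fun x : RSpace d => a * ‖x‖ ^ 2) (η.toLp 2 : L2Space d)
      = (schwartzPhase a η).toLp 2 := by
  refine Lp.ext ?_
  filter_upwards [phaseMul_coeFn (g := fun x : RSpace d => a * ‖x‖ ^ 2) (by fun_prop)
    (η.toLp 2 : L2Space d), η.coeFn_toLp 2 volume, (schwartzPhase a η).coeFn_toLp 2 volume]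
    with x h1 h2 h3
  rw [h1, h2, h3, schwartzPhase_apply]

/-- The regularized kernel of the free propagator. -/
lemma integral_fourier_mul_gaussian (η : 𝓢(RSpace d, ℂ)) (x : RSpace d) {b : ℂ} (hb : 0 < b.re) :
    ∫ k, 𝓕 η k * Complex.exp (-b * ‖k‖ ^ 2 + 2 * Real.pi * Complex.I * inner ℝ x k)
      = ∫ w, η w * ((Real.pi / b) ^ ((d : ℂ) / 2) *
          Complex.exp (-Real.pi ^ 2 * ‖x - w‖ ^ 2 / b)) := by
  have h1 := VectorFourier.integral_fourierIntegral_smul_eq_flip (L := innerₗ (RSpace d))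
    Real.continuous_fourierChar continuous_inner (η.integrable (μ := volume))
    (GaussianFourier.integrable_cexp_neg_mul_sq_norm_add hb (2 * Real.pi * Complex.I) x)
  rw [flip_innerₗ] at h1
  refine h1.trans (integral_congr_ae (ae_of_all _ fun w => ?_))
  have h2 := fourier_gaussian_innerProductSpace' hb x w
  rw [finrank_euclideanSpace_fin] at h2
  exact congrArg (η w * ·) h2

lemma re_inv_nonneg_of_nonneg {b : ℂ} (hb : 0 ≤ b.re) : 0 ≤ (b⁻¹).re := by
  rw [Complex.inv_re]
  exact div_nonneg hb (Complex.normSq_nonneg b)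

/-- Limit ε → 0+ of the Gaussian formula with b = ε + is. Both b and 1/b have nonnegative real part,
so the two integrands are dominated by |𝓕η| and |η|. -/
lemma integral_fourier_mul_imaginary_gaussian (η : 𝓢(RSpace d, ℂ)) (x : RSpace d) {s : ℝ}
    (hs : s ≠ 0) :
    ∫ k, 𝓕 η k * Complex.exp (-(Complex.I * s) * ‖k‖ ^ 2 + 2 * Real.pi * Complex.I * inner ℝ x k)
      = ∫ w, η w * ((Real.pi / (Complex.I * s)) ^ ((d : ℂ) / 2) *
          Complex.exp (-Real.pi ^ 2 * ‖x - w‖ ^ 2 / (Complex.I * s))) := by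
  set b : ℝ → ℂ := fun ε => (ε : ℂ) + Complex.I * s with hbdef
  have hs' : (s : ℂ) ≠ 0 := by exact_mod_cast hs
  have hb0 : Complex.I * (s : ℂ) ≠ 0 := mul_ne_zero Complex.I_ne_zero hs'
  have hbre : ∀ ε, (b ε).re = ε := fun ε => by simp [b]
  have hbc : Tendsto b (𝓝[>] 0) (𝓝 (Complex.I * s)) := by
    have : Continuous b := by fun_prop
    have h := this.tendsto 0
    simp only [b, Complex.ofReal_zero, zero_add] at h
    exact h.mono_left nhdsWithin_le_nhds
  have hpos : ∀ᶠ ε : ℝ in 𝓝[>] 0, 0 < ε := self_mem_nhdsWithin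
  have hL : Tendsto (fun ε => ∫ k, 𝓕 η k *
      Complex.exp (-(b ε) * ‖k‖ ^ 2 + 2 * Real.pi * Complex.I * inner ℝ x k)) (𝓝[>] 0)
      (𝓝 (∫ k, 𝓕 η k * Complex.exp (-(Complex.I * s) * ‖k‖ ^ 2
        + 2 * Real.pi * Complex.I * inner ℝ x k))) := by
    refine tendsto_integral_filter_of_dominated_convergence (fun k => ‖𝓕 η k‖)
      (Eventually.of_forall fun ε => ?_) ?_ (𝓕 η).integrable.norm (ae_of_all _ fun k => ?_)
    · exact (Continuous.aestronglyMeasurable (by fun_prop))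
    · filter_upwards [hpos] with ε hε
      refine ae_of_all _ fun k => ?_
      rw [norm_mul]
      refine mul_le_of_le_one_right (norm_nonneg _) ?_
      rw [Complex.norm_exp, Real.exp_le_one_iff]
      have e : (-(b ε) * ‖k‖ ^ 2 + 2 * Real.pi * Complex.I * inner ℝ x k : ℂ).re
          = -(ε * ‖k‖ ^ 2) := by
        have e1 : ((‖k‖ : ℂ) ^ 2) = ((‖k‖ ^ 2 : ℝ) : ℂ) := by push_cast; rfl
        rw [e1, Complex.add_re, Complex.re_mul_ofReal, Complex.neg_re, hbre]
        simp
      rw [e]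
      exact neg_nonpos.2 (by positivity)
    · have : Continuous fun c : ℂ => 𝓕 η k *
          Complex.exp (-c * ‖k‖ ^ 2 + 2 * Real.pi * Complex.I * inner ℝ x k) := by fun_prop
      exact (this.tendsto _).comp hbc
  have hpow : Tendsto (fun ε => ((Real.pi : ℂ) / b ε) ^ ((d : ℂ) / 2)) (𝓝[>] 0)
      (𝓝 ((Real.pi / (Complex.I * s)) ^ ((d : ℂ) / 2))) := by
    refine ((tendsto_const_nhds.div hbc hb0).cpow tendsto_const_nhds ?_)
    -- The limit π/(is) is purely imaginary and nonzero, so the complex power is continuous there.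
    right
    have : (Real.pi : ℂ) / (Complex.I * s) = ((-(Real.pi / s) : ℝ) : ℂ) * Complex.I := by
      field_simp
      push_cast
      field_simp
      rw [Complex.I_sq]
      ring
    rw [this, Complex.im_ofReal_mul]
    simpa using hs
  have hR : Tendsto (fun ε => ∫ w, η w * Complex.exp (-Real.pi ^ 2 * ‖x - w‖ ^ 2 / b ε)) (𝓝[>] 0)
      (𝓝 (∫ w, η w * Complex.exp (-Real.pi ^ 2 * ‖x - w‖ ^ 2 / (Complex.I * s)))) := by
    refine tendsto_integral_filter_of_dominated_convergence (fun k => ‖η k‖)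
      (Eventually.of_forall fun ε => ?_) ?_ η.integrable.norm (ae_of_all _ fun w => ?_)
    · exact (Continuous.aestronglyMeasurable (by fun_prop))
    · filter_upwards [hpos] with ε hε
      refine ae_of_all _ fun w => ?_
      rw [norm_mul]
      refine mul_le_of_le_one_right (norm_nonneg _) ?_
      rw [Complex.norm_exp, Real.exp_le_one_iff]
      have e1 : (-Real.pi ^ 2 * ‖x - w‖ ^ 2 / b ε : ℂ)
          = ((-(Real.pi ^ 2 * ‖x - w‖ ^ 2) : ℝ) : ℂ) * (b ε)⁻¹ := by
        push_cast; ring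
      rw [e1, Complex.re_ofReal_mul]
      exact mul_nonpos_of_nonpos_of_nonneg (neg_nonpos.2 (by positivity))
        (re_inv_nonneg_of_nonneg (by rw [hbre]; exact hε.le))
    · refine Tendsto.const_mul _ ?_
      exact (Complex.continuous_exp.tendsto _).comp (tendsto_const_nhds.div hbc hb0)
  have hR' := hpow.mul hR
  have pull : ∀ (c : ℂ) (F : RSpace d → ℂ), (∫ w, η w * (c * F w)) = c * ∫ w, η w * F w := by
    intro c F
    rw [← integral_const_mul]
    congr 1
    ext w
    ring
  rw [pull]
  refine tendsto_nhds_unique (hL.congr' ?_) hR'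
  filter_upwards [hpos] with ε hε
  rw [integral_fourier_mul_gaussian η x (by rw [hbre]; exact hε), pull]

/-- The formula `e^{-itH₀} = c M D 𝓕 M` on Schwartz functions. -/
lemma fourierInv_schwartzPhase_fourier (η : 𝓢(RSpace d, ℂ)) (x : RSpace d) {t : ℝ} (ht : t ≠ 0) :
    𝓕⁻ (schwartzPhase (-(4 * Real.pi ^ 2 * t)) (𝓕 η)) x
      = (Real.pi / (Complex.I * (4 * Real.pi ^ 2 * t : ℝ))) ^ ((d : ℂ) / 2) *
        (Complex.exp (Complex.I * (((4 * t)⁻¹ * ‖x‖ ^ 2 : ℝ) : ℂ)) *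
          𝓕 (schwartzPhase (4 * t)⁻¹ η) ((4 * Real.pi * t)⁻¹ • x)) := by
  -- With Mathlib's frequency k = ξ/(2π), the phase t|ξ|² is 4π²t|k|².
  have hs : 4 * Real.pi ^ 2 * t ≠ 0 := by positivity
  have hpi : (Real.pi : ℂ) ≠ 0 := by exact_mod_cast Real.pi_ne_zero
  have ht' : (t : ℂ) ≠ 0 := by exact_mod_cast ht
  have h := integral_fourier_mul_imaginary_gaussian η x hs
  rw [SchwartzMap.fourierInv_coe, Real.fourierInv_eq', SchwartzMap.fourier_coe, Real.fourier_eq']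
  refine Eq.trans ?_ (h.trans ?_)
  · refine integral_congr_ae (ae_of_all _ fun k => ?_)
    simp only [schwartzPhase_apply, smul_eq_mul]
    rw [← mul_assoc, ← Complex.exp_add, mul_comm, real_inner_comm]
    congr 2
    push_cast
    ring
  · rw [← integral_const_mul, ← integral_const_mul]
    refine integral_congr_ae (ae_of_all _ fun w => ?_)
    simp only [schwartzPhase_apply, smul_eq_mul]
    -- Expanding |x - w|² in e^{i|x - w|²/4t}: the two squares give the factors M, and the cross
    -- term is the Fourier character at x/(4πt).
    have e : Complex.exp (-Real.pi ^ 2 * ‖x - w‖ ^ 2 / (Complex.I * (4 * Real.pi ^ 2 * t : ℝ)))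
        = Complex.exp (Complex.I * (((4 * t)⁻¹ * ‖x‖ ^ 2 : ℝ) : ℂ)) *
          (Complex.exp ((-2 * Real.pi * inner ℝ w ((4 * Real.pi * t)⁻¹ • x) : ℝ) * Complex.I) *
          Complex.exp (Complex.I * (((4 * t)⁻¹ * ‖w‖ ^ 2 : ℝ) : ℂ))) := by
      rw [← Complex.exp_add, ← Complex.exp_add]
      congr 1
      have e1 : ((‖x - w‖ : ℂ) ^ 2) = (‖x‖ : ℂ) ^ 2 - 2 * (inner ℝ w x : ℝ) + (‖w‖ : ℂ) ^ 2 := by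
        have := norm_sub_sq_real x w
        rw [real_inner_comm] at this
        exact_mod_cast congrArg (fun r : ℝ => (r : ℂ)) this
      rw [e1, inner_smul_right]
      push_cast
      field_simp
      rw [Complex.I_sq]
      ring
    rw [e]
    ring

end Propagator

/-! ### The factorization of e^{-itH₀} in L₂ and its large-time consequence. -/

section Asymptotics

variable {d : ℕ}

open scoped FourierTransform SchwartzMap

lemma fourierL2_toLp_coeFn (η : 𝓢(RSpace d, ℂ)) :
    fourierL2 d (η.toLp 2) =ᵐ[volume] fun ξ => (((2 * Real.pi) ^ (-(d : ℝ) / 2) : ℝ) : ℂ) *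
      𝓕 η ((2 * Real.pi)⁻¹ • ξ) := by
  have h : Lp.fourierTransformₗᵢ (RSpace d) ℂ (η.toLp 2) = (𝓕 η).toLp 2 :=
    SchwartzMap.toLp_fourier_eq η
  have hpi : 2 * Real.pi ≠ 0 := by positivity
  filter_upwards [fourierL2_coeFn (η.toLp 2),
    (quasiMeasurePreserving_const_smul (inv_ne_zero hpi)).ae_eq_comp
      ((𝓕 η).coeFn_toLp 2 volume)] with ξ h1 h2
  rw [h] at h1
  rw [h1]
  exact congrArg _ h2

lemma fourierPhase_toLp (η : 𝓢(RSpace d, ℂ)) (t : ℝ) :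
    fourierPhase (fun ξ => -t * ‖ξ‖ ^ 2) (η.toLp 2 : L2Space d)
      = (𝓕⁻ (schwartzPhase (-(4 * Real.pi ^ 2 * t)) (𝓕 η))).toLp 2 := by
  refine fourierL2_injective ?_
  rw [fourierL2_fourierPhase]
  refine Lp.ext ?_
  filter_upwards [phaseMul_coeFn (g := fun ξ : RSpace d => -t * ‖ξ‖ ^ 2) (by fun_prop)
    (fourierL2 d (η.toLp 2)), fourierL2_toLp_coeFn η,
    fourierL2_toLp_coeFn (𝓕⁻ (schwartzPhase (-(4 * Real.pi ^ 2 * t)) (𝓕 η)))] with ξ h1 h2 h3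
  rw [h1, h2, h3, FourierTransform.fourier_fourierInv_eq, schwartzPhase_apply, norm_smul,
    Real.norm_of_nonneg (by positivity : (0 : ℝ) ≤ (2 * Real.pi)⁻¹)]
  have e : -t * ‖ξ‖ ^ 2 = -(4 * Real.pi ^ 2 * t) * ((2 * Real.pi)⁻¹ * ‖ξ‖) ^ 2 := by
    have := Real.pi_ne_zero
    field_simp
    ring
  rw [e]
  ring

/-- The formula `e^{-itH₀} = c M D 𝓕 M`. -/
lemma exists_fourierPhase_eq {t : ℝ} (ht : t ≠ 0) : ∃ c : ℂ, ∀ f : L2Space d,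
    fourierPhase (fun ξ => -t * ‖ξ‖ ^ 2) f
      = c • phaseMul (fun x => (4 * t)⁻¹ * ‖x‖ ^ 2)
        (compSMul d (2 * t)⁻¹ (inv_ne_zero (mul_ne_zero two_ne_zero ht))
          (fourierL2 d (phaseMul (fun x => (4 * t)⁻¹ * ‖x‖ ^ 2) f))) := by
  have h2t : (2 * t)⁻¹ ≠ 0 := inv_ne_zero (mul_ne_zero two_ne_zero ht)
  have hc0 : (((2 * Real.pi) ^ (-(d : ℝ) / 2) : ℝ) : ℂ) ≠ 0 := by
    exact_mod_cast (by positivity : (0 : ℝ) < (2 * Real.pi) ^ (-(d : ℝ) / 2)).ne'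
  set κ : ℂ := (Real.pi / (Complex.I * (4 * Real.pi ^ 2 * t : ℝ))) ^ ((d : ℂ) / 2) with hκ
  -- The division removes the factor (2π)^{-d/2} contained in `fourierL2`. The exact value of c
  -- plays no further role.
  set c : ℂ := κ / (((2 * Real.pi) ^ (-(d : ℝ) / 2) : ℝ) : ℂ) with hc
  refine ⟨c, fun f => ?_⟩
  have hdense := SchwartzMap.denseRange_toLpCLM (E := RSpace d) (F := ℂ) (p := 2)
    (μ := volume) ENNReal.ofNat_ne_top
  refine hdense.induction_on (p := fun f => fourierPhase (fun ξ => -t * ‖ξ‖ ^ 2) f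
      = c • phaseMul (fun x => (4 * t)⁻¹ * ‖x‖ ^ 2)
        (compSMul d (2 * t)⁻¹ (inv_ne_zero (mul_ne_zero two_ne_zero ht))
          (fourierL2 d (phaseMul (fun x => (4 * t)⁻¹ * ‖x‖ ^ 2) f)))) f ?_ ?_
  · refine isClosed_eq (ContinuousLinearMap.continuous _) ?_
    exact ((phaseMul _).continuous.comp ((compSMul _ _ _).continuous.comp
      ((fourierL2 d).continuous.comp (phaseMul _).continuous))).const_smul c
  intro η
  rw [SchwartzMap.toLpCLM_apply, fourierPhase_toLp, phaseMul_toLp]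
  refine Lp.ext ?_
  set Mη := schwartzPhase (4 * t)⁻¹ η with hMη
  filter_upwards [(𝓕⁻ (schwartzPhase (-(4 * Real.pi ^ 2 * t)) (𝓕 η))).coeFn_toLp 2 volume,
    Lp.coeFn_smul c (phaseMul (fun x => (4 * t)⁻¹ * ‖x‖ ^ 2)
      (compSMul d (2 * t)⁻¹ h2t (fourierL2 d (Mη.toLp 2)))),
    phaseMul_coeFn (g := fun x : RSpace d => (4 * t)⁻¹ * ‖x‖ ^ 2) (by fun_prop)
      (compSMul d (2 * t)⁻¹ h2t (fourierL2 d (Mη.toLp 2))),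
    compSMul_coeFn h2t (fourierL2 d (Mη.toLp 2)),
    (quasiMeasurePreserving_const_smul h2t).ae_eq_comp (fourierL2_toLp_coeFn Mη)]
    with x h1 h2 h3 h4 h5
  simp only [Function.comp_apply] at h5
  rw [h1, h2, Pi.smul_apply, h3, h4, h5, fourierInv_schwartzPhase_fourier η x ht, smul_smul,
    smul_eq_mul, show (2 * Real.pi)⁻¹ * (2 * t)⁻¹ = (4 * Real.pi * t)⁻¹ by
      rw [← mul_inv]; congr 1; ring]
  rw [← hκ, ← hMη, hc]
  generalize (((2 * Real.pi) ^ (-(d : ℝ) / 2) : ℝ) : ℂ) = z at hc0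
  field_simp

lemma phaseMul_compSMul {ψ : RSpace d → ℝ} (hψ : Measurable ψ) {c : ℝ} (hc : c ≠ 0)
    (v : L2Space d) :
    phaseMul ψ (compSMul d c⁻¹ (inv_ne_zero hc) v)
      = compSMul d c⁻¹ (inv_ne_zero hc) (phaseMul (fun ξ => ψ (c • ξ)) v) := by
  have hψc : Measurable fun ξ : RSpace d => ψ (c • ξ) := hψ.comp (measurable_const_smul c)
  refine Lp.ext ?_
  filter_upwards [phaseMul_coeFn hψ (compSMul d c⁻¹ (inv_ne_zero hc) v),
    compSMul_coeFn (inv_ne_zero hc) v,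
    compSMul_coeFn (inv_ne_zero hc) (phaseMul (fun ξ => ψ (c • ξ)) v),
    (quasiMeasurePreserving_const_smul (inv_ne_zero hc)).ae_eq_comp (phaseMul_coeFn hψc v)]
    with x h1 h2 h3 h4
  simp only [Function.comp_apply] at h4
  rw [h1, h2, h3, h4, smul_smul, mul_inv_cancel₀ hc, one_smul]

/-- `e^{-itH₀} = T 𝓕 e^{i|x|²/4t}`, where the isometry `T` intertwines the multiplications by
functions of `x` and of `2tξ`. -/
lemma exists_factorization_fourierPhase {t : ℝ} (ht : t ≠ 0) : ∃ T : L2Space d →L[ℂ] L2Space d,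
    (∀ v, ‖T v‖ = ‖v‖) ∧
    (∀ f, fourierPhase (fun ξ => -t * ‖ξ‖ ^ 2) f
      = T (fourierL2 d (phaseMul (fun x => (4 * t)⁻¹ * ‖x‖ ^ 2) f))) ∧
    ∀ ψ : RSpace d → ℝ, Measurable ψ → ∀ v,
      phaseMul ψ (T v) = T (phaseMul (fun ξ => ψ ((2 * t) • ξ)) v) := by
  obtain ⟨c, hc⟩ := exists_fourierPhase_eq (d := d) ht
  have h2t : 2 * t ≠ 0 := mul_ne_zero two_ne_zero ht
  have hm : Measurable fun x : RSpace d => (4 * t)⁻¹ * ‖x‖ ^ 2 := by fun_prop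
  set T : L2Space d →L[ℂ] L2Space d := c • (phaseMul fun x => (4 * t)⁻¹ * ‖x‖ ^ 2).comp
    (compSMul d (2 * t)⁻¹ (inv_ne_zero h2t)) with hT
  have hE : ∀ f, fourierPhase (fun ξ => -t * ‖ξ‖ ^ 2) f
      = T (fourierL2 d (phaseMul (fun x => (4 * t)⁻¹ * ‖x‖ ^ 2) f)) := hc
  refine ⟨T, fun v => ?_, hE, fun ψ hψ v => ?_⟩
  -- Every v has the form 𝓕 M w', and T 𝓕 M is the unitary free evolution; thus T is isometric
  -- without computing |c|.
  · obtain ⟨w, rfl⟩ := fourierL2_surjective v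
    have h1 := hE (phaseMul (fun x => -((4 * t)⁻¹ * ‖x‖ ^ 2)) w)
    rw [phaseMul_phaseMul_neg hm] at h1
    rw [← h1, norm_fourierPhase (by fun_prop), norm_phaseMul hm.fun_neg, norm_fourierL2]
  · simp only [hT, smul_apply, ContinuousLinearMap.comp_apply, map_smul]
    rw [← phaseMul_compSMul hψ h2t, phaseMul_phaseMul hψ hm, phaseMul_phaseMul hm hψ]
    simp only [add_comm]

lemma tendsto_phaseMul_of_tendsto {α ι : Type*} [MeasurableSpace α] {μ : Measure α}
    {l : Filter ι} [l.IsCountablyGenerated] {g : ι → α → ℝ} {h : α → ℝ}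
    (hg : ∀ i, Measurable (g i)) (hh : Measurable h)
    (hlim : ∀ᵐ x ∂μ, Tendsto (fun i => g i x) l (𝓝 (h x))) (f : Lp ℂ 2 μ) :
    Tendsto (fun i => phaseMul (g i) f) l (𝓝 (phaseMul h f)) := by
  refine tendsto_L2_of_dominated (fun i x => Complex.exp (Complex.I * (g i x : ℂ)) * f x)
    (fun x => ‖f x‖) (Lp.memLp f).norm (fun i => phaseMul_coeFn (hg i) f)
    (Eventually.of_forall fun i => ae_of_all _ fun x => ?_) ?_
  · rw [norm_mul, norm_cexp_I_mul_ofReal, one_mul]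
  · filter_upwards [hlim, phaseMul_coeFn hh f] with x h1 h2
    rw [h2]
    have : Continuous fun r : ℝ => Complex.exp (Complex.I * (r : ℂ)) * f x := by fun_prop
    exact (this.tendsto _).comp h1

/-- As `t → ±∞`, the operator of multiplication by a function of `x` acts on `e^{-itH₀} f` as the
Fourier multiplier by the limit of its values at `2tξ`. -/
lemma tendsto_phaseMul_free_sub {l : Filter ℝ} [l.IsCountablyGenerated]
    (hne : ∀ᶠ t in l, t ≠ 0) (hinv : Tendsto (fun t : ℝ => t⁻¹) l (𝓝 0))
    {ψ χ : RSpace d → ℝ} (hψ : Measurable ψ) (hχ : Measurable χ)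
    (hlim : ∀ᵐ ξ ∂(volume : Measure (RSpace d)),
      Tendsto (fun t : ℝ => ψ ((2 * t) • ξ)) l (𝓝 (χ ξ))) (f : L2Space d) :
    Tendsto (fun t => phaseMul ψ (unitaryGroup (freeHamiltonian d) t f)
      - unitaryGroup (freeHamiltonian d) t (fourierPhase χ f)) l (𝓝 0) := by
  have hM : ∀ g : L2Space d,
      Tendsto (fun t : ℝ => ‖phaseMul (fun x => (4 * t)⁻¹ * ‖x‖ ^ 2) g - g‖) l (𝓝 0) := by
    intro g
    rw [← tendsto_iff_norm_sub_tendsto_zero]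
    have h1 := tendsto_phaseMul_of_tendsto (l := l)
      (g := fun (t : ℝ) (x : RSpace d) => (4 * t)⁻¹ * ‖x‖ ^ 2) (h := fun _ => 0)
      (fun t => by fun_prop) measurable_const (ae_of_all _ fun x => by
        have := (hinv.const_mul (4⁻¹ : ℝ)).mul_const (‖x‖ ^ 2)
        simpa [mul_inv, mul_comm] using this) g
    rwa [phaseMul_zero] at h1
  have hψt : ∀ t : ℝ, Measurable fun ξ : RSpace d => ψ ((2 * t) • ξ) := fun t =>
    hψ.comp (measurable_const_smul _)
  have hP := tendsto_phaseMul_of_tendsto hψt hχ hlim (fourierL2 d f)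
  rw [tendsto_iff_norm_sub_tendsto_zero] at hP
  rw [tendsto_zero_iff_norm_tendsto_zero]
  have hsum := ((hM f).add hP).add (hM (fourierPhase χ f))
  simp only [add_zero] at hsum
  refine squeeze_zero' (Eventually.of_forall fun t => norm_nonneg _) ?_ hsum
  filter_upwards [hne] with t ht
  obtain ⟨T, hTn, hTE, hTψ⟩ := exists_factorization_fourierPhase (d := d) ht
  rw [unitaryGroup_freeHamiltonian, unitaryGroup_freeHamiltonian, hTE, hTE]
  set M : L2Space d →L[ℂ] L2Space d := phaseMul fun x => (4 * t)⁻¹ * ‖x‖ ^ 2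
  -- Three errors: replacing M by 1 on f, replacing ψ(2tξ) by its limit χ, and restoring M on the
  -- multiplied vector. Each tends to zero because T, 𝓕 and the phases are isometric.
  have e : phaseMul ψ (T (fourierL2 d (M f))) - T (fourierL2 d (M (fourierPhase χ f)))
      = phaseMul ψ (T (fourierL2 d (M f - f)))
        + T (phaseMul (fun ξ => ψ ((2 * t) • ξ)) (fourierL2 d f) - phaseMul χ (fourierL2 d f))
        - T (fourierL2 d (M (fourierPhase χ f) - fourierPhase χ f)) := by
    rw [map_sub (fourierL2 d), map_sub (fourierL2 d), map_sub T, map_sub T, map_sub T,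
      map_sub (phaseMul ψ), hTψ ψ hψ (fourierL2 d f), fourierL2_fourierPhase]
    abel
  rw [e]
  refine (norm_sub_le _ _).trans (add_le_add ((norm_add_le _ _).trans (add_le_add ?_ ?_)) ?_)
  · rw [norm_phaseMul hψ, hTn, norm_fourierL2]
  · rw [hTn]
  · rw [hTn, norm_fourierL2]

end Asymptotics

/-! ### Limits of φ along rays. -/

section RadialLimit

variable {d : ℕ} {φ φ₀ : RSpace d → ℝ}

lemma homogeneous_smul (hφ₀ : ∀ x, x ≠ 0 → φ₀ x = φ₀ (‖x‖⁻¹ • x)) {c : ℝ} (hc : 0 < c)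
    (x : RSpace d) : φ₀ (c • x) = φ₀ x := by
  rcases eq_or_ne x 0 with rfl | hx
  · rw [smul_zero]
  rw [hφ₀ _ (smul_ne_zero hc.ne' hx), hφ₀ x hx, norm_smul, Real.norm_of_nonneg hc.le, smul_smul,
    mul_inv, mul_right_comm, inv_mul_cancel₀ hc.ne', one_mul]

lemma tendsto_smul_cobounded {ι : Type*} {l : Filter ι} {r : ι → ℝ}
    (hr : Tendsto (fun i => |r i|) l atTop) {x : RSpace d} (hx : x ≠ 0) :
    Tendsto (fun i => r i • x) l (Bornology.cobounded (RSpace d)) := by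
  rw [← tendsto_norm_atTop_iff_cobounded]
  simp only [norm_smul, Real.norm_eq_abs]
  exact hr.atTop_mul_const (norm_pos_iff.2 hx)

lemma tendsto_of_eventually_eq {ι : Type*} {l : Filter ι} {y : ι → RSpace d} {c : ℝ}
    (hlim : Tendsto (fun x => φ x - φ₀ x) (Bornology.cobounded (RSpace d)) (𝓝 0))
    (hy : Tendsto y l (Bornology.cobounded (RSpace d))) (hc : ∀ᶠ i in l, φ₀ (y i) = c) :
    Tendsto (fun i => φ (y i)) l (𝓝 c) := by
  have h1 := (hlim.comp hy).add_const c
  rw [zero_add] at h1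
  refine h1.congr' ?_
  filter_upwards [hc] with i hi
  simp [hi]

lemma tendsto_atTop_radial (hφ₀ : ∀ x, x ≠ 0 → φ₀ x = φ₀ (‖x‖⁻¹ • x))
    (hlim : Tendsto (fun x => φ x - φ₀ x) (Bornology.cobounded (RSpace d)) (𝓝 0))
    {x : RSpace d} (hx : x ≠ 0) : Tendsto (fun t : ℝ => φ ((2 * t) • x)) atTop (𝓝 (φ₀ x)) := by
  have h2 : Tendsto (fun t : ℝ => 2 * t) atTop atTop := tendsto_id.const_mul_atTop two_pos
  refine tendsto_of_eventually_eq hlim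
    (tendsto_smul_cobounded (tendsto_abs_atTop_atTop.comp h2) hx) ?_
  filter_upwards [eventually_gt_atTop 0] with t ht
  exact homogeneous_smul hφ₀ (by positivity) x

lemma tendsto_atBot_radial (hφ₀ : ∀ x, x ≠ 0 → φ₀ x = φ₀ (‖x‖⁻¹ • x))
    (hlim : Tendsto (fun x => φ x - φ₀ x) (Bornology.cobounded (RSpace d)) (𝓝 0))
    {x : RSpace d} (hx : x ≠ 0) :
    Tendsto (fun t : ℝ => φ ((2 * t) • x)) atBot (𝓝 (φ₀ (-x))) := by
  have h2 : Tendsto (fun t : ℝ => 2 * t) atBot atBot := tendsto_id.const_mul_atBot two_pos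
  refine tendsto_of_eventually_eq hlim
    (tendsto_smul_cobounded (tendsto_abs_atBot_atTop.comp h2) hx) ?_
  filter_upwards [eventually_lt_atBot 0] with t ht
  -- For t < 0 the point 2tx is a positive multiple of -x; this is the source of φ₀(-ξ) in W₋.
  rw [← homogeneous_smul hφ₀ (c := -(2 * t)) (by linarith) (-x)]
  simp

/-- Off the origin φ₀ is the pointwise limit of the continuous functions φ(2nx); the value at the
origin is unrelated and is adjusted separately. -/
lemma measurable_radialLimit (hφ : Continuous φ) (hφ₀ : ∀ x, x ≠ 0 → φ₀ x = φ₀ (‖x‖⁻¹ • x))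
    (hlim : Tendsto (fun x => φ x - φ₀ x) (Bornology.cobounded (RSpace d)) (𝓝 0)) :
    Measurable φ₀ := by
  classical
  have h1 : Measurable fun x => if x = 0 then φ 0 else φ₀ x := by
    refine measurable_of_tendsto_metrizable (f := fun (n : ℕ) x => φ ((2 * (n : ℝ)) • x))
      (fun n => (hφ.comp (continuous_const_smul _)).measurable) ?_
    rw [tendsto_pi_nhds]
    intro x
    by_cases hx : x = 0
    · simp [hx]
    · rw [if_neg hx]
      exact (tendsto_atTop_radial hφ₀ hlim hx).comp tendsto_natCast_atTop_atTop
  have h2 : φ₀ = fun x => if x = 0 then φ₀ 0 else if x = 0 then φ 0 else φ₀ x := by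
    ext x
    by_cases hx : x = 0 <;> simp [hx]
  rw [h2]
  exact Measurable.ite (measurableSet_singleton 0) measurable_const h1

end RadialLimit

/-! ### Wave operators and scattering operators. -/

section WaveOperators

variable {d : ℕ} {φ χ : RSpace d → ℝ} {H H₀ : L2Space d →ₗ.[ℂ] L2Space d} {l : Filter ℝ}

lemma IsWaveOperator.waveOperator_eq [l.NeBot] {W : L2Space d →L[ℂ] L2Space d}
    (hW : IsWaveOperator H H₀ l W) : waveOperator H H₀ l = W := by
  have h : WaveOperatorExists H H₀ l := ⟨W, hW⟩
  rw [waveOperator, dif_pos h]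
  ext1 f
  exact tendsto_nhds_unique (h.choose_spec f) (hW f)

lemma WaveOperatorExists.isWaveOperator (h : WaveOperatorExists H H₀ l) :
    IsWaveOperator H H₀ l (waveOperator H H₀ l) := by
  rw [waveOperator, dif_pos h]
  exact h.choose_spec

/-- In e^{iφ} e^{iHt} e^{-iφ} e^{-iH₀t} f the inner phase is replaced by a Fourier multiplier placed
before e^{-iH₀t}. The error tends to zero and e^{iHt} does not enlarge it; what is left converges by
the existence of the original wave operator. -/
lemma waveOperatorExists_gaugeConj [l.IsCountablyGenerated] [l.NeBot]
    (hne : ∀ᶠ t in l, t ≠ 0) (hinv : Tendsto (fun t : ℝ => t⁻¹) l (𝓝 0))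
    (hφ : Measurable φ) (hχ : Measurable χ)
    (hlim : ∀ᵐ ξ ∂(volume : Measure (RSpace d)),
      Tendsto (fun t : ℝ => φ ((2 * t) • ξ)) l (𝓝 (χ ξ)))
    (h : WaveOperatorExists H (freeHamiltonian d) l) :
    WaveOperatorExists (gaugeConj φ H) (freeHamiltonian d) l ∧
      waveOperator (gaugeConj φ H) (freeHamiltonian d) l
        = (phaseMul φ).comp ((waveOperator H (freeHamiltonian d) l).comp
          (fourierPhase fun ξ => -χ ξ)) := by
  have key : IsWaveOperator (gaugeConj φ H) (freeHamiltonian d) l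
      ((phaseMul φ).comp ((waveOperator H (freeHamiltonian d) l).comp
        (fourierPhase fun ξ => -χ ξ))) := by
    intro f
    have h1 := h.isWaveOperator (fourierPhase (fun ξ => -χ ξ) f)
    have h2 := tendsto_phaseMul_free_sub hne hinv hφ.fun_neg hχ.fun_neg
      (hlim.mono fun ξ hξ => hξ.neg) f
    have h3 : Tendsto (fun t => unitaryGroup H (-t)
        (phaseMul (fun x => -φ x) (unitaryGroup (freeHamiltonian d) t f)
          - unitaryGroup (freeHamiltonian d) t (fourierPhase (fun ξ => -χ ξ) f))) l (𝓝 0) :=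
      squeeze_zero_norm (fun t => norm_unitaryGroup_le H (-t) _)
        (tendsto_zero_iff_norm_tendsto_zero.1 h2)
    have h4 := ((phaseMul φ).continuous.tendsto _).comp (h3.add h1)
    rw [zero_add] at h4
    refine h4.congr fun t => ?_
    rw [Function.comp_apply, unitaryGroup_gaugeConj hφ, map_sub, sub_add_cancel]
  exact ⟨⟨_, key⟩, key.waveOperator_eq⟩

lemma adjoint_fourierPhase {g : RSpace d → ℝ} (hg : Measurable g) :
    ContinuousLinearMap.adjoint (fourierPhase g) = fourierPhase fun ξ => -g ξ := by
  simp only [fourierPhase, ContinuousLinearMap.adjoint_comp, adjoint_phaseMul hg,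
    ContinuousLinearMap.adjoint_adjoint]
  rfl

/-- The phases e^{iφ} meet in the middle of W₊* W₋ and cancel; taking the adjoint flips the sign of
the multiplier of W₊. -/
lemma scatteringOperator_eq_of_waveOperator_eq {Ht : L2Space d →ₗ.[ℂ] L2Space d}
    {g k : RSpace d → ℝ} (hφ : Measurable φ) (hg : Measurable g)
    (hp : waveOperator Ht H₀ atTop = (phaseMul φ).comp ((waveOperator H H₀ atTop).comp
      (fourierPhase fun ξ => -g ξ)))
    (hm : waveOperator Ht H₀ atBot = (phaseMul φ).comp ((waveOperator H H₀ atBot).comp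
      (fourierPhase k))) :
    scatteringOperator Ht H₀
      = (fourierPhase g).comp ((scatteringOperator H H₀).comp (fourierPhase k)) := by
  rw [scatteringOperator, hp, hm, scatteringOperator]
  simp only [ContinuousLinearMap.adjoint_comp, adjoint_phaseMul hφ,
    adjoint_fourierPhase hg.fun_neg, neg_neg]
  ext1 f
  simp only [ContinuousLinearMap.comp_apply, phaseMul_neg_phaseMul hφ]

lemma fourierL2_conj_fourierPhase {S St : L2Space d →L[ℂ] L2Space d} {g k : RSpace d → ℝ}
    (h : St = (fourierPhase g).comp (S.comp (fourierPhase k))) :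
    (fourierL2 d).comp (St.comp (ContinuousLinearMap.adjoint (fourierL2 d)))
      = (phaseMul g).comp (((fourierL2 d).comp (S.comp
        (ContinuousLinearMap.adjoint (fourierL2 d)))).comp (phaseMul k)) := by
  ext1 f
  simp only [h, fourierPhase, ContinuousLinearMap.comp_apply, fourierL2_adjoint_fourierL2]

end WaveOperators

/-! ### Null sets in polar coordinates. -/

section Polar

variable {d : ℕ}

/-- In polar coordinates Lebesgue measure is a product measure whose radial density r^{d-1} is
positive, so Fubini applies and the density does not affect null sets. -/
lemma ae_sphere_radius_of_ae {p : RSpace d → Prop} (hp : ∀ᵐ x, p x) :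
    ∀ᵐ r ∂(volume.restrict (Ioi (0 : ℝ))), ∀ᵐ ω : USphere d ∂(surfaceMeasure d),
      p (r • (ω : RSpace d)) := by
  have h1 : ∀ᵐ x : ({0}ᶜ : Set (RSpace d)) ∂(Measure.comap Subtype.val volume), p x.1 :=
    (ae_restrict_iff_subtype (measurableSet_singleton _).compl).1 (ae_restrict_of_ae hp)
  have h2 := ((volume : Measure (RSpace d)).measurePreserving_homeomorphUnitSphereProd.symm
    (homeomorphUnitSphereProd (RSpace d)).toMeasurableEquiv).quasiMeasurePreserving.ae h1
  have h3 := Measure.ae_ae_of_ae_prod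
    (Measure.measurePreserving_swap.quasiMeasurePreserving.ae h2)
  rw [Measure.volumeIoiPow, ae_withDensity_iff (by fun_prop)] at h3
  refine (ae_restrict_iff_subtype measurableSet_Ioi).2 ?_
  filter_upwards [h3] with r hr
  have hr0 : (0 : ℝ) < r := r.2
  exact hr (by simpa using pow_pos hr0 _)

/-- The exceptional energies are contained in the image of a null set under the differentiable map r
↦ r². -/
lemma ae_sqrt_of_ae {q : ℝ → Prop} (hq : ∀ᵐ r ∂(volume.restrict (Ioi (0 : ℝ))), q r) :
    ∀ᵐ lam ∂(volume.restrict (Ioi (0 : ℝ))), q (Real.sqrt lam) := by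
  rw [ae_restrict_iff' measurableSet_Ioi, ae_iff] at hq ⊢
  refine measure_mono_null (t := (fun r : ℝ => r ^ 2) '' {r | ¬(r ∈ Ioi (0 : ℝ) → q r)}) ?_
    (addHaar_image_eq_zero_of_differentiableOn_of_addHaar_eq_zero volume
      (differentiable_pow 2).differentiableOn hq)
  intro lam hlam
  simp only [mem_ofPred_eq, Classical.not_imp, mem_Ioi] at hlam
  refine ⟨Real.sqrt lam, ?_, Real.sq_sqrt hlam.1.le⟩
  simp only [mem_ofPred_eq, Classical.not_imp, mem_Ioi]
  exact ⟨Real.sqrt_pos.2 hlam.1, hlam.2⟩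

lemma ae_sphere_sqrt_of_ae {p : RSpace d → Prop} (hp : ∀ᵐ x, p x) :
    ∀ᵐ lam ∂(volume.restrict (Ioi (0 : ℝ))), ∀ᵐ ω : USphere d ∂(surfaceMeasure d),
      p (Real.sqrt lam • (ω : RSpace d)) :=
  ae_sqrt_of_ae (q := fun r => ∀ᵐ ω : USphere d ∂(surfaceMeasure d), p (r • (ω : RSpace d)))
    (ae_sphere_radius_of_ae hp)

end Polar

/-! ### Energy slices under degree-zero multipliers. -/

section Slices

lemma memLp_of_ae_eq_phase_mul {α : Type*} [MeasurableSpace α] {μ : Measure α} {g : α → ℝ}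
    (hg : Measurable g) {u v : α → ℂ} (hv : MemLp v 2 μ)
    (h : u =ᵐ[μ] fun x => Complex.exp (Complex.I * (g x : ℂ)) * v x) :
    ∃ hu : MemLp u 2 μ, hu.toLp u = phaseMul g (hv.toLp v) := by
  have e : u =ᵐ[μ] phaseMul g (hv.toLp v) := by
    filter_upwards [h, phaseMul_coeFn hg (hv.toLp v), hv.coeFn_toLp] with x h1 h2 h3
    rw [h1, h2, h3]
  have hu : MemLp u 2 μ := (memLp_congr_ae e).2 (Lp.memLp _)
  exact ⟨hu, Lp.ext (hu.coeFn_toLp.trans e)⟩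

variable {d : ℕ}

/-- Homogeneity of degree 0 makes g(√λ ω) = g(ω), so one phase on the unit sphere serves every
energy. -/
lemma energySlice_eq_phaseMul {g : RSpace d → ℝ} (hg : Measurable g)
    (hom : ∀ c : ℝ, 0 < c → ∀ x, g (c • x) = g x) {u v : L2Space d}
    (h : fourierL2 d u = phaseMul g (fourierL2 d v)) :
    ∀ᵐ lam ∂(volume.restrict (Ioi (0 : ℝ))),
      energySlice lam u = phaseMul (fun ω : USphere d => g ω) (energySlice lam v) := by
  have hgs : Measurable fun ω : USphere d => g ω := hg.comp measurable_subtype_coe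
  filter_upwards [ae_sphere_sqrt_of_ae (phaseMul_coeFn hg (fourierL2 d v)),
    ae_restrict_mem measurableSet_Ioi] with lam hlam hpos
  rw [← h] at hlam
  have e : (fun ω : USphere d => (((2 : ℝ) ^ (-(1 / 2) : ℝ) * lam ^ (((d : ℝ) - 2) / 4) : ℝ) : ℂ)
      * fourierL2 d u (Real.sqrt lam • (ω : RSpace d))) =ᵐ[surfaceMeasure d] fun ω =>
      Complex.exp (Complex.I * (g ω : ℂ)) *
        ((((2 : ℝ) ^ (-(1 / 2) : ℝ) * lam ^ (((d : ℝ) - 2) / 4) : ℝ) : ℂ)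
          * fourierL2 d v (Real.sqrt lam • (ω : RSpace d))) := by
    filter_upwards [hlam] with ω hω
    rw [hω, hom _ (Real.sqrt_pos.2 hpos)]
    ring
  unfold energySlice
  by_cases hv : MemLp (fun ω : USphere d =>
      (((2 : ℝ) ^ (-(1 / 2) : ℝ) * lam ^ (((d : ℝ) - 2) / 4) : ℝ) : ℂ)
        * fourierL2 d v (Real.sqrt lam • (ω : RSpace d))) 2 (surfaceMeasure d)
  · obtain ⟨hu, h'⟩ := memLp_of_ae_eq_phase_mul hgs hv e
    rw [dif_pos hu, dif_pos hv, h']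
  -- The slices of u and v leave L₂ at the same energies, so their default values 0 agree.
  · rw [dif_neg hv, dif_neg, map_zero]
    intro hu
    refine hv (memLp_of_ae_eq_phase_mul hgs.fun_neg hu ?_).1
    filter_upwards [e] with ω hω
    rw [hω, ← mul_assoc, ← Complex.exp_add]
    simp

lemma IsScatteringMatrix.sphereGauge {T T' : L2Space d →L[ℂ] L2Space d} {φ₀ : RSpace d → ℝ}
    (hφ₀ : Measurable φ₀) (hom : ∀ c : ℝ, 0 < c → ∀ x, φ₀ (c • x) = φ₀ x)
    {S : ℝ → L2Sphere d →L[ℂ] L2Sphere d} (hS : IsScatteringMatrix T S)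
    (hT : T' = (fourierPhase φ₀).comp (T.comp (fourierPhase fun ξ => -φ₀ (-ξ)))) :
    IsScatteringMatrix T' fun lam => sphereGauge φ₀ (S lam) := by
  intro f
  have hneg : Measurable fun ξ => -φ₀ (-ξ) := (hφ₀.comp measurable_neg).fun_neg
  have h1 := energySlice_eq_phaseMul (u := T' f) (v := T (fourierPhase (fun ξ => -φ₀ (-ξ)) f))
    hφ₀ hom (by rw [hT, ContinuousLinearMap.comp_apply, fourierL2_fourierPhase,
      ContinuousLinearMap.comp_apply])
  have h2 := energySlice_eq_phaseMul (u := fourierPhase (fun ξ => -φ₀ (-ξ)) f) (v := f)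
    hneg (fun c hc x => by rw [← smul_neg, hom c hc]) (fourierL2_fourierPhase _ _)
  filter_upwards [h1, h2, hS (fourierPhase (fun ξ => -φ₀ (-ξ)) f)] with lam e1 e2 e3
  rw [e1, e3, e2]
  rfl

end Slices

/-! ### Uniqueness of the scattering matrix. -/

section Uniqueness

variable {d : ℕ}

lemma memLp_annulus_radial (b : C(RSpace d, ℂ)) (n : ℕ) :
    MemLp (indicator {x : RSpace d | ((n : ℝ) + 1)⁻¹ < ‖x‖ ∧ ‖x‖ < n + 1}
      fun x => b (‖x‖⁻¹ • x)) 2 volume := by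
  have hs : MeasurableSet {x : RSpace d | ((n : ℝ) + 1)⁻¹ < ‖x‖ ∧ ‖x‖ < n + 1} :=
    (measurableSet_lt measurable_const measurable_norm).inter
      (measurableSet_lt measurable_norm measurable_const)
  have hfin : volume {x : RSpace d | ((n : ℝ) + 1)⁻¹ < ‖x‖ ∧ ‖x‖ < n + 1} ≠ ∞ :=
    (lt_of_le_of_lt (measure_mono fun x hx => by simpa using hx.2)
      (measure_ball_lt_top (x := (0 : RSpace d)) (r := (n : ℝ) + 1))).ne
  obtain ⟨C, hC⟩ := (isCompact_sphere (0 : RSpace d) 1).exists_bound_of_continuousOn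
    b.continuous.continuousOn
  rw [memLp_indicator_iff_restrict hs]
  have : IsFiniteMeasure (volume.restrict {x : RSpace d | ((n : ℝ) + 1)⁻¹ < ‖x‖ ∧ ‖x‖ < n + 1}) :=
    isFiniteMeasure_restrict.2 hfin
  refine MemLp.of_bound (b.continuous.measurable.comp
    (measurable_norm.inv.smul measurable_id)).aestronglyMeasurable C ?_
  filter_upwards [ae_restrict_mem hs] with x hx
  refine hC _ ?_
  have : 0 < ‖x‖ := lt_trans (by positivity) hx.1
  simp [norm_smul, this.ne']

/-- Choose f̂(ξ) = b(ξ/|ξ|) on an annulus and 0 elsewhere: a single f then produces the prescribed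
slice, up to a nonzero factor, at almost all energies in a window. The windows exhaust (0, ∞) as n
grows. -/
lemma exists_energySlice_eq_toLp (b : C(RSpace d, ℂ)) (n : ℕ) :
    ∃ f : L2Space d, ∀ᵐ lam ∂(volume.restrict (Ioi (0 : ℝ))),
      ((n : ℝ) + 1)⁻¹ < Real.sqrt lam → Real.sqrt lam < n + 1 →
        ∃ c : ℂ, c ≠ 0 ∧ energySlice lam f =
          c • ContinuousMap.toLp 2 (surfaceMeasure d) ℂ (b.restrict (Metric.sphere 0 1)) := by
  obtain ⟨f, hf⟩ := fourierL2_surjective (d := d) ((memLp_annulus_radial b n).toLp _)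
  refine ⟨f, ?_⟩
  have hae := (memLp_annulus_radial b n).coeFn_toLp
  rw [← hf] at hae
  filter_upwards [ae_sphere_sqrt_of_ae hae, ae_restrict_mem measurableSet_Ioi] with lam hlam hpos
    h1 h2
  have hc : (((2 : ℝ) ^ (-(1 / 2) : ℝ) * lam ^ (((d : ℝ) - 2) / 4) : ℝ) : ℂ) ≠ 0 := by
    have : (0 : ℝ) < lam := hpos
    exact_mod_cast (by positivity : (0 : ℝ) < (2 : ℝ) ^ (-(1 / 2) : ℝ)
      * lam ^ (((d : ℝ) - 2) / 4)).ne'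
  refine ⟨_, hc, ?_⟩
  have e : (fun ω : USphere d => (((2 : ℝ) ^ (-(1 / 2) : ℝ) * lam ^ (((d : ℝ) - 2) / 4) : ℝ) : ℂ)
      * fourierL2 d f (Real.sqrt lam • (ω : RSpace d))) =ᵐ[surfaceMeasure d]
      ((((2 : ℝ) ^ (-(1 / 2) : ℝ) * lam ^ (((d : ℝ) - 2) / 4) : ℝ) : ℂ) •
        ContinuousMap.toLp 2 (surfaceMeasure d) ℂ (b.restrict (Metric.sphere 0 1)) :
          L2Sphere d) := by
    filter_upwards [hlam, Lp.coeFn_smul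
      (((2 : ℝ) ^ (-(1 / 2) : ℝ) * lam ^ (((d : ℝ) - 2) / 4) : ℝ) : ℂ)
      (ContinuousMap.toLp 2 (surfaceMeasure d) ℂ (b.restrict (Metric.sphere 0 1))),
      ContinuousMap.coeFn_toLp (p := 2) (𝕜 := ℂ) (surfaceMeasure d)
        (b.restrict (Metric.sphere 0 1))]
      with ω hω h3 h4
    have hs : 0 < Real.sqrt lam := Real.sqrt_pos.2 hpos
    have hn : ‖Real.sqrt lam • (ω : RSpace d)‖ = Real.sqrt lam := by
      rw [norm_smul, Real.norm_of_nonneg hs.le, norm_eq_of_mem_sphere, mul_one]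
    rw [hω, h3, Pi.smul_apply, h4, indicator_of_mem (by
      rw [mem_ofPred_eq, hn]; exact ⟨h1, h2⟩), hn, smul_smul, inv_mul_cancel₀ hs.ne', one_smul]
    rfl
  have hm := (memLp_congr_ae e).2 (Lp.memLp _)
  unfold energySlice
  rw [dif_pos hm]
  exact Lp.ext (hm.coeFn_toLp.trans e)

lemma denseRange_toLp_restrict_sphere :
    DenseRange fun b : C(RSpace d, ℂ) =>
      ContinuousMap.toLp 2 (surfaceMeasure d) ℂ (b.restrict (Metric.sphere 0 1)) := by
  have h1 : DenseRange (ContinuousMap.toLp 2 (surfaceMeasure d) ℂ : C(USphere d, ℂ) → _) :=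
    ContinuousMap.toLp_denseRange ℂ (surfaceMeasure d) ℂ (by norm_num)
  refine h1.comp (f := fun b : C(RSpace d, ℂ) => b.restrict (Metric.sphere (0 : RSpace d) 1))
    (Function.Surjective.denseRange fun b => ?_) (ContinuousMap.toLp 2 (surfaceMeasure d) ℂ).continuous
  exact ContinuousMap.exists_restrict_eq Metric.isClosed_sphere b

/-- A countable dense family b_k of continuous functions and countably many windows require only
countably many f, hence one exceptional null set. Off it the two bounded operators agree on a dense
subset of L₂ of the sphere. -/
lemma IsScatteringMatrix.ae_eq {T : L2Space d →L[ℂ] L2Space d}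
    {S S' : ℝ → L2Sphere d →L[ℂ] L2Sphere d} (hS : IsScatteringMatrix T S)
    (hS' : IsScatteringMatrix T S') :
    ∀ᵐ lam ∂(volume.restrict (Ioi (0 : ℝ))), S lam = S' lam := by
  have hdense : DenseRange fun k : ℕ => ContinuousMap.toLp 2 (surfaceMeasure d) ℂ
      ((TopologicalSpace.denseSeq C(RSpace d, ℂ) k).restrict (Metric.sphere 0 1)) :=
    denseRange_toLp_restrict_sphere.comp (TopologicalSpace.denseRange_denseSeq _)
      ((ContinuousMap.toLp 2 (surfaceMeasure d) ℂ).continuous.comp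
        (ContinuousMap.continuous_restrict _))
  choose f hf using fun (k n : ℕ) =>
    exists_energySlice_eq_toLp (TopologicalSpace.denseSeq C(RSpace d, ℂ) k) n
  filter_upwards [ae_all_iff.2 fun k => ae_all_iff.2 fun n => hf k n,
    ae_all_iff.2 fun k => ae_all_iff.2 fun n => hS (f k n),
    ae_all_iff.2 fun k => ae_all_iff.2 fun n => hS' (f k n),
    ae_restrict_mem measurableSet_Ioi] with lam h1 h2 h3 hpos
  have hs : 0 < Real.sqrt lam := Real.sqrt_pos.2 hpos
  obtain ⟨n, hn⟩ := exists_nat_gt (max (Real.sqrt lam) (Real.sqrt lam)⁻¹)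
  have hn1 : Real.sqrt lam < n + 1 := lt_trans (lt_of_le_of_lt (le_max_left _ _) hn) (by simp)
  have hn2 : ((n : ℝ) + 1)⁻¹ < Real.sqrt lam := by
    rw [inv_lt_comm₀ (by positivity) hs]
    exact lt_trans (lt_of_le_of_lt (le_max_right _ _) hn) (by simp)
  refine ContinuousLinearMap.ext fun v => congrFun (hdense.equalizer (S lam).continuous
    (S' lam).continuous (funext fun k => ?_)) v
  obtain ⟨c, hc, he⟩ := h1 k n hn2 hn1
  have h := (h2 k n).symm.trans (h3 k n)
  rw [he, map_smul, map_smul] at h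
  exact smul_right_injective _ hc h

/-- The phases do not depend on λ and can be moved onto the vectors of a matrix element, so the
gauged family is again weakly continuous. Continuous functions equal a.e. on an open set coincide
there. -/
lemma eq_sphereGauge_of_weaklyContinuous {φ₀ : RSpace d → ℝ} (hφ₀ : Measurable φ₀)
    {S S' : ℝ → L2Sphere d →L[ℂ] L2Sphere d} (hS : WeaklyContinuousOnPos S)
    (hS' : WeaklyContinuousOnPos S')
    (h : ∀ᵐ lam ∂(volume.restrict (Ioi (0 : ℝ))), S' lam = sphereGauge φ₀ (S lam)) {lam : ℝ}
    (hlam : 0 < lam) : S' lam = sphereGauge φ₀ (S lam) := by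
  have hg : Measurable fun ω : USphere d => φ₀ ω := hφ₀.comp measurable_subtype_coe
  refine ContinuousLinearMap.ext fun v => ext_inner_left ℂ fun u => ?_
  have key : ∀ lam, inner ℂ u (sphereGauge φ₀ (S lam) v)
      = inner ℂ (phaseMul (fun ω : USphere d => -φ₀ ω) u)
        (S lam (phaseMul (fun ω : USphere d => -φ₀ (-(ω : RSpace d))) v)) := by
    intro lam
    rw [← adjoint_phaseMul hg, ContinuousLinearMap.adjoint_inner_left]
    rfl
  refine Measure.eqOn_open_of_ae_eq (μ := volume) (f := fun lam => inner ℂ u (S' lam v))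
    (g := fun lam => inner ℂ u (sphereGauge φ₀ (S lam) v)) ?_ isOpen_Ioi (hS' u v) ?_ hlam
  · filter_upwards [h] with lam hl
    rw [hl]
  · simp only [key]
    exact hS _ _

end Uniqueness

/-! ### Kernels and their uniqueness off the diagonal. -/

section Kernels

variable {d : ℕ}

/-- The cone over a point lies in a line, which is a proper subspace when d ≥ 2 and therefore null.
-/
lemma surfaceMeasure_singleton (hd : 2 ≤ d) (ω : USphere d) : surfaceMeasure d {ω} = 0 := by
  rw [Measure.toSphere_apply' _ (measurableSet_singleton ω), mul_eq_zero]
  right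
  refine measure_mono_null (t := (Submodule.span ℝ {(ω : RSpace d)} : Set (RSpace d))) ?_
    (Measure.addHaar_submodule volume _ ?_)
  · rintro x ⟨r, -, y, ⟨z, rfl, rfl⟩, rfl⟩
    exact Submodule.smul_mem _ r (Submodule.mem_span_singleton_self _)
  · intro h
    have h1 := finrank_span_singleton (K := ℝ) (v := (ω : RSpace d)) (ne_zero_of_mem_unit_sphere ω)
    rw [h, finrank_top, finrank_euclideanSpace_fin] at h1
    omega

lemma ae_prod_fst_ne_snd (hd : 2 ≤ d) :
    ∀ᵐ p ∂((surfaceMeasure d).prod (surfaceMeasure d)), p.1 ≠ p.2 := by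
  have h : ((surfaceMeasure d).prod (surfaceMeasure d)) (diagonal (USphere d)) = 0 := by
    rw [Measure.measure_prod_null measurableSet_diagonal]
    refine ae_of_all _ fun ω => ?_
    have : Prod.mk ω ⁻¹' diagonal (USphere d) = {ω} := by
      ext x
      simp [eq_comm]
    simp only [this, surfaceMeasure_singleton hd, Pi.zero_apply]
  rw [ae_iff]
  simpa [diagonal] using h

/-- Rectangles form a π-system generating the product σ-algebra; the vanishing total integral
handles complements. -/
lemma ae_eq_zero_of_setIntegral_prod_eq_zero {α β : Type*} [MeasurableSpace α]
    [MeasurableSpace β] {μ : Measure (α × β)} {f : α × β → ℂ} (hf : Integrable f μ)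
    (huniv : ∫ p, f p ∂μ = 0)
    (h : ∀ s t, MeasurableSet s → MeasurableSet t → ∫ p in s ×ˢ t, f p ∂μ = 0) :
    f =ᵐ[μ] 0 := by
  refine hf.ae_eq_zero_of_forall_setIntegral_eq_zero fun E hE hfin => ?_
  clear hfin
  induction E, hE using MeasurableSpace.induction_on_inter generateFrom_prod.symm isPiSystem_prod with
  | empty => simp
  | basic t ht =>
    obtain ⟨s, hs, t, ht, rfl⟩ := ht
    exact h s t hs ht
  | compl t ht ih =>
    rw [setIntegral_compl ht hf, huniv, ih, sub_zero]
  | iUnion g hd hm ih =>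
    rw [integral_iUnion hm hd hf.integrableOn, tsum_congr ih, tsum_zero]

lemma indicator_mul_mul_indicator (f : USphere d → USphere d → ℂ) (A B : Set (USphere d)) :
    (fun p : USphere d × USphere d => A.indicator (fun _ => (1 : ℂ)) p.1 * f p.1 p.2 *
      B.indicator (fun _ => (1 : ℂ)) p.2) = (A ×ˢ B).indicator fun p => f p.1 p.2 := by
  ext p
  by_cases h1 : p.1 ∈ A <;> by_cases h2 : p.2 ∈ B <;> simp [indicator, h1, h2]

lemma disjoint_tsupport_indicator {U V A B : Set (USphere d)} (hU : IsClosed U) (hV : IsClosed V)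
    (hUV : Disjoint U V) (hA : A ⊆ U) (hB : B ⊆ V) :
    Disjoint (tsupport (A.indicator fun _ => (1 : ℂ))) (tsupport (B.indicator fun _ => (1 : ℂ))) :=
  hUV.mono (closure_minimal (support_indicator_subset.trans hA) hU)
    (closure_minimal (support_indicator_subset.trans hB) hV)

lemma memLp_top_indicator_one {A : Set (USphere d)} (hA : MeasurableSet A) :
    MemLp (A.indicator fun _ => (1 : ℂ)) ∞ (surfaceMeasure d) :=
  (memLp_const (1 : ℂ)).indicator hA

lemma IsOffDiagonalKernel.integrableOn_prod {T : L2Sphere d →L[ℂ] L2Sphere d}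
    {s : USphere d → USphere d → ℂ} (hs : IsOffDiagonalKernel T s) {U V : Set (USphere d)}
    (hU : IsClosed U) (hV : IsClosed V) (hUV : Disjoint U V) :
    IntegrableOn (fun p : USphere d × USphere d => s p.1 p.2) (U ×ˢ V)
      ((surfaceMeasure d).prod (surfaceMeasure d)) := by
  have h := (hs _ _ (memLp_top_indicator_one hU.measurableSet)
    (memLp_top_indicator_one hV.measurableSet)
    (disjoint_tsupport_indicator hU hV hUV subset_rfl subset_rfl)).1
  rwa [indicator_mul_mul_indicator,
    integrable_indicator_iff (hU.measurableSet.prod hV.measurableSet)] at h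

lemma IsOffDiagonalKernel.setIntegral_prod_eq {T : L2Sphere d →L[ℂ] L2Sphere d}
    {s s' : USphere d → USphere d → ℂ} (hs : IsOffDiagonalKernel T s)
    (hs' : IsOffDiagonalKernel T s') {U V : Set (USphere d)}
    (hU : IsClosed U) (hV : IsClosed V) (hUV : Disjoint U V) {A B : Set (USphere d)}
    (hA : MeasurableSet A) (hB : MeasurableSet B) (hAU : A ⊆ U) (hBV : B ⊆ V) :
    ∫ p in A ×ˢ B, s p.1 p.2 ∂((surfaceMeasure d).prod (surfaceMeasure d))
      = ∫ p in A ×ˢ B, s' p.1 p.2 ∂((surfaceMeasure d).prod (surfaceMeasure d)) := by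
  have h := (hs _ _ (memLp_top_indicator_one hA) (memLp_top_indicator_one hB)
    (disjoint_tsupport_indicator hU hV hUV hAU hBV)).2
  rw [(hs' _ _ (memLp_top_indicator_one hA) (memLp_top_indicator_one hB)
    (disjoint_tsupport_indicator hU hV hUV hAU hBV)).2, indicator_mul_mul_indicator,
    indicator_mul_mul_indicator, integral_indicator (hA.prod hB),
    integral_indicator (hA.prod hB)] at h
  exact h.symm

lemma IsOffDiagonalKernel.ae_eq_on_prod {T : L2Sphere d →L[ℂ] L2Sphere d}
    {s s' : USphere d → USphere d → ℂ} (hs : IsOffDiagonalKernel T s)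
    (hs' : IsOffDiagonalKernel T s') {U V : Set (USphere d)}
    (hU : IsClosed U) (hV : IsClosed V) (hUV : Disjoint U V) :
    ∀ᵐ p ∂(((surfaceMeasure d).prod (surfaceMeasure d)).restrict (U ×ˢ V)),
      s p.1 p.2 = s' p.1 p.2 := by
  have hi := hs.integrableOn_prod hU hV hUV
  have hi' := hs'.integrableOn_prod hU hV hUV
  have h : (fun p : USphere d × USphere d => s p.1 p.2 - s' p.1 p.2)
      =ᵐ[((surfaceMeasure d).prod (surfaceMeasure d)).restrict (U ×ˢ V)] 0 := by
    refine ae_eq_zero_of_setIntegral_prod_eq_zero (hi.sub hi') ?_ fun A B hA hB => ?_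
    · rw [integral_sub hi hi', hs.setIntegral_prod_eq hs' hU hV hUV hU.measurableSet
        hV.measurableSet subset_rfl subset_rfl, sub_self]
    · rw [integral_sub hi.integrableOn hi'.integrableOn, Measure.restrict_restrict (hA.prod hB),
        prod_inter_prod, hs.setIntegral_prod_eq hs' hU hV hUV (hA.inter hU.measurableSet)
        (hB.inter hV.measurableSet) inter_subset_right inter_subset_right, sub_self]
  filter_upwards [h] with p hp
  exact sub_eq_zero.1 hp

/-- Indicators supported in disjoint closed sets U, V determine the kernel a.e. on U × V. Such
products are neighbourhoods of every off-diagonal point, a locally null set is null, and the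
diagonal is itself null. -/
lemma IsOffDiagonalKernel.ae_eq (hd : 2 ≤ d) {T : L2Sphere d →L[ℂ] L2Sphere d}
    {s s' : USphere d → USphere d → ℂ} (hs : IsOffDiagonalKernel T s)
    (hs' : IsOffDiagonalKernel T s') :
    ∀ᵐ p ∂((surfaceMeasure d).prod (surfaceMeasure d)), s p.1 p.2 = s' p.1 p.2 := by
  have hnull : ((surfaceMeasure d).prod (surfaceMeasure d))
      {p | p.1 ≠ p.2 ∧ s p.1 p.2 ≠ s' p.1 p.2} = 0 := by
    refine measure_null_of_locally_null _ fun p hp => ?_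
    have hdist : 0 < dist p.1 p.2 := dist_pos.2 hp.1
    -- A third of the distance keeps the closed balls of radius r disjoint.
    set r := dist p.1 p.2 / 3 with hr
    have hr0 : 0 < r := by positivity
    have hUV : Disjoint (Metric.closedBall p.1 r) (Metric.closedBall p.2 r) :=
      Metric.closedBall_disjoint_closedBall (by linarith)
    have h := hs.ae_eq_on_prod hs' Metric.isClosed_closedBall Metric.isClosed_closedBall hUV
    rw [ae_restrict_iff' (Metric.isClosed_closedBall.measurableSet.prod
      Metric.isClosed_closedBall.measurableSet), ae_iff] at h
    refine ⟨_, inter_mem_nhdsWithin _ (prod_mem_nhds (Metric.closedBall_mem_nhds p.1 hr0)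
      (Metric.closedBall_mem_nhds p.2 hr0)), measure_mono_null (fun q hq => ?_) h⟩
    exact fun hq' => hq.1.2 (hq' hq.2)
  filter_upwards [ae_prod_fst_ne_snd hd, measure_eq_zero_iff_ae_notMem.1 hnull] with p h1 h2
  by_contra h3
  exact h2 ⟨h1, h3⟩

lemma kernelPairing_sphereGauge {φ₀ : RSpace d → ℝ} (hφ₀ : Measurable φ₀)
    (T : L2Sphere d →L[ℂ] L2Sphere d) (u v : L2Sphere d) :
    kernelPairing (sphereGauge φ₀ T) u v = kernelPairing T
      (phaseMul (fun ω : USphere d => φ₀ ω) u)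
      (phaseMul (fun ω : USphere d => -φ₀ (-(ω : RSpace d))) v) := by
  have hg : Measurable fun ω : USphere d => φ₀ ω := hφ₀.comp measurable_subtype_coe
  refine integral_congr_ae ?_
  filter_upwards [phaseMul_coeFn hg u, phaseMul_coeFn hg
    (T (phaseMul (fun ω : USphere d => -φ₀ (-(ω : RSpace d))) v))] with ω h1 h2
  rw [h1, sphereGauge, ContinuousLinearMap.comp_apply, ContinuousLinearMap.comp_apply, h2]
  ring

/-- The phase never vanishes; hence gauged test functions still have disjoint supports. -/
lemma tsupport_phase_mul (g : USphere d → ℝ) (u : USphere d → ℂ) :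
    tsupport (fun ω => Complex.exp (Complex.I * (g ω : ℂ)) * u ω) = tsupport u := by
  rw [tsupport, tsupport]
  congr 1
  ext ω
  simp [Complex.exp_ne_zero]

lemma memLp_top_phase_mul {g : USphere d → ℝ} (hg : Measurable g) {u : USphere d → ℂ}
    (hu : MemLp u ∞ (surfaceMeasure d)) :
    MemLp (fun ω => Complex.exp (Complex.I * (g ω : ℂ)) * u ω) ∞ (surfaceMeasure d) :=
  hu.mul (memLp_phase hg)

/-- Apply the kernel property of T to e^{iφ₀(ω)}u and e^{-iφ₀(-ω')}v and regroup the phases around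
s. -/
lemma IsOffDiagonalKernel.sphereGauge {φ₀ : RSpace d → ℝ} (hφ₀ : Measurable φ₀)
    {T : L2Sphere d →L[ℂ] L2Sphere d} {s : USphere d → USphere d → ℂ}
    (hs : IsOffDiagonalKernel T s) :
    IsOffDiagonalKernel (sphereGauge φ₀ T) fun ω ω' => amplitudeFactor φ₀ ω ω' * s ω ω' := by
  intro u v hu hv huv
  have hg : Measurable fun ω : USphere d => φ₀ ω := hφ₀.comp measurable_subtype_coe
  have hk : Measurable fun ω : USphere d => -φ₀ (-(ω : RSpace d)) :=
    (hφ₀.comp measurable_subtype_coe.neg).fun_neg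
  obtain ⟨h1, h2⟩ := hs _ _ (memLp_top_phase_mul hg hu) (memLp_top_phase_mul hk hv)
    (by rwa [tsupport_phase_mul, tsupport_phase_mul])
  have e : (fun p : USphere d × USphere d =>
      Complex.exp (Complex.I * (φ₀ p.1 : ℂ)) * u p.1 * s p.1 p.2 *
        (Complex.exp (Complex.I * ((-φ₀ (-(p.2 : RSpace d)) : ℝ) : ℂ)) * v p.2))
      = fun p => u p.1 * (amplitudeFactor φ₀ p.1 p.2 * s p.1 p.2) * v p.2 := by
    ext p
    rw [amplitudeFactor, sub_eq_add_neg, Complex.exp_add]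
    push_cast
    rw [mul_neg]
    ring
  rw [e] at h1 h2
  refine ⟨h1, h2 ▸ integral_congr_ae ?_⟩
  have hv' : (memLp_top_phase_mul hk hv |>.mono_exponent le_top).toLp _ =
      phaseMul (fun ω : USphere d => -φ₀ (-(ω : RSpace d)))
        ((hv.mono_exponent le_top).toLp v : L2Sphere d) :=
    (memLp_of_ae_eq_phase_mul hk (hv.mono_exponent le_top) (ae_eq_refl _)).2
  filter_upwards [phaseMul_coeFn hg (T (phaseMul (fun ω : USphere d => -φ₀ (-(ω : RSpace d)))
    ((hv.mono_exponent le_top).toLp v : L2Sphere d)))] with ω hω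
  rw [hv', _root_.sphereGauge, ContinuousLinearMap.comp_apply, ContinuousLinearMap.comp_apply, hω]
  ring

lemma kernelsGaugeRelated_sphereGauge (hd : 2 ≤ d) {φ₀ : RSpace d → ℝ} (hφ₀ : Measurable φ₀)
    (T : L2Sphere d →L[ℂ] L2Sphere d) : KernelsGaugeRelated φ₀ T (sphereGauge φ₀ T) :=
  ⟨kernelPairing_sphereGauge hφ₀ T, fun _ hs => hs.sphereGauge hφ₀,
    fun _ _ hs hs' => hs'.ae_eq hd (hs.sphereGauge hφ₀)⟩

end Kernels

end

theorem mainTheorem9 (d : ℕ) (hd : 2 ≤ d)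
    (A : RSpace d → RSpace d) (hA : LocallyL2 A)
    (φ φ₀ : RSpace d → ℝ) (hφ : Differentiable ℝ φ)
    (hφ₀ : ∀ x, x ≠ 0 → φ₀ x = φ₀ (‖x‖⁻¹ • x))
    (hlim : Tendsto (fun x => φ x - φ₀ x) (Bornology.cobounded (RSpace d)) (𝓝 0))
    (H H₀ Ht : L2Space d →ₗ.[ℂ] L2Space d)
    (hH : H = magneticSchrodinger A) (hH₀ : H₀ = freeHamiltonian d)
    (hHt : Ht = gaugeConj φ H) :
    -- the gauge transformed operator is the one with the magnetic potential `A + grad φ`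
    (LocallyL2 (fun x => A x + gradient φ x) →
      Ht = magneticSchrodinger (fun x => A x + gradient φ x)) ∧
    -- the wave operator for `t → +∞`
    (WaveOperatorExists H H₀ atTop →
      WaveOperatorExists Ht H₀ atTop ∧
      waveOperator Ht H₀ atTop =
        (phaseMul φ).comp ((waveOperator H H₀ atTop).comp (fourierPhase fun ξ => -φ₀ ξ))) ∧
    -- the wave operator for `t → -∞`
    (WaveOperatorExists H H₀ atBot →
      WaveOperatorExists Ht H₀ atBot ∧
      waveOperator Ht H₀ atBot =
        (phaseMul φ).comp ((waveOperator H H₀ atBot).comp (fourierPhase fun ξ => -φ₀ (-ξ)))) ∧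
    (WaveOperatorExists H H₀ atTop → WaveOperatorExists H H₀ atBot →
      -- the scattering operators
      (fourierL2 d).comp ((scatteringOperator Ht H₀).comp
          (ContinuousLinearMap.adjoint (fourierL2 d))) =
        (phaseMul φ₀).comp
          (((fourierL2 d).comp ((scatteringOperator H H₀).comp
            (ContinuousLinearMap.adjoint (fourierL2 d)))).comp (phaseMul fun ξ => -φ₀ (-ξ))) ∧
      -- the scattering matrix for the pair `H₀, Ht`, for all `λ > 0`
      (∀ S, IsScatteringMatrix (scatteringOperator H H₀) S →
        IsScatteringMatrix (scatteringOperator Ht H₀) (fun lam => sphereGauge φ₀ (S lam))) ∧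
      (∀ S St, IsScatteringMatrix (scatteringOperator H H₀) S →
        IsScatteringMatrix (scatteringOperator Ht H₀) St →
        (∀ᵐ lam ∂(volume.restrict (Ioi (0 : ℝ))),
          St lam = sphereGauge φ₀ (S lam) ∧ KernelsGaugeRelated φ₀ (S lam) (St lam)) ∧
        (WeaklyContinuousOnPos S → WeaklyContinuousOnPos St →
          ∀ lam : ℝ, 0 < lam →
            St lam = sphereGauge φ₀ (S lam) ∧ KernelsGaugeRelated φ₀ (S lam) (St lam)))) := by
  subst hH hH₀ hHt
  have hφm : Measurable φ := hφ.continuous.measurable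
  have hφ₀m : Measurable φ₀ := measurable_radialLimit hφ.continuous hφ₀ hlim
  have : Nontrivial (RSpace d) :=
    Module.nontrivial_of_finrank_pos (R := ℝ) (by rw [finrank_euclideanSpace_fin]; omega)
  have hne : ∀ᵐ ξ ∂(volume : Measure (RSpace d)), ξ ≠ 0 := Measure.ae_ne volume 0
  have hp := fun h => waveOperatorExists_gaugeConj (H := magneticSchrodinger A)
    (eventually_ne_atTop (0 : ℝ)) tendsto_inv_atTop_zero hφm hφ₀m
    (hne.mono fun ξ hξ => tendsto_atTop_radial hφ₀ hlim hξ) h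
  have hm := fun h => waveOperatorExists_gaugeConj (H := magneticSchrodinger A)
    (eventually_ne_atBot (0 : ℝ)) tendsto_inv_atBot_zero hφm (hφ₀m.comp measurable_neg)
    (hne.mono fun ξ hξ => tendsto_atBot_radial hφ₀ hlim hξ) h
  refine ⟨gaugeConj_magneticSchrodinger hA hφ, hp, hm, fun hWp hWm => ?_⟩
  have hS := scatteringOperator_eq_of_waveOperator_eq hφm hφ₀m (hp hWp).2 (hm hWm).2
  have hgauge := fun S (h : IsScatteringMatrix _ S) => h.sphereGauge hφ₀m
    (fun c hc x => homogeneous_smul hφ₀ hc x) hS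
  refine ⟨fourierL2_conj_fourierPhase hS, hgauge, fun S St h ht => ?_⟩
  -- The gauged family is one scattering matrix of the transformed pair, so uniqueness identifies
  -- any other with it a.e.
  have hae := ht.ae_eq (hgauge S h)
  refine ⟨hae.mono fun lam hl => ⟨hl, hl ▸ kernelsGaugeRelated_sphereGauge hd hφ₀m _⟩,
    fun hc hct lam hlam => ?_⟩
  have hl := eq_sphereGauge_of_weaklyContinuous hφ₀m hc hct hae hlam
  exact ⟨hl, hl ▸ kernelsGaugeRelated_sphereGauge hd hφ₀m _⟩
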